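/- **Notation.** Let $T$ be a text over a finite ordered alphabet $\Sigma$ of size $\sigma\ge 2$ that terminates with a letter appearing nowhere else in $T$. A substring $w$ of $T$ that occurs at least twice is a *maximal repeat* if every string $wa$ and every string $aw$ ($a\in\Sigma$) occurs strictly fewer times in $T$ than $w$ (the empty string occurs $|T|+1$ times); let $\tilde e_T$ be the number of substrings $wa$ of $T$ plus the number of substrings $aw$ of $T$, with $w$ a maximal repeat and $a\in\Sigma$. The nodes of $\mathrm{CDAWG}(T)$ (*type-1 nodes*) are the classes, under equality of the sets of ending positions in $T$, of those substrings that are the longest with their set of beginning positions. The longest string of a node $v$ is denoted $\mathrm{value}(v)$, the source is the node of the empty string, and each edge leads from a node to the next node reached by reading one more letter and all letters forced by it. $\mathrm{L\text{-}CDAWG}(T)$ is obtained by inserting a *type-2 node* wherever the path from the source that spells out a substring $au$ of $T$, with $a\in\Sigma$ and $u$ the value of a type-1 node, ends in the middle of an edge. The *suffix link* of this type-2 node is the node with value $u$; that of a type-1 node $v$ other than the source is the node of the longest suffix of $\mathrm{value}(v)$ that does not belong to $v$. Each edge $e$, with original label $\mathrm{lab}(e)$, stores only its end points, the first letter of $\mathrm{lab}(e)$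 and the length $|\mathrm{lab}(e)|$; each node stores its type, its suffix link and its out-going edges, sorted by their first letters; the source is given. For an edge $e=(u,v)$ with $|\mathrm{lab}(e)|\ge2$ let $(e_1,\dots,e_k)$ be the path from the suffix link of $u$ that spells out $\mathrm{lab}(e)$; then $\mathrm{jump}(e)=(e_1,\dots,e_k)$ if $k\ge2$, and $\mathrm{jump}(e)=\mathrm{jump}(e_1)$ if $k=1$. A *straight-line program* (SLP) is a loop-free context-free grammar with exactly one production, $X\to a$ or $X\to YZ$, for each variable $X$, and a designated start variable. **Theorem.** There are a single algorithm (on a random access machine with words of $O(\log |T|)$ bits, which only copies and compares letters) and an absolute constant $C$ such that for all $\Sigma$ and $T$ as above, given $\mathrm{L\text{-}CDAWG}(T)$ without its edge labels and without $T$, the algorithm constructs in at most $C\,\tilde e_T\log_2\sigma$ steps an SLP with at most $C\,\tilde e_T$ productions, together with pairwise distinct variables $X(e)$, one for each edge $e$ of $\mathrm{L\text{-}CDAWG}(T)$, such that $X(e)$ derives $\mathrm{lab}(e)$ for every edge $e$ and the start variable derives $T$. Moreover, $X(e)\to \mathrm{lab}(e)$ is a production if $|\mathrm{lab}(e)|=1$;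 if $|\mathrm{lab}(e)|\ge2$, then $\mathrm{jump}(e)=(e'_1,\dots,e'_k)$ is defined, $k\ge 2$, and $X(e)$ is expanded by productions $X(e)\to X(e'_1)Y_1,\ Y_1\to X(e'_2)Y_2,\ \dots,\ Y_{k-2}\to X(e'_{k-1})X(e'_k)$ (just $X(e)\to X(e'_1)X(e'_2)$ if $k=2$); and the start variable is expanded in the same way along the path from the source that spells out $T$ (it is $X(e)$ if that path is a single edge $e$). -/

import Mathlib

namespace LinCDAWG

/-! ### Occurrences, maximal repeats, extensions -/

section Strings

variable {α : Type*}

/-- The (0-based) positions at which an occurrence of `x` in `T` begins.  The empty string begins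
at each of the `|T| + 1` positions `0, …, |T|`. -/
def begPos (T x : List α) : Set ℕ := {i | i ≤ T.length ∧ x <+: T.drop i}

/-- The positions at which an occurrence of `x` in `T` ends. -/
def endPos (T x : List α) : Set ℕ := {j | j ≤ T.length ∧ x <:+ T.take j}

/-- The number of occurrences of `x` in `T`. -/
noncomputable def occ (T x : List α) : ℕ := (begPos T x).ncard

/-- `w` is a maximal repeat of `T`: it occurs at least twice, and each of its left and right
extensions by one letter occurs strictly fewer times. -/
def IsMaxRepeat (T w : List α) : Prop :=
  w <:+: T ∧ 1 < occ T w ∧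
    (∀ a : α, occ T (w ++ [a]) < occ T w) ∧ (∀ a : α, occ T (a :: w) < occ T w)

/-- The right extensions of the maximal repeats of `T`. -/
def rightExt (T : List α) : Set (List α) :=
  {x | x <:+: T ∧ ∃ w a, IsMaxRepeat T w ∧ x = w ++ [a]}

/-- The left extensions of the maximal repeats of `T`. -/
def leftExt (T : List α) : Set (List α) :=
  {x | x <:+: T ∧ ∃ w a, IsMaxRepeat T w ∧ x = a :: w}

/-- The number of right extensions plus the number of left extensions of maximal repeats. -/
noncomputable def numExt (T : List α) : ℕ := (rightExt T).ncard + (leftExt T).ncard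

/-- `T` terminates with a letter that appears nowhere else in `T`. -/
def HasEndMarker (T : List α) : Prop := ∃ w d, T = w ++ [d] ∧ d ∉ w

end Strings

/-! ### The CDAWG and the L-CDAWG of a text -/

section Graph

variable {α : Type*}

/-- `x` and `y` have the same beginning positions in `T`. -/
def EqL (T x y : List α) : Prop := begPos T x = begPos T y

/-- `x` and `y` have the same ending positions in `T`. -/
def EqR (T x y : List α) : Prop := endPos T x = endPos T y

/-- The substring `x` of `T` is the longest string with its beginning positions, that is, the path
that spells out `x` from the source of the CDAWG of `T` ends at a node. -/
def Explicit (T x : List α) : Prop := x <:+: T ∧ ∀ y, EqL T x y → y.length ≤ x.length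

/-- `x` is the longest string of a CDAWG node.  A node of the CDAWG is the class, under equality of
ending positions, of an explicit string; we name it by its longest member. -/
def IsValue (T x : List α) : Prop := Explicit T x ∧ ∀ y, EqR T x y → y.length ≤ x.length

/-- A point of the CDAWG: `off` is read downwards from the CDAWG node whose longest string is
`base`.  The point is the node itself if `off = []`; otherwise it is in the middle of an edge. -/
@[ext] structure Point (α : Type*) where
  base : List α
  off : List α

/-- The longest string that leads from the source to the point `v`. -/
def Point.str (v : Point α) : List α := v.base ++ v.off

/-- The path that spells out the substring `y` of `T` from the source of the CDAWG ends at the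
point `v`: `y = s ++ v.off`, where `s` is the longest explicit prefix of `y`, and `s` belongs to
the node `v.base`. -/
def EndsAt (T y : List α) (v : Point α) : Prop :=
  y <:+: T ∧ IsValue T v.base ∧ ∃ s, y = s ++ v.off ∧ Explicit T s ∧ EqR T s v.base ∧
    ∀ γ, γ <+: v.off → γ ≠ [] → ¬ Explicit T (s ++ γ)

/-- Type-1 nodes: the nodes of the CDAWG. -/
def IsType1 (T : List α) (v : Point α) : Prop := IsValue T v.base ∧ v.off = []

/-- Type-2 nodes: points in the middle of a CDAWG edge at which the path that spells out `a :: u`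
ends, for a letter `a` and the longest string `u` of a CDAWG node. -/
def IsType2 (T : List α) (v : Point α) : Prop :=
  v.off ≠ [] ∧ ∃ a u, IsValue T u ∧ EndsAt T (a :: u) v

/-- The nodes of the L-CDAWG. -/
def IsNode (T : List α) (v : Point α) : Prop := IsType1 T v ∨ IsType2 T v

/-- `(u, x, v)` is an edge of the L-CDAWG with its original label `x`: reading `x` from the node `u`
leads to the node `v`, without meeting a node in between. -/
def IsEdge (T : List α) (u : Point α) (x : List α) (v : Point α) : Prop :=
  IsNode T u ∧ IsNode T v ∧ x ≠ [] ∧ EndsAt T (u.str ++ x) v ∧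
    ∀ y, y <+: x → y ≠ [] → y ≠ x → ∀ w, EndsAt T (u.str ++ y) w → ¬ IsNode T w

/-- Suffix links.  From a type-1 node: to the node of the longest suffix of its longest string that
does not belong to it.  From the type-2 node at which `a :: u` ends: to the node of `u`.  The source
has no suffix link. -/
def IsSLink (T : List α) (v w : Point α) : Prop :=
  (IsType1 T v ∧ IsType1 T w ∧ ∃ y, y <:+ v.base ∧ ¬ EqR T y v.base ∧
      (∀ z, z <:+ v.base → y.length < z.length → EqR T z v.base) ∧ EndsAt T y w) ∨
  (IsType2 T v ∧ ∃ a u, IsValue T u ∧ EndsAt T (a :: u) v ∧ w = ⟨u, []⟩)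

/-- The L-CDAWG of `T` as a data structure.  Stored are only the numbers of nodes and edges, the
source, the types and suffix links of the nodes, and the end points, first letter and label length
of each edge; the out-going edges of a node are consecutive and sorted by their first letters
(node `i` has the edges `first i, …, first i + deg i - 1`).  The numbering is otherwise arbitrary.
The entry `slink root` is without meaning.  The fields `point` and `label` are not stored; they say
which node and which edge label of the L-CDAWG the numbers stand for. -/
structure LCDAWG [LinearOrder α] (T : List α) where
  nodes : ℕ
  edges : ℕ
  root : Fin nodes
  type2 : Fin nodes → Bool
  slink : Fin nodes → Fin nodes
  first : Fin nodes → ℕ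
  deg : Fin nodes → ℕ
  hi : Fin edges → Fin nodes
  lo : Fin edges → Fin nodes
  chr : Fin edges → α
  slen : Fin edges → ℕ
  point : Fin nodes → Point α
  label : Fin edges → List α
  point_injective : Function.Injective point
  point_range : ∀ v, (∃ i, point i = v) ↔ IsNode T v
  edge_injective : Function.Injective fun e => (point (hi e), label e, point (lo e))
  edge_range : ∀ u x v, (∃ e, point (hi e) = u ∧ label e = x ∧ point (lo e) = v) ↔ IsEdge T u x v
  root_spec : point root = ⟨[], []⟩
  type2_spec : ∀ i, type2 i = true ↔ IsType2 T (point i)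
  slink_spec : ∀ i, i ≠ root → IsSLink T (point i) (point (slink i))
  chr_spec : ∀ e, (label e).head? = some (chr e)
  slen_spec : ∀ e, slen e = (label e).length
  out_le : ∀ i, first i + deg i ≤ edges
  out_spec : ∀ i (e : Fin edges), hi e = i ↔ first i ≤ e ∧ (e : ℕ) < first i + deg i
  out_sorted : ∀ e e', hi e = hi e' → e < e' → chr e < chr e'

variable [LinearOrder α] {T : List α}

/-- `p` is a path of edges that starts at the node `i`. -/
def LCDAWG.IsPathFrom (L : LCDAWG T) : Fin L.nodes → List (Fin L.edges) → Prop
  | _, [] => True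
  | i, e :: p => L.hi e = i ∧ L.IsPathFrom (L.lo e) p

/-- The label string of a path. -/
def LCDAWG.pathLabel (L : LCDAWG T) (p : List (Fin L.edges)) : List α := p.flatMap L.label

/-- `p` is the edge suffix link of `e`: the path from the suffix link of `e.hi` that spells out the
label of `e`. -/
def LCDAWG.IsESuf (L : LCDAWG T) (e : Fin L.edges) (p : List (Fin L.edges)) : Prop :=
  2 ≤ L.slen e ∧ L.IsPathFrom (L.slink (L.hi e)) p ∧ L.pathLabel p = L.label e

/-- `p` is the jump link of `e`: edge suffix links are followed until a path of at least two edges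
is reached. -/
inductive LCDAWG.IsJump (L : LCDAWG T) : Fin L.edges → List (Fin L.edges) → Prop
  | done {e p} : L.IsESuf e p → 2 ≤ p.length → L.IsJump e p
  | step {e e₁ p} : L.IsESuf e [e₁] → L.IsJump e₁ p → L.IsJump e p

end Graph

/-! ### Straight-line programs -/

section SLPs

/-- A straight-line program with variables `0, …, size - 1`: each variable has exactly one
production, of the form `X → a` (`Sum.inl a`) or `X → YZ` (`Sum.inr (Y, Z)`), without loops. -/
structure SLP (α : Type*) where
  size : ℕ
  rule : Fin size → α ⊕ (Fin size × Fin size)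
  start : Fin size
  acyclic : WellFounded fun j i : Fin size => ∃ k, rule i = Sum.inr (j, k) ∨ rule i = Sum.inr (k, j)

variable {α : Type*}

/-- The phrase of a variable: the string that it produces. -/
noncomputable def SLP.phrase (R : SLP α) : Fin R.size → List α :=
  R.acyclic.fix fun i ih =>
    match h : R.rule i with
    | Sum.inl a => [a]
    | Sum.inr (j, k) => ih j ⟨k, Or.inl h⟩ ++ ih k ⟨j, Or.inr h⟩

theorem SLP.phrase_inl (R : SLP α) {i : Fin R.size} {a : α} (h : R.rule i = Sum.inl a) :
    R.phrase i = [a] := by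
  rw [SLP.phrase, WellFounded.fix_eq]
  split
  · simp_all
  · simp_all

theorem SLP.phrase_inr (R : SLP α) {i j k : Fin R.size} (h : R.rule i = Sum.inr (j, k)) :
    R.phrase i = R.phrase j ++ R.phrase k := by
  rw [SLP.phrase, WellFounded.fix_eq]
  split
  · simp_all
  · next j' k' h' =>
    obtain ⟨rfl, rfl⟩ : j' = j ∧ k' = k := by simpa [h] using h'.symm.trans h
    rfl

/-- The variable `v` is expanded along the list `p` by intermediate productions: for
`p = [e₁, …, e_k]` the productions are `v → X(e₁) Y₁`, `Y₁ → X(e₂) Y₂`, …, and finally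
`Y → X(e_{k-1}) X(e_k)`.  For `p = [e]` it says that `v` is `X(e)`. -/
inductive SLP.Expands (R : SLP α) {E : Type*} (X : E → Fin R.size) : Fin R.size → List E → Prop
  | single (e : E) : R.Expands X (X e) [e]
  | cons {v y : Fin R.size} {e : E} {p : List E} :
      R.rule v = Sum.inr (X e, y) → R.Expands X y p → R.Expands X v (e :: p)

end SLPs

/-! ### The machine model: a random access machine over a general ordered alphabet

A machine has integer registers, finitely many integer arrays and finitely many letter arrays (those
that its program mentions), all with random access.  Letters can be copied and compared, and nothing
else.  Programs are structured; each operation, each memory access, each test and each assignment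
takes one step. -/

section Machine

/-- A state of the machine; a letter cell may be blank. -/
structure State (α : Type*) where
  reg : ℕ → ℕ
  mem : ℕ → ℕ → ℕ
  chr : ℕ → ℕ → Option α

/-- Integer expressions. -/
inductive Expr
  | const (k : ℕ)
  | reg (r : ℕ)
  | read (a : ℕ) (i : Expr)
  | plus (e f : Expr)
  | minus (e f : Expr)
  | half (e : Expr)

/-- Tests.  `chrLt a i b j` compares the letter in cell `i` of letter array `a` with the letter in
cell `j` of letter array `b`; it fails if one of them is blank. -/
inductive Test
  | lt (e f : Expr)
  | eq (e f : Expr)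
  | chrLt (a : ℕ) (i : Expr) (b : ℕ) (j : Expr)
  | chrEq (a : ℕ) (i : Expr) (b : ℕ) (j : Expr)

/-- Programs. -/
inductive Prog
  | skip
  | set (r : ℕ) (e : Expr)
  | write (a : ℕ) (i e : Expr)
  | copyChr (a : ℕ) (i : Expr) (b : ℕ) (j : Expr)
  | seq (p q : Prog)
  | ite (c : Test) (p q : Prog)
  | loop (c : Test) (p : Prog)

variable {α : Type*}

/-- The value of an expression (`minus` is truncated subtraction, `half` rounds down). -/
def Expr.val (s : State α) : Expr → ℕ
  | .const k => k
  | .reg r => s.reg r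
  | .read a i => s.mem a (i.val s)
  | .plus e f => e.val s + f.val s
  | .minus e f => e.val s - f.val s
  | .half e => e.val s / 2

/-- All values that arise in the evaluation of the expression are at most `B`. -/
def Expr.Fits (B : ℕ) (s : State α) : Expr → Prop
  | .const k => k ≤ B
  | .reg r => s.reg r ≤ B
  | .read a i => i.Fits B s ∧ s.mem a (i.val s) ≤ B
  | .plus e f => e.Fits B s ∧ f.Fits B s ∧ e.val s + f.val s ≤ B
  | .minus e f => e.Fits B s ∧ f.Fits B s
  | .half e => e.Fits B s

/-- The number of steps that the evaluation of the expression takes. -/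
def Expr.cost : Expr → ℕ
  | .const _ => 1
  | .reg _ => 1
  | .read _ i => i.cost + 1
  | .plus e f => e.cost + f.cost + 1
  | .minus e f => e.cost + f.cost + 1
  | .half e => e.cost + 1

/-- The test succeeds. -/
def Test.Holds [LinearOrder α] (s : State α) : Test → Prop
  | .lt e f => e.val s < f.val s
  | .eq e f => e.val s = f.val s
  | .chrLt a i b j => ∃ x y, s.chr a (i.val s) = some x ∧ s.chr b (j.val s) = some y ∧ x < y
  | .chrEq a i b j => s.chr a (i.val s) = s.chr b (j.val s)

/-- All values that arise in the test are at most `B`. -/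
def Test.Fits (B : ℕ) (s : State α) : Test → Prop
  | .lt e f | .eq e f | .chrLt _ e _ f | .chrEq _ e _ f => e.Fits B s ∧ f.Fits B s

/-- The number of steps that the test takes. -/
def Test.cost : Test → ℕ
  | .lt e f | .eq e f | .chrLt _ e _ f | .chrEq _ e _ f => e.cost + f.cost + 1

/-- Assign the value `x` to register `r`. -/
def State.setReg (s : State α) (r x : ℕ) : State α :=
  { s with reg := Function.update s.reg r x }

/-- Write the value `x` into cell `i` of integer array `a`. -/
def State.setMem (s : State α) (a i x : ℕ) : State α :=
  { s with mem := Function.update s.mem a (Function.update (s.mem a) i x) }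

/-- Write `x` into cell `i` of letter array `a`. -/
def State.setChr (s : State α) (a i : ℕ) (x : Option α) : State α :=
  { s with chr := Function.update s.chr a (Function.update (s.chr a) i x) }

/-- `Exec B p s t s'`: started in the state `s`, the program `p` halts after `t` steps in the state
`s'`, and all integers that arise in the computation, addresses included, are at most `B`. -/
inductive Exec [LinearOrder α] (B : ℕ) : Prog → State α → ℕ → State α → Prop
  | skip {s} : Exec B .skip s 1 s
  | set {s r e} : e.Fits B s → Exec B (.set r e) s (e.cost + 1) (s.setReg r (e.val s))
  | write {s a i e} : i.Fits B s → e.Fits B s →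
      Exec B (.write a i e) s (i.cost + e.cost + 1) (s.setMem a (i.val s) (e.val s))
  | copyChr {s a i b j} : i.Fits B s → j.Fits B s →
      Exec B (.copyChr a i b j) s (i.cost + j.cost + 1)
        (s.setChr a (i.val s) (s.chr b (j.val s)))
  | seq {p q s t s₁ t₁ s₂} : Exec B p s t s₁ → Exec B q s₁ t₁ s₂ →
      Exec B (.seq p q) s (t + t₁) s₂
  | ite_true {c p q s t s₁} : c.Fits B s → c.Holds s → Exec B p s t s₁ →
      Exec B (.ite c p q) s (c.cost + t) s₁
  | ite_false {c p q s t s₁} : c.Fits B s → ¬ c.Holds s → Exec B q s t s₁ →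
      Exec B (.ite c p q) s (c.cost + t) s₁
  | loop_false {c p s} : c.Fits B s → ¬ c.Holds s → Exec B (.loop c p) s c.cost s
  | loop_true {c p s t s₁ t₁ s₂} : c.Fits B s → c.Holds s → Exec B p s t s₁ →
      Exec B (.loop c p) s₁ t₁ s₂ → Exec B (.loop c p) s (c.cost + t + t₁) s₂

/-- An array of length `n` as memory contents, with the cells beyond it set to `d`. -/
def cells {β : Type*} (d : β) {n : ℕ} (f : Fin n → β) (i : ℕ) : β :=
  if h : i < n then f ⟨i, h⟩ else d

/-- The initial state: the stored part of the L-CDAWG is in registers 0–2, integer arrays 0–6 and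
letter array 0; all else is zero or blank. -/
def LCDAWG.initState [LinearOrder α] {T : List α} (L : LCDAWG T) : State α where
  reg := fun
    | 0 => L.nodes
    | 1 => L.edges
    | 2 => L.root
    | _ => 0
  mem := fun
    | 0 => cells 0 fun i => if L.type2 i then 1 else 0
    | 1 => cells 0 fun i => (L.slink i : ℕ)
    | 2 => cells 0 L.first
    | 3 => cells 0 L.deg
    | 4 => cells 0 fun e => (L.hi e : ℕ)
    | 5 => cells 0 fun e => (L.lo e : ℕ)
    | 6 => cells 0 L.slen
    | _ => fun _ => 0
  chr := fun
    | 0 => cells none fun e => some (L.chr e)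
    | _ => fun _ => none

/-- The state contains the straight-line program `R` with a table of the variables `X e`: the number
of productions and the start variable are in registers 0 and 1; integer array 7 tells whether the
production of a variable is `X → a` (entry 0, the letter is in letter array 1) or `X → YZ` (entry 1,
with `Y` in array 8 and `Z` in array 9); and integer array 10 holds the table. -/
def State.Stores (s : State α) (R : SLP α) {m : ℕ} (X : Fin m → Fin R.size) : Prop :=
  s.reg 0 = R.size ∧ s.reg 1 = R.start ∧
  (∀ i a, R.rule i = Sum.inl a → s.mem 7 i = 0 ∧ s.chr 1 i = some a) ∧
  (∀ i j k, R.rule i = Sum.inr (j, k) → s.mem 7 i = 1 ∧ s.mem 8 i = j ∧ s.mem 9 i = k) ∧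
  ∀ e : Fin m, s.mem 10 e = X e

end Machine

end LinCDAWG

/-!
Let `u` be the upper end of an edge `e`, and `s` its suffix link.  There is a letter `c` such that
`c · value(s)` leads to `u`.  The path from `s` that spells out `lab(e)` can meet a type-1 node only
at its ends: if a proper non-empty prefix `y` of `lab(e)` led from `s` to a type-1 node, then
`c · value(s) · y` would lead to a node in the middle of `e`.  So all inner nodes of that path are
of type 2, and its last node can be seen to be of type 1.  As a type-2 node has a single outgoing
edge, the path is determined by its first edge, the head, and two such paths that meet in an inner
node agree from there on.  One variable per edge, for the string from its upper end down to the next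
type-1 node, therefore provides all the `Y₁, …, Y_{k-2}`.

The head is found by binary search among the sorted outgoing edges of `s`, in `O(log σ)` steps.  If
it is the whole path, then `e` takes over the production of the head; each edge waits for another
one in this way at most once, so that the walks along these edges take linear time together.
The path of the text is the longest path of the L-CDAWG: the greatest distances from the source are
computed in topological order, and the path is traced back.  Finally, an edge out of a type-1 node
stands for a right extension of a maximal repeat and the only edge out of a type-2 node for a left
extension, hence there are at most `ẽ_T` edges.
-/

namespace LinCDAWG

/-! ### Occurrences -/

section Strings

variable {α : Type*} {T x y z : List α}

theorem infix_iff_endPos_nonempty : x <:+: T ↔ (endPos T x).Nonempty := by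
  constructor
  · rintro ⟨p, q, rfl⟩
    refine ⟨(p ++ x).length, by simp, ?_⟩
    rw [List.take_left]
    exact List.suffix_append p x
  · rintro ⟨j, _, h⟩
    exact h.isInfix.trans (List.take_prefix _ _).isInfix

theorem length_le_of_mem_endPos {j : ℕ} (h : j ∈ endPos T x) : x.length ≤ j :=
  h.2.length_le.trans (List.length_take_le j T)

theorem endPos_subset_of_suffix (h : y <:+ x) : endPos T x ⊆ endPos T y :=
  fun _ hj => ⟨hj.1, h.trans hj.2⟩

theorem begPos_subset_of_prefix (h : y <+: x) : begPos T x ⊆ begPos T y :=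
  fun _ hj => ⟨hj.1, h.trans hj.2⟩

theorem mem_endPos_append {j : ℕ} :
    j ∈ endPos T (x ++ z) ↔ ∃ i, j = i + z.length ∧ i ∈ endPos T x ∧ z <+: T.drop i := by
  constructor
  · rintro ⟨hj, p, hp⟩
    have hl := congrArg List.length hp
    simp only [List.length_append, List.length_take] at hl
    have hT : T = (p ++ x) ++ (z ++ T.drop j) := by
      conv_lhs => rw [← List.take_append_drop j T, ← hp]
      simp
    refine ⟨(p ++ x).length, by simp; omega, ⟨by simp; omega, ?_⟩, ?_⟩
    · rw [hT, List.take_left]; exact List.suffix_append p x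
    · rw [hT, List.drop_left]; exact List.prefix_append _ _
  · rintro ⟨i, rfl, ⟨hi, p, hp⟩, q, hq⟩
    have hT : T = (p ++ (x ++ z)) ++ q := by
      rw [← List.take_append_drop i T, ← hp, ← hq]; simp
    have hl := congrArg List.length hp
    simp only [List.length_append, List.length_take] at hl
    have : i + z.length = (p ++ (x ++ z)).length := by simp; omega
    refine ⟨by rw [this, hT]; simp, ?_⟩
    rw [this, hT, List.take_left]
    exact List.suffix_append _ _

theorem mem_begPos_iff {i : ℕ} : i ∈ begPos T x ↔ i + x.length ∈ endPos T x := by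
  have mem_nil : i ∈ endPos T ([] : List α) ↔ i ≤ T.length := by simp [endPos]
  rw [← List.nil_append x, mem_endPos_append, List.nil_append]
  constructor
  · rintro ⟨hi, hx⟩
    exact ⟨i, rfl, mem_nil.2 hi, hx⟩
  · rintro ⟨k, hk, hk', hx⟩
    obtain rfl : i = k := by omega
    exact ⟨hk'.1, hx⟩

theorem infix_iff_begPos_nonempty : x <:+: T ↔ (begPos T x).Nonempty := by
  rw [infix_iff_endPos_nonempty]
  constructor
  · rintro ⟨j, hj⟩
    refine ⟨j - x.length, mem_begPos_iff.2 ?_⟩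
    rwa [Nat.sub_add_cancel (length_le_of_mem_endPos hj)]
  · rintro ⟨i, hi⟩
    exact ⟨_, mem_begPos_iff.1 hi⟩

theorem EqR.symm (h : EqR T x y) : EqR T y x := Eq.symm h

theorem EqR.trans (h : EqR T x y) (h' : EqR T y z) : EqR T x z := Eq.trans h h'

theorem EqR.append (h : EqR T x y) (z : List α) : EqR T (x ++ z) (y ++ z) := by
  ext j
  rw [mem_endPos_append, mem_endPos_append, h]

theorem EqR.infix (h : EqR T x y) (hx : x <:+: T) : y <:+: T := by
  rw [infix_iff_endPos_nonempty] at *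
  rwa [← h]

theorem EqR.suffix (h : EqR T x y) (hx : x <:+: T) (hl : x.length ≤ y.length) : x <:+ y := by
  obtain ⟨j, hj⟩ := infix_iff_endPos_nonempty.1 hx
  have hj' : j ∈ endPos T y := by rwa [← h]
  exact List.suffix_of_suffix_length_le hj.2 hj'.2 hl

theorem EqR.of_suffix_of_suffix (h : EqR T x y) (h1 : x <:+ z) (h2 : z <:+ y) : EqR T z y :=
  Set.Subset.antisymm ((endPos_subset_of_suffix h1).trans h.subset) (endPos_subset_of_suffix h2)

theorem eqR_iff_subset_of_suffix (h : x <:+ y) : EqR T x y ↔ endPos T x ⊆ endPos T y :=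
  ⟨fun h => h.subset, fun h' => h'.antisymm (endPos_subset_of_suffix h)⟩

theorem EqL.prefix (h : EqL T x y) (hx : x <:+: T) (hl : x.length ≤ y.length) : x <+: y := by
  obtain ⟨i, hi⟩ := infix_iff_begPos_nonempty.1 hx
  have hi' : i ∈ begPos T y := by rwa [← h]
  exact List.prefix_of_prefix_length_le hi.2 hi'.2 hl

theorem EqL.of_prefix_of_prefix (h : EqL T x y) (h1 : x <+: z) (h2 : z <+: y) : EqL T x z :=
  Set.Subset.antisymm (h.subset.trans (begPos_subset_of_prefix h2)) (begPos_subset_of_prefix h1)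

theorem forall_eqR_length_le_iff (hx : x <:+: T) :
    (∀ y, EqR T x y → y.length ≤ x.length) ↔ ∀ a, ¬ EqR T x (a :: x) := by
  constructor
  · intro h a ha
    exact absurd (h _ ha) (by simp)
  · intro h y hy
    by_contra! hl
    obtain ⟨u, rfl⟩ := hy.suffix hx hl.le
    rcases List.eq_nil_or_concat u with rfl | ⟨u, a, rfl⟩
    · simp at hl
    · refine h a (hy.trans (hy.of_suffix_of_suffix (List.suffix_cons a x) ?_).symm)
      exact ⟨u, by simp⟩

theorem forall_eqL_length_le_iff (hx : x <:+: T) :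
    (∀ y, EqL T x y → y.length ≤ x.length) ↔ ∀ a, ¬ EqL T x (x ++ [a]) := by
  constructor
  · intro h a ha
    exact absurd (h _ ha) (by simp)
  · intro h y hy
    by_contra! hl
    obtain ⟨u, rfl⟩ := hy.prefix hx hl.le
    obtain - | ⟨a, u⟩ := u
    · simp at hl
    · exact h a (hy.of_prefix_of_prefix (List.prefix_append x [a]) ⟨u, by simp⟩)

theorem singleton_prefix_drop_iff {a : α} {i : ℕ} : [a] <+: T.drop i ↔ T[i]? = some a := by
  rw [List.prefix_iff_eq_take, List.length_singleton, List.take_one, List.head?_drop]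
  cases h : T[i]? <;> simp [eq_comm]

theorem eqL_concat_iff {a : α} :
    EqL T x (x ++ [a]) ↔ ∀ i ∈ endPos T x, T[i]? = some a := by
  have mem_concat : ∀ i, i ∈ begPos T (x ++ [a]) ↔
      i + x.length ∈ endPos T x ∧ T[i + x.length]? = some a := by
    intro i
    rw [mem_begPos_iff, mem_endPos_append, ← singleton_prefix_drop_iff]
    constructor
    · rintro ⟨k, hk, h⟩
      obtain rfl : i + x.length = k := by
        simp only [List.length_append, List.length_singleton] at hk
        omega
      exact h
    · exact fun h => ⟨_, by simp [add_assoc], h⟩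
  constructor
  · intro h j hj
    have hlen := Nat.sub_add_cancel (length_le_of_mem_endPos hj)
    have hb : j - x.length ∈ begPos T (x ++ [a]) := by
      rw [← h, mem_begPos_iff, hlen]
      exact hj
    rw [mem_concat, hlen] at hb
    exact hb.2
  · intro h
    ext i
    rw [mem_concat, mem_begPos_iff]
    exact ⟨fun hi => ⟨hi, h _ hi⟩, And.left⟩

/-! ### Explicit strings and values of nodes -/

theorem explicit_iff :
    Explicit T x ↔ x <:+: T ∧ ∀ a, ∃ i ∈ endPos T x, T[i]? ≠ some a := by
  refine and_congr_right fun hx => ?_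
  simp only [forall_eqL_length_le_iff hx, eqL_concat_iff, not_forall, exists_prop, ne_eq]

theorem Explicit.infix (h : Explicit T x) : x <:+: T := h.1

theorem Explicit.of_suffix (h : Explicit T x) (hy : y <:+ x) : Explicit T y := by
  rw [explicit_iff] at *
  refine ⟨hy.isInfix.trans h.1, fun a => ?_⟩
  obtain ⟨i, hi, hn⟩ := h.2 a
  exact ⟨i, endPos_subset_of_suffix hy hi, hn⟩

theorem Explicit.of_eqR (h : Explicit T x) (hy : EqR T x y) : Explicit T y := by
  have := hy.infix h.infix
  rw [explicit_iff] at *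
  exact ⟨this, by rw [← hy]; exact h.2⟩

theorem EqR.explicit_iff (hy : EqR T x y) : Explicit T x ↔ Explicit T y :=
  ⟨fun h => h.of_eqR hy, fun h => h.of_eqR hy.symm⟩

theorem explicit_of_suffix (h : x <:+ T) : Explicit T x :=
  explicit_iff.2 ⟨h.isInfix, fun _ => ⟨T.length, by simpa [endPos] using h, by simp⟩⟩

theorem explicit_nil : Explicit T [] := explicit_of_suffix List.nil_suffix

theorem exists_forced_of_not_explicit (hx : x <:+: T) (h : ¬ Explicit T x) :
    ∃ a, ∀ i ∈ endPos T x, T[i]? = some a := by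
  rw [explicit_iff] at h
  push Not at h
  exact h hx

theorem isValue_iff : IsValue T x ↔ Explicit T x ∧ ∀ a, ¬ EqR T x (a :: x) :=
  and_congr_right fun h => forall_eqR_length_le_iff h.infix

theorem IsValue.explicit (h : IsValue T x) : Explicit T x := h.1

theorem IsValue.infix (h : IsValue T x) : x <:+: T := h.explicit.infix

theorem IsValue.suffix (h : IsValue T y) (hxy : EqR T x y) : x <:+ y :=
  hxy.suffix (hxy.symm.infix h.infix) (h.2 x hxy.symm)

theorem IsValue.eq_of_eqR (h : IsValue T x) (h' : IsValue T y) (hxy : EqR T x y) : x = y :=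
  (h'.suffix hxy).eq_of_length_le (h.2 y hxy)

theorem isValue_self : IsValue T T := by
  refine isValue_iff.2 ⟨explicit_of_suffix List.suffix_rfl, fun a h => ?_⟩
  exact absurd (h.infix List.infix_rfl).length_le (by simp)

theorem Explicit.exists_value {x : List α} (h : Explicit T x) : ∃ b, IsValue T b ∧ EqR T x b := by
  by_cases hv : IsValue T x
  · exact ⟨x, hv, rfl⟩
  · rw [isValue_iff] at hv
    push Not at hv
    obtain ⟨a, ha⟩ := hv h
    have hax := h.of_eqR ha
    obtain ⟨b, hb, hab⟩ := hax.exists_value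
    exact ⟨b, hb, ha.trans hab⟩
termination_by T.length - x.length
decreasing_by
  have := hax.infix.length_le
  simp only [List.length_cons] at this ⊢
  omega

theorem EqR.eq_of_cons_infix {c d : α} (h : EqR T z (d :: z)) (hc : c :: z <:+: T) : c = d := by
  obtain ⟨j, hj⟩ := infix_iff_endPos_nonempty.1 hc
  have hj' : j ∈ endPos T (d :: z) := by
    rw [← h]
    exact endPos_subset_of_suffix (List.suffix_cons c z) hj
  have : c :: z = d :: z :=
    (List.suffix_of_suffix_length_le hj.2 hj'.2 le_rfl).eq_of_length rfl
  exact (List.cons_eq_cons.1 this).1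

theorem Explicit.isValue_of_not_eqR_cons {c : α} (hz : Explicit T z) (hc : c :: z <:+: T)
    (h : ¬ EqR T z (c :: z)) : IsValue T z :=
  isValue_iff.2 ⟨hz, fun _ hd => h (hd.eq_of_cons_infix hc ▸ hd)⟩

theorem IsValue.length_cons_le_of_eqR {a : α} (hz : IsValue T z) (hy : y <:+: T)
    (h : EqR T (a :: z) y) : (a :: z).length ≤ y.length := by
  by_contra! hl
  rcases List.suffix_cons_iff.1 (h.symm.suffix hy hl.le) with rfl | hyz
  · exact lt_irrefl _ hl
  · exact (isValue_iff.1 hz).2 a (h.symm.of_suffix_of_suffix hyz (List.suffix_cons _ _))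

/-! ### Points of the CDAWG -/

theorem exists_longest_explicit_append (s y : List α) (hs : Explicit T s) :
    ∃ γ δ, y = γ ++ δ ∧ Explicit T (s ++ γ) ∧
      ∀ ε, ε <+: δ → ε ≠ [] → ¬ Explicit T (s ++ γ ++ ε) := by
  by_cases h : ∃ ε, ε <+: y ∧ ε ≠ [] ∧ Explicit T (s ++ ε)
  · obtain ⟨ε, ⟨y', rfl⟩, hne, he⟩ := h
    have : 0 < ε.length := List.length_pos_iff.2 hne
    obtain ⟨γ, δ, rfl, h1, h2⟩ := exists_longest_explicit_append (s ++ ε) y' he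
    exact ⟨ε ++ γ, δ, by simp, by simpa using h1, by simpa using h2⟩
  · push Not at h
    exact ⟨[], y, by simp, by simpa using hs, by simpa using h⟩
termination_by y.length
decreasing_by
  subst_vars
  simp only [List.length_append]
  omega

theorem exists_endsAt (hy : y <:+: T) : ∃ v, EndsAt T y v := by
  obtain ⟨γ, δ, rfl, h1, h2⟩ := exists_longest_explicit_append [] y (explicit_nil (T := T))
  obtain ⟨b, hb, hγ⟩ := h1.exists_value
  exact ⟨⟨b, δ⟩, hy, hb, γ, rfl, h1, hγ, h2⟩

variable {u v w : Point α}

theorem EndsAt.infix (h : EndsAt T y v) : y <:+: T := h.1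

theorem EndsAt.isValue (h : EndsAt T y v) : IsValue T v.base := h.2.1

theorem prefix_of_explicit_of_maximal {s t γ δ : List α} (hy : s ++ γ = t ++ δ)
    (hs : Explicit T s) (ht : ∀ ε, ε <+: δ → ε ≠ [] → ¬ Explicit T (t ++ ε)) : s <+: t := by
  rcases List.prefix_or_prefix_of_prefix ⟨γ, rfl⟩ ⟨δ, hy.symm⟩ with h | ⟨ε, rfl⟩
  · exact h
  · rcases eq_or_ne ε [] with rfl | hne
    · simp
    · rw [List.append_assoc, List.append_cancel_left_eq] at hy
      exact absurd hs (ht ε ⟨γ, hy⟩ hne)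

theorem EndsAt.unique (h : EndsAt T y v) (h' : EndsAt T y w) : v = w := by
  obtain ⟨-, hv, s, hs, hse, hsv, hsm⟩ := h
  obtain ⟨-, hw, t, ht, hte, htw, htm⟩ := h'
  have hst : s ++ v.off = t ++ w.off := hs.symm.trans ht
  obtain rfl : s = t := (prefix_of_explicit_of_maximal hst hse htm).eq_of_length_le
    (prefix_of_explicit_of_maximal hst.symm hte hsm).length_le
  ext1
  · exact hv.eq_of_eqR hw (hsv.symm.trans htw)
  · exact List.append_cancel_left hst

theorem EndsAt.eqR (h : EndsAt T y v) : EqR T y v.str := by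
  obtain ⟨-, -, s, rfl, -, hsv, -⟩ := h
  exact hsv.append _

theorem EndsAt.suffix (h : EndsAt T y v) : y <:+ v.str := by
  obtain ⟨-, hv, s, rfl, -, hsv, -⟩ := h
  obtain ⟨p, hp⟩ := hv.suffix hsv
  exact ⟨p, by simp [Point.str, ← hp]⟩

theorem Explicit.endsAt_iff (h : Explicit T y) : EndsAt T y v ↔
    v.off = [] ∧ IsValue T v.base ∧ EqR T y v.base := by
  constructor
  · rintro ⟨-, hv, s, rfl, -, hsv, hsm⟩
    have : v.off = [] := by
      by_contra hne
      exact hsm _ List.prefix_rfl hne h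
    rw [this, List.append_nil]
    exact ⟨rfl, hv, hsv⟩
  · rintro ⟨ho, hv, hy⟩
    refine ⟨h.1, hv, y, by simp [ho], h, hy, fun γ hγ hne => ?_⟩
    rw [ho, List.prefix_nil] at hγ
    exact absurd hγ hne

theorem EndsAt.explicit_iff (h : EndsAt T y v) : Explicit T y ↔ v.off = [] := by
  refine ⟨fun h' => (h'.endsAt_iff.1 h).1, fun ho => ?_⟩
  obtain ⟨-, -, s, rfl, hs, -⟩ := h
  simpa [ho] using hs

theorem EndsAt.isType1_iff (h : EndsAt T y v) : IsType1 T v ↔ Explicit T y := by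
  rw [h.explicit_iff]
  exact ⟨fun h => h.2, fun h' => ⟨h.isValue, h'⟩⟩

theorem EndsAt.of_eqR_explicit {s s' z : List α} (hs : Explicit T s) (hss : EqR T s s')
    (h : EndsAt T (s ++ z) v) : EndsAt T (s' ++ z) v := by
  obtain ⟨hi, hv, t, ht, hte, htv, htm⟩ := h
  obtain ⟨γ, rfl⟩ := prefix_of_explicit_of_maximal ht hs htm
  rw [List.append_assoc, List.append_cancel_left_eq] at ht
  subst ht
  refine ⟨(hss.append _).infix hi, hv, s' ++ γ, by simp, hte.of_eqR (hss.append _),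
    (hss.append γ).symm.trans htv, fun δ hδ hne he => htm δ hδ hne ?_⟩
  rw [(hss.append γ |>.append δ).explicit_iff]
  exact he

theorem EndsAt.append_iff (h : EndsAt T y v) : EndsAt T (y ++ z) w ↔ EndsAt T (v.str ++ z) w := by
  obtain ⟨-, -, s, rfl, hs, hsv, -⟩ := h
  rw [Point.str, List.append_assoc, List.append_assoc]
  exact ⟨fun h => h.of_eqR_explicit hs hsv, fun h => h.of_eqR_explicit (hs.of_eqR hsv) hsv.symm⟩

theorem EndsAt.str (h : EndsAt T y v) : EndsAt T v.str v := by
  have := h.append_iff (z := []) (w := v)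
  simp only [List.append_nil] at this
  exact this.1 h

theorem IsNode.endsAt (h : IsNode T v) : EndsAt T v.str v := by
  rcases h with h | ⟨-, a, u, -, h⟩
  · exact (h.1.explicit.endsAt_iff.2 ⟨h.2, h.1, rfl⟩).str
  · exact h.str

theorem IsType1.not_isType2 (h : IsType1 T v) : ¬ IsType2 T v := fun h' => h'.1 h.2

theorem IsType1.str_eq (h : IsType1 T v) : v.str = v.base := by simp [Point.str, h.2]

theorem IsType1.isValue_str (h : IsType1 T v) : IsValue T v.str := h.str_eq ▸ h.1

theorem isNode_of_endsAt_cons {c : α} (hz : Explicit T z) (h : EndsAt T (c :: z) v) :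
    IsNode T v := by
  by_cases ho : v.off = []
  · exact Or.inl ⟨h.isValue, ho⟩
  · refine Or.inr ⟨ho, c, z, hz.isValue_of_not_eqR_cons h.infix fun hc => ho ?_, h⟩
    exact h.explicit_iff.1 (hz.of_eqR hc)

/-! ### Suffix links and edges -/

theorem IsSLink.exists_endsAt_cons (h : IsSLink T v w) :
    IsType1 T w ∧ ∃ c, EndsAt T (c :: w.str) v := by
  rcases h with ⟨hv, hw, y, hy, hne, hmax, hyw⟩ | ⟨-, a, u, hu, he, rfl⟩
  · obtain ⟨p, hp⟩ := hy
    rcases List.eq_nil_or_concat p with rfl | ⟨p, c, rfl⟩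
    · exact absurd (by rw [← hp]; rfl) hne
    rw [List.concat_eq_append, List.append_assoc, List.singleton_append] at hp
    have hc : EqR T (c :: y) v.base := hmax _ ⟨p, hp⟩ (by simp)
    have hey : Explicit T y := hv.1.explicit.of_suffix ((List.suffix_cons c y).trans ⟨p, hp⟩)
    have hvy : IsValue T y := hey.isValue_of_not_eqR_cons (hc.symm.infix hv.1.infix)
      fun h => hne (h.trans hc)
    have hyw' : y = w.str := hvy.eq_of_eqR hw.isValue_str hyw.eqR
    rw [← hyw']
    exact ⟨hw, c, (hv.1.explicit.of_eqR hc.symm).endsAt_iff.2 ⟨hv.2, hv.1, hc⟩⟩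
  · exact ⟨⟨hu, rfl⟩, a, by simpa [Point.str] using he⟩

theorem IsEdge.endsAt_append (he : IsEdge T u x v) (hz : EndsAt T z u) : EndsAt T (z ++ x) v :=
  hz.append_iff.2 he.2.2.2.1

theorem IsEdge.not_isNode_of_endsAt_append (he : IsEdge T u x v) (hz : EndsAt T z u) (hy : y <+: x)
    (hy0 : y ≠ []) (hyx : y ≠ x) (hw : EndsAt T (z ++ y) w) : ¬ IsNode T w :=
  he.2.2.2.2 y hy hy0 hyx w (hz.append_iff.1 hw)

theorem IsEdge.exists_endsAt_append (he : IsEdge T u x v) (hz : EndsAt T z u) (hy : y <+: x) :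
    ∃ w, EndsAt T (z ++ y) w :=
  exists_endsAt <| (List.prefix_append_right_inj z |>.2 hy).isInfix.trans
    (he.endsAt_append hz).infix

theorem EndsAt.exists_eqR_cons_of_length_lt {c : α} (hy : EndsAt T y v)
    (hz : EndsAt T (c :: z) v) (hl : y.length < (c :: z).length) :
    ∃ t, z = t ++ v.off ∧ Explicit T (c :: t) ∧ EqR T t (c :: t) := by
  obtain ⟨p, hp⟩ := (hy.eqR.trans hz.eqR.symm).suffix hy.infix hl.le
  obtain ⟨-, -, s, hs, -, hsv, -⟩ := hy
  obtain ⟨-, -, t, ht, hte, htv, -⟩ := hz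
  obtain rfl : t = p ++ s := by
    rw [hs, ht, ← List.append_assoc] at hp
    exact (List.append_cancel_right hp).symm
  obtain - | ⟨d, p⟩ := p
  · simp [← hp] at hl
  · simp only [List.cons_append, List.cons.injEq] at ht
    obtain ⟨rfl, hz⟩ := ht
    exact ⟨p ++ s, hz, hte, (hsv.trans htv.symm).of_suffix_of_suffix (List.suffix_append p s)
      (List.suffix_cons _ _)⟩

theorem IsEdge.length_le_of_endsAt {c : α} (he : IsEdge T u x v) (hw : IsType1 T w)
    (hc : EndsAt T (c :: w.str) u) (hv : v.off ≠ []) (hy : EndsAt T y v) :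
    (c :: w.str ++ x).length ≤ y.length := by
  by_contra! hl
  obtain ⟨t, ht, hte, hts⟩ := hy.exists_eqR_cons_of_length_lt (he.endsAt_append hc) hl
  rcases List.prefix_or_prefix_of_prefix ⟨x, rfl⟩ ⟨v.off, ht.symm⟩ with ⟨γ, rfl⟩ | ⟨γ, hγ⟩
  · replace ht : x = γ ++ v.off := by simpa using ht
    rcases eq_or_ne γ [] with rfl | hγ0
    · rw [List.append_nil] at hts
      exact (isValue_iff.1 hw.isValue_str).2 c hts
    · have hγx : γ ≠ x := fun h => hv (by simpa [h] using ht)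
      obtain ⟨q, hq⟩ := he.exists_endsAt_append hc ⟨v.off, ht.symm⟩
      exact he.not_isNode_of_endsAt_append hc ⟨v.off, ht.symm⟩ hγ0 hγx hq
        (Or.inl (hq.isType1_iff.2 hte))
  · have := hts.append γ
    rw [List.cons_append, hγ] at this
    exact (isValue_iff.1 hw.isValue_str).2 c this

/-- With `not_explicit_slink_append`: from the suffix link `w` of `u`, the label of an edge below
`u` spells out a single edge of the CDAWG. -/
theorem IsEdge.explicit_slink_append {c : α} (he : IsEdge T u x v) (hw : IsType1 T w)
    (hc : EndsAt T (c :: w.str) u) : Explicit T (w.str ++ x) := by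
  have hxv := he.endsAt_append hc
  rcases he.2.1 with hv | ⟨ho, a, z, hz, hzv⟩
  · exact (hxv.isType1_iff.1 hv).of_suffix (List.suffix_cons _ _)
  · have hzx : EqR T (a :: z) (c :: w.str ++ x) := hzv.eqR.trans hxv.eqR.symm
    have hlen := (hz.length_cons_le_of_eqR hxv.infix hzx).antisymm
      (he.length_le_of_endsAt hw hc ho hzv)
    have heq := (hzx.suffix hzv.infix hlen.le).eq_of_length hlen
    simp only [List.cons_append, List.cons.injEq] at heq
    exact heq.2 ▸ hz.explicit

theorem IsEdge.not_explicit_slink_append {c : α} (he : IsEdge T u x v)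
    (hc : EndsAt T (c :: w.str) u) (hy : y <+: x) (hy0 : y ≠ []) (hyx : y ≠ x) :
    ¬ Explicit T (w.str ++ y) := by
  intro hex
  obtain ⟨q, hq⟩ := he.exists_endsAt_append hc hy
  exact he.not_isNode_of_endsAt_append hc hy hy0 hyx hq (isNode_of_endsAt_cons hex hq)

theorem IsEdge.length_eq_one_of_source (he : IsEdge T ⟨[], []⟩ x v) : x.length = 1 := by
  have hs : EndsAt T [] ⟨[], []⟩ := by simpa [Point.str] using he.1.endsAt
  obtain - | ⟨c, x⟩ := x
  · exact absurd rfl he.2.2.1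
  by_contra hl
  have hc : [c] <+: c :: x := ⟨x, rfl⟩
  have hcx : [c] ≠ c :: x := fun h => hl (by simp [← h])
  obtain ⟨q, hq⟩ := he.exists_endsAt_append hs hc
  exact he.not_isNode_of_endsAt_append hs hc (by simp) hcx hq
    (isNode_of_endsAt_cons explicit_nil hq)

end Strings

/-! ### Paths of the L-CDAWG -/

section Graph

variable {α : Type*} {T : List α}

theorem exists_isEdge_prefix {u v : Point α} {x : List α} (hu : IsNode T u) (hv : IsNode T v)
    (hx : x ≠ []) (h : EndsAt T (u.str ++ x) v) : ∃ y w, y <+: x ∧ IsEdge T u y w := by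
  by_cases hin : ∀ y, y <+: x → y ≠ [] → y ≠ x → ∀ w, EndsAt T (u.str ++ y) w → ¬ IsNode T w
  · exact ⟨x, v, List.prefix_rfl, hu, hv, hx, h, hin⟩
  · push Not at hin
    obtain ⟨y, hyx, hy, hne, w, hw, hwn⟩ := hin
    have : y.length < x.length := hyx.length_le.lt_of_ne fun h => hne (hyx.eq_of_length h)
    obtain ⟨z, w', hz, he⟩ := exists_isEdge_prefix hu hwn hy hw
    exact ⟨z, w', hz.trans hyx, he⟩
termination_by x.length

namespace LCDAWG

variable [LinearOrder α] (L : LCDAWG T)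

/-- The longest string that leads to a node. -/
def str (i : Fin L.nodes) : List α := (L.point i).str

/-- The last node of a path. -/
def pathEnd : Fin L.nodes → List (Fin L.edges) → Fin L.nodes
  | i, [] => i
  | _, e :: p => pathEnd (L.lo e) p

theorem isNode (i : Fin L.nodes) : IsNode T (L.point i) := (L.point_range _).1 ⟨i, rfl⟩

theorem isEdge (e : Fin L.edges) : IsEdge T (L.point (L.hi e)) (L.label e) (L.point (L.lo e)) :=
  (L.edge_range _ _ _).1 ⟨e, rfl, rfl, rfl⟩

theorem endsAt (i : Fin L.nodes) : EndsAt T (L.str i) (L.point i) := (L.isNode i).endsAt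

theorem endsAt_lo (e : Fin L.edges) : EndsAt T (L.str (L.hi e) ++ L.label e) (L.point (L.lo e)) :=
  (L.isEdge e).endsAt_append (L.endsAt _)

theorem label_ne_nil (e : Fin L.edges) : L.label e ≠ [] := (L.isEdge e).2.2.1

theorem slen_pos (e : Fin L.edges) : 0 < L.slen e := by
  rw [L.slen_spec]
  exact List.length_pos_iff.2 (L.label_ne_nil e)

theorem label_eq_cons (e : Fin L.edges) : ∃ x, L.label e = L.chr e :: x :=
  ⟨_, List.eq_cons_of_mem_head? (L.chr_spec e)⟩

theorem eq_of_hi_eq_of_chr_eq {e e' : Fin L.edges} (h : L.hi e = L.hi e')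
    (hc : L.chr e = L.chr e') : e = e' := by
  rcases lt_trichotomy e e' with hl | hl | hl
  · exact absurd hc (L.out_sorted _ _ h hl).ne
  · exact hl
  · exact absurd hc (L.out_sorted _ _ h.symm hl).ne'

theorem str_root : L.str L.root = [] := by simp [str, L.root_spec, Point.str]

theorem isType1_iff (i : Fin L.nodes) : IsType1 T (L.point i) ↔ L.type2 i = false := by
  rw [← Bool.not_eq_true, L.type2_spec]
  exact ⟨fun h => h.not_isType2, fun h => (L.isNode i).resolve_right h⟩

theorem explicit_iff_of_endsAt {i : Fin L.nodes} {y : List α} (h : EndsAt T y (L.point i)) :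
    Explicit T y ↔ L.type2 i = false := by
  rw [← isType1_iff, h.isType1_iff]

theorem eq_of_endsAt {i j : Fin L.nodes} {y : List α} (h : EndsAt T y (L.point i))
    (h' : EndsAt T y (L.point j)) : i = j := L.point_injective (h.unique h')

theorem slen_add_le (e : Fin L.edges) :
    (L.str (L.hi e)).length + L.slen e ≤ (L.str (L.lo e)).length := by
  rw [L.slen_spec, ← List.length_append]
  exact (L.endsAt_lo e).suffix.length_le

theorem str_lo_eq {e : Fin L.edges}
    (h : (L.str (L.hi e)).length + L.slen e = (L.str (L.lo e)).length) :
    L.str (L.hi e) ++ L.label e = L.str (L.lo e) :=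
  (L.endsAt_lo e).suffix.eq_of_length (by rw [List.length_append, ← L.slen_spec]; exact h)

theorem length_str_hi_lt (e : Fin L.edges) :
    (L.str (L.hi e)).length < (L.str (L.lo e)).length := by
  have := L.slen_add_le e
  have := L.slen_pos e
  omega

theorem length_str_le (i : Fin L.nodes) : (L.str i).length ≤ T.length :=
  (L.endsAt i).infix.length_le

theorem slen_le (e : Fin L.edges) : L.slen e ≤ T.length :=
  (Nat.le_add_left _ _).trans ((L.slen_add_le e).trans (L.length_str_le _))

theorem pathLabel_nil : L.pathLabel [] = [] := List.flatMap_nil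

theorem pathLabel_cons (e : Fin L.edges) (p) : L.pathLabel (e :: p) = L.label e ++ L.pathLabel p :=
  List.flatMap_cons

theorem pathLabel_append (p q) : L.pathLabel (p ++ q) = L.pathLabel p ++ L.pathLabel q :=
  List.flatMap_append

theorem pathLabel_eq_nil_iff {p : List (Fin L.edges)} : L.pathLabel p = [] ↔ p = [] := by
  cases p <;> simp [pathLabel_nil, pathLabel_cons, L.label_ne_nil]

theorem isPathFrom_append {i : Fin L.nodes} {p q : List (Fin L.edges)} :
    L.IsPathFrom i (p ++ q) ↔ L.IsPathFrom i p ∧ L.IsPathFrom (L.pathEnd i p) q := by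
  induction p generalizing i with
  | nil => simp [IsPathFrom, pathEnd]
  | cons e p ih => simp [IsPathFrom, pathEnd, ih, and_assoc]

theorem pathEnd_append {i : Fin L.nodes} {p q : List (Fin L.edges)} :
    L.pathEnd i (p ++ q) = L.pathEnd (L.pathEnd i p) q := by
  induction p generalizing i with
  | nil => rfl
  | cons e p ih => simp [pathEnd, ih]

theorem endsAt_pathEnd {i : Fin L.nodes} {p : List (Fin L.edges)} {y : List α}
    (hp : L.IsPathFrom i p) (hy : EndsAt T y (L.point i)) :
    EndsAt T (y ++ L.pathLabel p) (L.point (L.pathEnd i p)) := by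
  induction p generalizing i y with
  | nil => simpa [pathLabel_nil, pathEnd] using hy
  | cons e p ih =>
    obtain ⟨rfl, hp⟩ := hp
    rw [pathLabel_cons, ← List.append_assoc]
    exact ih hp ((L.isEdge e).endsAt_append hy)

theorem exists_first_edge {i j : Fin L.nodes} {x : List α} (hx : x ≠ [])
    (h : EndsAt T (L.str i ++ x) (L.point j)) : ∃ e, L.hi e = i ∧ L.label e <+: x := by
  obtain ⟨y, w, hy, he⟩ := exists_isEdge_prefix (L.isNode i) (L.isNode j) hx h
  obtain ⟨e, hi, rfl, -⟩ := (L.edge_range _ _ _).2 he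
  exact ⟨e, L.point_injective hi, hy⟩

theorem exists_path {i j : Fin L.nodes} (x : List α) (h : EndsAt T (L.str i ++ x) (L.point j)) :
    ∃ p, L.IsPathFrom i p ∧ L.pathLabel p = x ∧ L.pathEnd i p = j := by
  by_cases hx : x = []
  · subst hx
    exact ⟨[], trivial, rfl, L.eq_of_endsAt (L.endsAt i) (by simpa using h)⟩
  · obtain ⟨e, rfl, z, hz⟩ := L.exists_first_edge hx h
    have hlt : z.length < x.length := by
      rw [← hz, List.length_append, ← L.slen_spec]
      exact Nat.lt_add_of_pos_left (L.slen_pos e)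
    rw [← hz, ← List.append_assoc] at h
    obtain ⟨p, hp, hlabel, hj⟩ := exists_path z ((L.endsAt_lo e).append_iff.1 h)
    exact ⟨e :: p, ⟨rfl, hp⟩, by rw [pathLabel_cons, hlabel, hz], hj⟩
termination_by x.length

theorem exists_primary_edge {i : Fin L.nodes} (hi : i ≠ L.root) :
    ∃ e, L.lo e = i ∧ (L.str (L.hi e)).length + L.slen e = (L.str i).length := by
  obtain ⟨p, hp, hlabel, hend⟩ := L.exists_path (i := L.root) (j := i) (L.str i)
    (by rw [str_root]; exact L.endsAt i)
  rcases List.eq_nil_or_concat p with rfl | ⟨p, e, rfl⟩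
  · exact absurd hend.symm hi
  rw [List.concat_eq_append] at hp hlabel hend
  rw [isPathFrom_append] at hp
  rw [pathEnd_append] at hend
  obtain ⟨hp, hhi : L.hi e = L.pathEnd L.root p, -⟩ := hp
  obtain rfl : L.lo e = i := hend
  refine ⟨e, rfl, le_antisymm (L.slen_add_le e) ?_⟩
  have hle := (L.endsAt_pathEnd hp (L.endsAt L.root)).suffix.length_le
  rw [str_root, List.nil_append, ← hhi] at hle
  rw [← hlabel, pathLabel_append, List.length_append, pathLabel_cons, pathLabel_nil,
    List.append_nil, ← L.slen_spec]
  exact Nat.add_le_add_right hle _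

theorem exists_str_eq_text : ∃ i, L.str i = T := by
  obtain ⟨i, hi⟩ := (L.point_range ⟨T, []⟩).2 (Or.inl ⟨isValue_self, rfl⟩)
  exact ⟨i, by simp [str, hi, Point.str]⟩

theorem str_eq_text {i : Fin L.nodes} (h : (L.str i).length = T.length) : L.str i = T :=
  (L.endsAt i).infix.eq_of_length h

/-! ### Type-2 nodes -/

theorem exists_edge_of_type2 {i : Fin L.nodes} (hi : L.type2 i = true) : ∃ e, L.hi e = i := by
  have hne : ¬ Explicit T (L.str i) := by simp [L.explicit_iff_of_endsAt (L.endsAt i), hi]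
  obtain ⟨p, q, hpq⟩ := (L.endsAt i).infix
  have hsuff : L.str i ++ q <:+ T := ⟨p, by rw [← List.append_assoc, hpq]⟩
  have hq : q ≠ [] := by
    rintro rfl
    rw [List.append_nil] at hsuff
    exact hne (explicit_of_suffix hsuff)
  obtain ⟨v, hv⟩ := exists_endsAt hsuff.isInfix
  obtain ⟨j, rfl⟩ := (L.point_range v).2 (Or.inl (hv.isType1_iff.2 (explicit_of_suffix hsuff)))
  obtain ⟨e, he, -⟩ := L.exists_first_edge hq hv
  exact ⟨e, he⟩

theorem exists_chr_eq_of_type2 {i : Fin L.nodes} (hi : L.type2 i = true) :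
    ∃ a, ∀ e, L.hi e = i → L.chr e = a := by
  have hne : ¬ Explicit T (L.str i) := by simp [L.explicit_iff_of_endsAt (L.endsAt i), hi]
  obtain ⟨a, ha⟩ := exists_forced_of_not_explicit (L.endsAt i).infix hne
  refine ⟨a, ?_⟩
  rintro e rfl
  obtain ⟨k, hk⟩ := infix_iff_endPos_nonempty.1 (L.endsAt_lo e).infix
  obtain ⟨l, -, hl, hla⟩ := mem_endPos_append.1 hk
  obtain ⟨x, hx⟩ := L.label_eq_cons e
  have hchr : [L.chr e] <+: L.label e := ⟨x, hx.symm⟩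
  have h := singleton_prefix_drop_iff.1 (hchr.trans hla)
  rw [ha l hl] at h
  exact (Option.some.inj h).symm

theorem eq_of_hi_eq_of_type2 {e e' : Fin L.edges} (he : L.type2 (L.hi e) = true)
    (h : L.hi e = L.hi e') : e = e' :=
  let ⟨_, ha⟩ := L.exists_chr_eq_of_type2 he
  L.eq_of_hi_eq_of_chr_eq h ((ha e rfl).trans (ha e' h.symm).symm)

theorem first_eq_of_type2 {e : Fin L.edges} (he : L.type2 (L.hi e) = true) :
    L.first (L.hi e) = e := by
  have hout := (L.out_spec (L.hi e) e).1 rfl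
  have hle := L.out_le (L.hi e)
  have hfirst : L.hi ⟨L.first (L.hi e), by omega⟩ = L.hi e := by
    rw [L.out_spec]
    exact ⟨le_rfl, by simp only; omega⟩
  exact congrArg Fin.val (L.eq_of_hi_eq_of_type2 he hfirst.symm).symm

/-- The path of edges from a node to the next type-1 node. -/
inductive Chain : Fin L.nodes → List (Fin L.edges) → Prop
  | nil {i} : L.type2 i = false → Chain i []
  | cons {e p} : L.type2 (L.hi e) = true → Chain (L.lo e) p → Chain (L.hi e) (e :: p)

variable {L} in
theorem Chain.unique {i : Fin L.nodes} {p q : List (Fin L.edges)} (hp : L.Chain i p)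
    (hq : L.Chain i q) : p = q := by
  induction hp generalizing q with
  | nil h =>
    cases hq with
    | nil => rfl
    | cons h' => simp [h] at h'
  | @cons e p h _ ih =>
    generalize hi : L.hi e = i at hq
    cases hq with
    | nil h' => rw [← hi, h] at h'; cases h'
    | cons h' hq =>
      obtain rfl := L.eq_of_hi_eq_of_type2 h hi
      rw [ih hq]

theorem exists_chain (i : Fin L.nodes) : ∃ p, L.Chain i p := by
  by_cases h : L.type2 i = true
  · obtain ⟨e, rfl⟩ := L.exists_edge_of_type2 h
    have := L.length_str_hi_lt e
    have := L.length_str_le (L.lo e)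
    obtain ⟨p, hp⟩ := exists_chain (L.lo e)
    exact ⟨_, .cons h hp⟩
  · exact ⟨[], .nil (by simpa using h)⟩
termination_by T.length - (L.str i).length

/-- The string that leads from a node to the next type-1 node. -/
noncomputable def rest (i : Fin L.nodes) : List α := L.pathLabel (L.exists_chain i).choose

variable {L} in
theorem Chain.rest_eq {i : Fin L.nodes} {p : List (Fin L.edges)} (hp : L.Chain i p) :
    L.rest i = L.pathLabel p := by
  rw [rest, (L.exists_chain i).choose_spec.unique hp]

theorem rest_of_type1 {i : Fin L.nodes} (h : L.type2 i = false) : L.rest i = [] :=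
  (Chain.nil h).rest_eq

theorem rest_hi_of_type2 {e : Fin L.edges} (h : L.type2 (L.hi e) = true) :
    L.rest (L.hi e) = L.label e ++ L.rest (L.lo e) := by
  obtain ⟨p, hp⟩ := L.exists_chain (L.lo e)
  rw [(Chain.cons h hp).rest_eq, hp.rest_eq, pathLabel_cons]

theorem chain_of_explicit {i : Fin L.nodes} {p : List (Fin L.edges)} {y : List α}
    (hp : L.IsPathFrom i p) (hy : EndsAt T y (L.point i)) (hend : Explicit T (y ++ L.pathLabel p))
    (hin : ∀ z, z <+: L.pathLabel p → z ≠ L.pathLabel p → ¬ Explicit T (y ++ z)) :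
    L.Chain i p := by
  induction p generalizing i y with
  | nil =>
    rw [pathLabel_nil, List.append_nil] at hend
    exact .nil ((L.explicit_iff_of_endsAt hy).1 hend)
  | cons e p ih =>
    obtain ⟨rfl, hp⟩ := hp
    rw [pathLabel_cons] at hend hin
    refine .cons ?_ (ih hp ((L.isEdge e).endsAt_append hy) (by simpa using hend) fun z hz hne => ?_)
    · have := hin [] List.nil_prefix (by simp [L.label_ne_nil])
      rw [List.append_nil, L.explicit_iff_of_endsAt hy] at this
      simpa using this
    · rw [List.append_assoc]
      exact hin _ ((List.prefix_append_right_inj _).2 hz) (by simpa using hne)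

/-! ### Edge suffix links and jump links -/

theorem exists_endsAt_cons_slink {i : Fin L.nodes} (hi : i ≠ L.root) :
    IsType1 T (L.point (L.slink i)) ∧ ∃ c, EndsAt T (c :: L.str (L.slink i)) (L.point i) :=
  (L.slink_spec i hi).exists_endsAt_cons

theorem length_slink_lt {i : Fin L.nodes} (hi : i ≠ L.root) :
    (L.str (L.slink i)).length < (L.str i).length := by
  obtain ⟨-, c, hc⟩ := L.exists_endsAt_cons_slink hi
  exact hc.suffix.length_le

theorem hi_ne_root {e : Fin L.edges} (he : 2 ≤ L.slen e) : L.hi e ≠ L.root := by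
  intro h
  have hedge := L.isEdge e
  rw [h, L.root_spec] at hedge
  have := hedge.length_eq_one_of_source
  rw [L.slen_spec] at he
  omega

/-- `e₁` is the first edge of the edge suffix link of `e`. -/
def IsESufHead (e e₁ : Fin L.edges) : Prop := L.hi e₁ = L.slink (L.hi e) ∧ L.chr e₁ = L.chr e

theorem exists_isESuf_path {e : Fin L.edges} (he : 2 ≤ L.slen e) : ∃ p, L.IsESuf e p := by
  obtain ⟨hw, c, hc⟩ := L.exists_endsAt_cons_slink (L.hi_ne_root he)
  have hex := (L.isEdge e).explicit_slink_append hw hc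
  obtain ⟨v, hv⟩ := exists_endsAt hex.infix
  obtain ⟨j, rfl⟩ := (L.point_range v).2 (Or.inl (hv.isType1_iff.2 hex))
  obtain ⟨p, hp, hlabel, -⟩ := L.exists_path (i := L.slink (L.hi e)) _ hv
  exact ⟨p, he, hp, hlabel⟩

variable {L}

theorem IsESuf.chain {e e₁ : Fin L.edges} {p : List (Fin L.edges)} (h : L.IsESuf e (e₁ :: p)) :
    L.Chain (L.lo e₁) p := by
  obtain ⟨he, ⟨hhi, hp⟩, hlabel⟩ := h
  rw [pathLabel_cons] at hlabel
  obtain ⟨hw, c, hc⟩ := L.exists_endsAt_cons_slink (L.hi_ne_root he)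
  have hex : Explicit T (L.str (L.slink (L.hi e)) ++ L.label e) :=
    (L.isEdge e).explicit_slink_append hw hc
  refine L.chain_of_explicit (y := L.str (L.slink (L.hi e)) ++ L.label e₁) hp ?_ ?_ ?_
  · rw [← hhi]
    exact L.endsAt_lo e₁
  · rwa [List.append_assoc, hlabel]
  · intro z hz hne
    rw [List.append_assoc]
    refine (L.isEdge e).not_explicit_slink_append (w := L.point (L.slink (L.hi e))) hc ?_ ?_ ?_
    · rw [← hlabel]
      exact (List.prefix_append_right_inj _).2 hz
    · simp [L.label_ne_nil]
    · rw [← hlabel]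
      simpa using hne

theorem IsESuf.isESufHead {e e₁ : Fin L.edges} {p : List (Fin L.edges)}
    (h : L.IsESuf e (e₁ :: p)) : L.IsESufHead e e₁ := by
  obtain ⟨-, ⟨hhi, -⟩, hlabel⟩ := h
  obtain ⟨x, hx⟩ := L.label_eq_cons e
  obtain ⟨y, hy⟩ := L.label_eq_cons e₁
  rw [pathLabel_cons, hx, hy] at hlabel
  exact ⟨hhi, (List.cons_eq_cons.1 hlabel).1⟩

theorem exists_isESuf {e : Fin L.edges} (he : 2 ≤ L.slen e) : ∃ e₁ p, L.IsESuf e (e₁ :: p) := by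
  obtain ⟨p, hp⟩ := L.exists_isESuf_path he
  obtain - | ⟨e₁, p⟩ := p
  · exact absurd hp.2.2.symm (L.label_ne_nil e)
  · exact ⟨e₁, p, hp⟩

theorem exists_isESufHead {e : Fin L.edges} (he : 2 ≤ L.slen e) : ∃ e₁, L.IsESufHead e e₁ :=
  let ⟨e₁, _, h⟩ := exists_isESuf he
  ⟨e₁, h.isESufHead⟩

theorem IsESufHead.unique {e e₁ e₂ : Fin L.edges} (h₁ : L.IsESufHead e e₁)
    (h₂ : L.IsESufHead e e₂) : e₁ = e₂ :=
  L.eq_of_hi_eq_of_chr_eq (h₁.1.trans h₂.1.symm) (h₁.2.trans h₂.2.symm)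

theorem IsESufHead.exists_isESuf {e e₁ : Fin L.edges} (h : L.IsESufHead e e₁)
    (he : 2 ≤ L.slen e) : ∃ p, L.IsESuf e (e₁ :: p) := by
  obtain ⟨e₂, p, hp⟩ := LCDAWG.exists_isESuf he
  obtain rfl := h.unique hp.isESufHead
  exact ⟨p, hp⟩

theorem IsESuf.tail_eq_nil_iff {e e₁ : Fin L.edges} {p : List (Fin L.edges)}
    (h : L.IsESuf e (e₁ :: p)) : p = [] ↔ L.slen e₁ = L.slen e := by
  rw [L.slen_spec, L.slen_spec, ← h.2.2, pathLabel_cons, List.length_append, left_eq_add,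
    List.length_eq_zero_iff, pathLabel_eq_nil_iff]

theorem IsESufHead.length_lt {e e₁ : Fin L.edges} (h : L.IsESufHead e e₁) (he : 2 ≤ L.slen e) :
    (L.str (L.hi e₁)).length < (L.str (L.hi e)).length := by
  rw [h.1]
  exact L.length_slink_lt (L.hi_ne_root he)

variable (L) in
/-- `g` is the first edge of the jump link of `e`.  The other edges of the jump link form a chain,
so that `g` determines the jump link. -/
def IsJumpHead (e g : Fin L.edges) : Prop :=
  ∃ p, p ≠ [] ∧ L.IsJump e (g :: p) ∧ L.Chain (L.lo g) p

theorem IsESufHead.isJumpHead {e e₁ : Fin L.edges} (h : L.IsESufHead e e₁) (he : 2 ≤ L.slen e)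
    (hs : L.slen e₁ ≠ L.slen e) : L.IsJumpHead e e₁ := by
  obtain ⟨p, hp⟩ := h.exists_isESuf he
  have hne : p ≠ [] := fun h => hs (hp.tail_eq_nil_iff.1 h)
  exact ⟨p, hne, .done hp (Nat.succ_le_succ (List.length_pos_iff.2 hne)), hp.chain⟩

theorem IsESufHead.isJumpHead_of_slen_eq {e e₁ g : Fin L.edges} (h : L.IsESufHead e e₁)
    (he : 2 ≤ L.slen e) (hs : L.slen e₁ = L.slen e) (hg : L.IsJumpHead e₁ g) :
    L.IsJumpHead e g := by
  obtain ⟨q, hq0, hq, hqc⟩ := hg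
  obtain ⟨p, hp⟩ := h.exists_isESuf he
  rw [hp.tail_eq_nil_iff.2 hs] at hp
  exact ⟨q, hq0, .step hp hq, hqc⟩

theorem IsJump.pathLabel_eq {e : Fin L.edges} {p : List (Fin L.edges)} (h : L.IsJump e p) :
    L.pathLabel p = L.label e := by
  induction h with
  | done h _ => exact h.2.2
  | step h _ ih => rw [ih, ← h.2.2, pathLabel_cons, pathLabel_nil, List.append_nil]

theorem IsJumpHead.label_eq {e g : Fin L.edges} (h : L.IsJumpHead e g) :
    L.label e = L.label g ++ L.rest (L.lo g) := by
  obtain ⟨p, -, hp, hc⟩ := h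
  rw [← hp.pathLabel_eq, pathLabel_cons, hc.rest_eq]

theorem IsJumpHead.type2_lo {e g : Fin L.edges} (h : L.IsJumpHead e g) :
    L.type2 (L.lo g) = true := by
  obtain ⟨p, hne, -, hc⟩ := h
  generalize L.lo g = i at hc
  cases hc with
  | nil => exact absurd rfl hne
  | cons h => exact h

end LCDAWG

/-! ### The size of the L-CDAWG -/

variable {x : List α}

theorem finite_begPos : (begPos T x).Finite := (Set.finite_Iic T.length).subset fun _ h => h.1

theorem finite_endPos : (endPos T x).Finite := (Set.finite_Iic T.length).subset fun _ h => h.1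

theorem occ_eq_ncard_endPos : occ T x = (endPos T x).ncard := by
  have himage : endPos T x = (· + x.length) '' begPos T x := by
    ext j
    constructor
    · intro hj
      have hlen := Nat.sub_add_cancel (length_le_of_mem_endPos hj)
      exact ⟨j - x.length, by rwa [mem_begPos_iff, hlen], hlen⟩
    · rintro ⟨i, hi, rfl⟩
      exact mem_begPos_iff.1 hi
  rw [occ, himage, Set.ncard_image_of_injective _ (add_left_injective _)]

theorem endPos_self : endPos T T = {T.length} := by
  refine Set.eq_singleton_iff_unique_mem.2 ⟨by simp [endPos], fun k hk => ?_⟩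
  exact le_antisymm hk.1 (length_le_of_mem_endPos hk)

theorem Explicit.endPos_eq_of_subsingleton (h : Explicit T x) (hs : (endPos T x).Subsingleton) :
    endPos T x = {T.length} := by
  obtain ⟨hx, hfollow⟩ := explicit_iff.1 h
  obtain ⟨j, hj⟩ := infix_iff_endPos_nonempty.1 hx
  rw [hs.eq_singleton_of_mem hj, Set.singleton_eq_singleton_iff]
  by_contra hne
  have hlt : j < T.length := hj.1.lt_of_ne hne
  obtain ⟨i, hi, hni⟩ := hfollow T[j]
  obtain rfl := hs hi hj
  exact hni (List.getElem?_eq_getElem hlt)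

theorem IsValue.one_lt_occ (h : IsValue T x) (hx : x ≠ T) : 1 < occ T x := by
  rw [occ_eq_ncard_endPos]
  by_contra! hle
  have hle : (endPos T x).Subsingleton := (Set.ncard_le_one finite_endPos).1 hle
  refine hx (h.eq_of_eqR isValue_self ?_)
  rw [EqR, h.explicit.endPos_eq_of_subsingleton hle, endPos_self]

theorem Explicit.occ_concat_lt (h : Explicit T x) (a : α) : occ T (x ++ [a]) < occ T x := by
  have hsub : begPos T (x ++ [a]) ⊆ begPos T x :=
    begPos_subset_of_prefix (List.prefix_append x [a])
  refine Set.ncard_lt_ncard ⟨hsub, fun hs => ?_⟩ finite_begPos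
  exact (forall_eqL_length_le_iff h.infix).1 h.2 a (hs.antisymm hsub)

theorem IsValue.occ_cons_lt (h : IsValue T x) (a : α) : occ T (a :: x) < occ T x := by
  have hsuff := List.suffix_cons a x
  rw [occ_eq_ncard_endPos, occ_eq_ncard_endPos]
  refine Set.ncard_lt_ncard ⟨endPos_subset_of_suffix hsuff, fun hs => ?_⟩ finite_endPos
  exact (isValue_iff.1 h).2 a ((eqR_iff_subset_of_suffix hsuff).2 hs)

theorem IsValue.isMaxRepeat (h : IsValue T x) (hx : x ≠ T) : IsMaxRepeat T x :=
  ⟨h.infix, h.one_lt_occ hx, h.explicit.occ_concat_lt, h.occ_cons_lt⟩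

theorem IsValue.concat_mem_rightExt (h : IsValue T x) {a : α} (hx : x ++ [a] <:+: T) :
    x ++ [a] ∈ rightExt T := by
  refine ⟨hx, x, a, h.isMaxRepeat ?_, rfl⟩
  rintro rfl
  exact absurd hx.length_le (by simp)

theorem IsValue.cons_mem_leftExt (h : IsValue T x) {a : α} (hx : a :: x <:+: T) :
    a :: x ∈ leftExt T := by
  refine ⟨hx, x, a, h.isMaxRepeat ?_, rfl⟩
  rintro rfl
  exact absurd hx.length_le (by simp)

theorem setOf_infix_subset : {x | x <:+: T} ⊆ (fun p : ℕ × ℕ => (T.drop p.1).take p.2) ''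
    (Finset.range (T.length + 1) ×ˢ Finset.range (T.length + 1) : Finset (ℕ × ℕ)) := by
  rintro x ⟨p, q, rfl⟩
  refine ⟨(p.length, x.length), ?_, by simp⟩
  simp only [Finset.coe_product, Finset.coe_range, Set.mem_prod, Set.mem_Iio, List.length_append]
  omega

theorem finite_setOf_infix : {x | x <:+: T}.Finite :=
  ((Finset.finite_toSet _).image _).subset setOf_infix_subset

theorem ncard_setOf_infix_le : {x | x <:+: T}.ncard ≤ (T.length + 1) ^ 2 := by
  refine (Set.ncard_le_ncard setOf_infix_subset ((Finset.finite_toSet _).image _)).trans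
    ((Set.ncard_image_le (Finset.finite_toSet _)).trans ?_)
  rw [Set.ncard_coe_finset, Finset.card_product, Finset.card_range, sq]

theorem finite_rightExt : (rightExt T).Finite := finite_setOf_infix.subset fun _ h => h.1

theorem finite_leftExt : (leftExt T).Finite := finite_setOf_infix.subset fun _ h => h.1

theorem numExt_le : numExt T ≤ 2 * (T.length + 1) ^ 2 := by
  rw [numExt, two_mul]
  refine Nat.add_le_add (le_trans (Set.ncard_le_ncard ?_ finite_setOf_infix) ncard_setOf_infix_le)
    (le_trans (Set.ncard_le_ncard ?_ finite_setOf_infix) ncard_setOf_infix_le) <;>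
  exact fun _ h => h.1

namespace LCDAWG

variable [LinearOrder α] (L : LCDAWG T)

theorem str_hi_concat_chr_infix (e : Fin L.edges) : L.str (L.hi e) ++ [L.chr e] <:+: T := by
  obtain ⟨x, hx⟩ := L.label_eq_cons e
  refine List.IsInfix.trans ⟨[], x, ?_⟩ (L.endsAt_lo e).infix
  simp [hx]

theorem deg_le_card_toFinset (i : Fin L.nodes) : L.deg i ≤ T.toFinset.card := by
  have hle := L.out_le i
  have hi : ∀ j : Fin (L.deg i), L.hi ⟨L.first i + j, by omega⟩ = i := by
    intro j
    rw [L.out_spec]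
    simp
  have hmem : ∀ e, L.chr e ∈ T.toFinset := fun e =>
    List.mem_toFinset.2 ((L.str_hi_concat_chr_infix e).subset (by simp))
  have hinj : Set.InjOn (fun j : Fin (L.deg i) => L.chr ⟨L.first i + j, by omega⟩)
      (Finset.univ : Finset (Fin (L.deg i))) := by
    intro j _ k _ h
    have := L.eq_of_hi_eq_of_chr_eq ((hi j).trans (hi k).symm) h
    simpa [Fin.ext_iff] using this
  simpa using Finset.card_le_card_of_injOn _ (fun j _ => hmem _) hinj

theorem edges_pos (hT : T ≠ []) : 0 < L.edges := by
  obtain ⟨b, hb⟩ := L.exists_str_eq_text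
  obtain ⟨e, -⟩ := L.exists_primary_edge (i := b) fun hroot => hT (by rw [← hb, hroot, L.str_root])
  exact e.pos

theorem nodes_le : L.nodes ≤ L.edges + 1 := by
  have hsub : Finset.univ.erase L.root ⊆ Finset.univ.image L.lo := by
    intro i hi
    obtain ⟨e, he, -⟩ := L.exists_primary_edge (Finset.ne_of_mem_erase hi)
    exact Finset.mem_image.2 ⟨e, Finset.mem_univ _, he⟩
  have hcard := (Finset.card_le_card hsub).trans Finset.card_image_le
  rw [Finset.card_erase_of_mem (Finset.mem_univ _), Finset.card_univ, Finset.card_univ,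
    Fintype.card_fin, Fintype.card_fin] at hcard
  omega

theorem ncard_hi_type1_le : {e | L.type2 (L.hi e) = false}.ncard ≤ (rightExt T).ncard := by
  refine Set.ncard_le_ncard_of_injOn (fun e => L.str (L.hi e) ++ [L.chr e]) ?_ ?_ finite_rightExt
  · intro e he
    exact ((L.isType1_iff _).2 he).isValue_str.concat_mem_rightExt (L.str_hi_concat_chr_infix e)
  · intro e _ e' _ h
    obtain ⟨h, hc⟩ := List.append_inj' h rfl
    refine L.eq_of_hi_eq_of_chr_eq (L.eq_of_endsAt (L.endsAt _) ?_) (by simpa using hc)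
    rw [h]
    exact L.endsAt _

theorem ncard_hi_type2_le : {e | L.type2 (L.hi e) = true}.ncard ≤ (leftExt T).ncard := by
  have hleft : ∀ i, L.type2 i = true → ∃ y ∈ leftExt T, EndsAt T y (L.point i) := by
    intro i hi
    obtain ⟨-, a, u, hu, hau⟩ := (L.type2_spec i).1 hi
    exact ⟨a :: u, hu.cons_mem_leftExt hau.infix, hau⟩
  choose! y hy hye using hleft
  refine Set.ncard_le_ncard_of_injOn (fun e => y (L.hi e)) (fun e he => hy _ he) ?_ finite_leftExt
  intro e he e' he' (h : y (L.hi e) = y (L.hi e'))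
  refine L.eq_of_hi_eq_of_type2 he (L.eq_of_endsAt (hye _ he) ?_)
  rw [h]
  exact hye _ he'

theorem edges_le : L.edges ≤ numExt T := by
  have hunion : {e | L.type2 (L.hi e) = false} ∪ {e | L.type2 (L.hi e) = true} = Set.univ := by
    ext e
    cases h : L.type2 (L.hi e) <;> simp [h]
  calc L.edges = (Set.univ : Set (Fin L.edges)).ncard := by rw [Set.ncard_univ, Nat.card_fin]
    _ ≤ {e | L.type2 (L.hi e) = false}.ncard + {e | L.type2 (L.hi e) = true}.ncard := by
      rw [← hunion]
      exact Set.ncard_union_le _ _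
    _ ≤ numExt T := Nat.add_le_add L.ncard_hi_type1_le L.ncard_hi_type2_le

end LCDAWG

end Graph

/-! ### Reasoning about programs -/

section Machine

variable {α : Type*}

@[simp] theorem State.reg_setReg (s : State α) (r x r' : ℕ) :
    (s.setReg r x).reg r' = if r' = r then x else s.reg r' := Function.update_apply ..

@[simp] theorem State.mem_setReg (s : State α) (r x : ℕ) : (s.setReg r x).mem = s.mem := rfl

@[simp] theorem State.chr_setReg (s : State α) (r x : ℕ) : (s.setReg r x).chr = s.chr := rfl

@[simp] theorem State.reg_setMem (s : State α) (a i x : ℕ) : (s.setMem a i x).reg = s.reg := rfl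

@[simp] theorem State.mem_setMem (s : State α) (a i x a' j : ℕ) :
    (s.setMem a i x).mem a' j = if a' = a then if j = i then x else s.mem a' j else s.mem a' j := by
  simp only [State.setMem, Function.update_apply]
  split
  · next h => rw [h, Function.update_apply]
  · rfl

@[simp] theorem State.chr_setMem (s : State α) (a i x : ℕ) : (s.setMem a i x).chr = s.chr := rfl

@[simp] theorem State.reg_setChr (s : State α) (a i : ℕ) (x : Option α) :
    (s.setChr a i x).reg = s.reg := rfl

@[simp] theorem State.mem_setChr (s : State α) (a i : ℕ) (x : Option α) :
    (s.setChr a i x).mem = s.mem := rfl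

@[simp] theorem State.chr_setChr (s : State α) (a i : ℕ) (x : Option α) (a' j : ℕ) :
    (s.setChr a i x).chr a' j =
      if a' = a then if j = i then x else s.chr a' j else s.chr a' j := by
  simp only [State.setChr, Function.update_apply]
  split
  · next h => rw [h, Function.update_apply]
  · rfl

/-- All integers in the state are at most `M`. -/
def State.Bdd (M : ℕ) (s : State α) : Prop := (∀ r, s.reg r ≤ M) ∧ ∀ a i, s.mem a i ≤ M

/-- A factor `w` such that, in states that are bounded by `M ≥ 1`, all values that arise in the
evaluation of the expression are at most `w * M`. -/
def Expr.weight : Expr → ℕ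
  | .const k => k
  | .reg _ => 1
  | .read _ i => max i.weight 1
  | .plus e f => e.weight + f.weight
  | .minus e f => max e.weight f.weight
  | .half e => e.weight

/-- The greatest weight of an expression in the test. -/
def Test.weight : Test → ℕ
  | .lt e f | .eq e f | .chrLt _ e _ f | .chrEq _ e _ f => max e.weight f.weight

/-- The greatest weight of an expression in the program. -/
def Prog.weight : Prog → ℕ
  | .skip => 0
  | .set _ e => e.weight
  | .write _ i e => max i.weight e.weight
  | .copyChr _ i _ j => max i.weight j.weight
  | .seq p q => max p.weight q.weight
  | .ite c p q => max c.weight (max p.weight q.weight)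
  | .loop c p => max c.weight p.weight

/-- Integers up to `M` fit into words for integers up to `B`, and so do all results that are
computed from them by expressions of weight at most `W`. -/
structure WordSize (W M B : ℕ) : Prop where
  one_le : 1 ≤ M
  mul_le : W * M ≤ B

variable {W M B : ℕ} {s : State α}

theorem Expr.fits_of_bdd (hM : 1 ≤ M) (hs : s.Bdd M) (e : Expr) :
    e.weight * M ≤ B → e.Fits B s ∧ e.val s ≤ e.weight * M := by
  induction e with
  | const k =>
    exact fun h => ⟨(Nat.le_mul_of_pos_right k hM).trans h, Nat.le_mul_of_pos_right k hM⟩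
  | reg r =>
    simp only [weight, one_mul, Fits, val]
    exact fun h => ⟨(hs.1 r).trans h, hs.1 r⟩
  | read a i ih =>
    simp only [weight, Fits, val, max_mul, one_mul, max_le_iff]
    exact fun h => ⟨⟨(ih h.1).1, (hs.2 a _).trans h.2⟩, (hs.2 a _).trans (le_max_right _ _)⟩
  | plus e f ihe ihf =>
    simp only [weight, Fits, val, add_mul]
    intro h
    have he := ihe (by omega)
    have hf := ihf (by omega)
    have hsum := Nat.add_le_add he.2 hf.2
    exact ⟨⟨he.1, hf.1, hsum.trans h⟩, hsum⟩
  | minus e f ihe ihf =>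
    simp only [weight, Fits, val, max_mul, max_le_iff]
    exact fun h => ⟨⟨(ihe h.1).1, (ihf h.2).1⟩,
      (Nat.sub_le _ _).trans ((ihe h.1).2.trans (le_max_left _ _))⟩
  | half e ih => exact fun h => ⟨(ih h).1, (Nat.div_le_self _ _).trans (ih h).2⟩

theorem Expr.fits_of_weight_le (hw : WordSize W M B) (hs : s.Bdd M) {e : Expr}
    (he : e.weight ≤ W) : e.Fits B s :=
  (e.fits_of_bdd hw.one_le hs ((Nat.mul_le_mul_right M he).trans hw.mul_le)).1

theorem Test.fits_of_weight_le (hw : WordSize W M B) (hs : s.Bdd M) {c : Test}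
    (hc : c.weight ≤ W) : c.Fits B s := by
  cases c <;>
  · simp only [Test.weight, max_le_iff] at hc
    exact ⟨Expr.fits_of_weight_le hw hs hc.1, Expr.fits_of_weight_le hw hs hc.2⟩

theorem Test.cost_pos (c : Test) : 0 < c.cost := by cases c <;> exact Nat.succ_pos _

theorem State.Bdd.setReg (hs : s.Bdd M) {r x : ℕ} (hx : x ≤ M) : (s.setReg r x).Bdd M := by
  refine ⟨fun r' => ?_, hs.2⟩
  rw [State.reg_setReg]
  split
  · exact hx
  · exact hs.1 r'

theorem State.Bdd.setMem (hs : s.Bdd M) {a i x : ℕ} (hx : x ≤ M) : (s.setMem a i x).Bdd M := by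
  refine ⟨hs.1, fun a' j => ?_⟩
  rw [State.mem_setMem]
  split_ifs
  · exact hx
  · exact hs.2 _ _
  · exact hs.2 _ _

/-- The registers that the program assigns to. -/
def Prog.regs : Prog → List ℕ
  | .skip | .write .. | .copyChr .. => []
  | .set r _ => [r]
  | .seq p q | .ite _ p q => p.regs ++ q.regs
  | .loop _ p => p.regs

/-- The integer arrays that the program writes to. -/
def Prog.mems : Prog → List ℕ
  | .skip | .set .. | .copyChr .. => []
  | .write a _ _ => [a]
  | .seq p q | .ite _ p q => p.mems ++ q.mems
  | .loop _ p => p.mems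

/-- The letter arrays that the program writes to. -/
def Prog.chrs : Prog → List ℕ
  | .skip | .set .. | .write .. => []
  | .copyChr a _ _ _ => [a]
  | .seq p q | .ite _ p q => p.chrs ++ q.chrs
  | .loop _ p => p.chrs

/-- The states agree on the registers and arrays that are not targets of the program. -/
structure Prog.Frame (p : Prog) (s s' : State α) : Prop where
  reg : ∀ r, r ∉ p.regs → s'.reg r = s.reg r
  mem : ∀ a, a ∉ p.mems → s'.mem a = s.mem a
  chr : ∀ a, a ∉ p.chrs → s'.chr a = s.chr a

theorem Prog.Frame.refl (p : Prog) (s : State α) : p.Frame s s :=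
  ⟨fun _ _ => rfl, fun _ _ => rfl, fun _ _ => rfl⟩

theorem Prog.Frame.trans {p : Prog} {s s' s'' : State α} (h : p.Frame s s') (h' : p.Frame s' s'') :
    p.Frame s s'' :=
  ⟨fun r hr => (h'.reg r hr).trans (h.reg r hr), fun a ha => (h'.mem a ha).trans (h.mem a ha),
    fun a ha => (h'.chr a ha).trans (h.chr a ha)⟩

theorem Prog.Frame.mono {p q : Prog} {s s' : State α} (h : p.Frame s s') (hr : p.regs ⊆ q.regs)
    (hm : p.mems ⊆ q.mems) (hc : p.chrs ⊆ q.chrs) : q.Frame s s' :=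
  ⟨fun r h' => h.reg r fun h => h' (hr h), fun r h' => h.mem r fun h => h' (hm h),
    fun r h' => h.chr r fun h => h' (hc h)⟩

variable [LinearOrder α]

theorem Exec.frame {p : Prog} {t : ℕ} {s' : State α} (h : Exec B p s t s') : p.Frame s s' := by
  induction h with
  | skip => exact .refl _ _
  | set =>
    refine ⟨fun r hr => ?_, fun _ _ => rfl, fun _ _ => rfl⟩
    rw [State.reg_setReg, if_neg (by simpa [Prog.regs] using hr)]
  | write =>
    refine ⟨fun _ _ => rfl, fun a ha => ?_, fun _ _ => rfl⟩
    funext j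
    rw [State.mem_setMem, if_neg (by simpa [Prog.mems] using ha)]
  | copyChr =>
    refine ⟨fun _ _ => rfl, fun _ _ => rfl, fun a ha => ?_⟩
    funext j
    rw [State.chr_setChr, if_neg (by simpa [Prog.chrs] using ha)]
  | seq _ _ ih ih' =>
    exact (ih.mono (List.subset_append_left _ _) (List.subset_append_left _ _)
      (List.subset_append_left _ _)).trans (ih'.mono (List.subset_append_right _ _)
      (List.subset_append_right _ _) (List.subset_append_right _ _))
  | ite_true _ _ _ ih =>
    exact ih.mono (List.subset_append_left _ _) (List.subset_append_left _ _)
      (List.subset_append_left _ _)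
  | ite_false _ _ _ ih =>
    exact ih.mono (List.subset_append_right _ _) (List.subset_append_right _ _)
      (List.subset_append_right _ _)
  | loop_false => exact .refl _ _
  | loop_true _ _ _ _ ih ih' =>
    exact Prog.Frame.trans (p := .loop _ _)
      (ih.mono (List.Subset.refl _) (List.Subset.refl _) (List.Subset.refl _)) ih'

/-- The program halts on `s`, with all intermediate integers at most `B` and all final ones at most
`M`, and `Q` holds of its running time and its final state. -/
def Run (B M : ℕ) (p : Prog) (s : State α) (Q : ℕ → State α → Prop) : Prop :=
  ∃ t s', Exec B p s t s' ∧ s'.Bdd M ∧ p.Frame s s' ∧ Q t s'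

theorem Run.mono {p : Prog} {Q Q' : ℕ → State α → Prop} (h : Run B M p s Q)
    (hQ : ∀ t s', s'.Bdd M → p.Frame s s' → Q t s' → Q' t s') : Run B M p s Q' := by
  obtain ⟨t, s', hexec, hs', hframe, h⟩ := h
  exact ⟨t, s', hexec, hs', hframe, hQ t s' hs' hframe h⟩

theorem Run.seq {p q : Prog} {Q : ℕ → State α → Prop}
    (h : Run B M p s fun t s' => Run B M q s' fun t' => Q (t + t')) :
    Run B M (.seq p q) s Q := by
  obtain ⟨t, s', hexec, -, -, t', s'', hexec', hs'', -, h⟩ := h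
  exact ⟨_, _, .seq hexec hexec', hs'', (hexec.seq hexec').frame, h⟩

/-- An upper bound for the running time of a program without loops; the value at loops is junk. -/
def Prog.steps : Prog → ℕ
  | .skip => 1
  | .set _ e => e.cost + 1
  | .write _ i e => i.cost + e.cost + 1
  | .copyChr _ i _ j => i.cost + j.cost + 1
  | .seq p q => p.steps + q.steps
  | .ite c p q => c.cost + max p.steps q.steps
  | .loop _ _ => 0

/-- The weakest condition on the initial state of a program without loops that leads to a final
state with the property `Q` such that all assigned integers are at most `M`; it is `False` for
loops. -/
def Prog.wp (M : ℕ) : Prog → State α → (State α → Prop) → Prop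
  | .skip, s, Q => Q s
  | .set r e, s, Q => e.val s ≤ M ∧ Q (s.setReg r (e.val s))
  | .write a i e, s, Q => e.val s ≤ M ∧ Q (s.setMem a (i.val s) (e.val s))
  | .copyChr a i b j, s, Q => Q (s.setChr a (i.val s) (s.chr b (j.val s)))
  | .seq p q, s, Q => p.wp M s fun s' => q.wp M s' Q
  | .ite c p q, s, Q => (c.Holds s → p.wp M s Q) ∧ (¬ c.Holds s → q.wp M s Q)
  | .loop _ _, _, _ => False

theorem Prog.wp_mono {p : Prog} {Q Q' : State α → Prop} (h : p.wp M s Q)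
    (hQ : ∀ s', Q s' → Q' s') : p.wp M s Q' := by
  induction p generalizing s Q Q' with
  | skip => exact hQ _ h
  | set | write => exact ⟨h.1, hQ _ h.2⟩
  | copyChr => exact hQ _ h
  | seq p q ihp ihq => exact ihp h fun _ h' => ihq h' hQ
  | ite c p q ihp ihq => exact ⟨fun hc => ihp (h.1 hc) hQ, fun hc => ihq (h.2 hc) hQ⟩
  | loop => exact h

theorem Prog.exists_exec_of_wp (hw : WordSize W M B) {p : Prog} (hp : p.weight ≤ W)
    {Q : State α → Prop} (hs : s.Bdd M) (h : p.wp M s Q) :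
    ∃ t s', Exec B p s t s' ∧ s'.Bdd M ∧ t ≤ p.steps ∧ Q s' := by
  induction p generalizing s Q with
  | skip => exact ⟨_, _, .skip, hs, le_rfl, h⟩
  | set r e => exact ⟨_, _, .set (Expr.fits_of_weight_le hw hs hp), hs.setReg h.1, le_rfl, h.2⟩
  | write a i e =>
    simp only [weight, max_le_iff] at hp
    exact ⟨_, _, .write (Expr.fits_of_weight_le hw hs hp.1) (Expr.fits_of_weight_le hw hs hp.2),
      hs.setMem h.1, le_rfl, h.2⟩
  | copyChr a i b j =>
    simp only [weight, max_le_iff] at hp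
    exact ⟨_, _, .copyChr (Expr.fits_of_weight_le hw hs hp.1) (Expr.fits_of_weight_le hw hs hp.2),
      hs, le_rfl, h⟩
  | seq p q ihp ihq =>
    simp only [weight, max_le_iff] at hp
    obtain ⟨t, s', hexec, hs', ht, h⟩ := ihp hp.1 hs h
    obtain ⟨t', s'', hexec', hs'', ht', h⟩ := ihq hp.2 hs' h
    exact ⟨_, _, .seq hexec hexec', hs'', Nat.add_le_add ht ht', h⟩
  | ite c p q ihp ihq =>
    simp only [weight, max_le_iff] at hp
    have hfits := Test.fits_of_weight_le hw hs hp.1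
    by_cases hc : c.Holds s
    · obtain ⟨t, s', hexec, hs', ht, h⟩ := ihp hp.2.1 hs (h.1 hc)
      exact ⟨_, _, .ite_true hfits hc hexec, hs',
        Nat.add_le_add_left (ht.trans (le_max_left _ _)) _, h⟩
    · obtain ⟨t, s', hexec, hs', ht, h⟩ := ihq hp.2.2 hs (h.2 hc)
      exact ⟨_, _, .ite_false hfits hc hexec, hs',
        Nat.add_le_add_left (ht.trans (le_max_right _ _)) _, h⟩
  | loop c p => exact h.elim

theorem Run.of_wp {τ : ℕ} (hw : WordSize W M B) {p : Prog} (hp : p.weight ≤ W)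
    {Q : ℕ → State α → Prop} (hs : s.Bdd M) (hτ : p.steps ≤ τ)
    (h : p.wp M s fun s' => ∀ t, t ≤ τ → Q t s') : Run B M p s Q := by
  obtain ⟨t, s', hexec, hs', ht, h⟩ := Prog.exists_exec_of_wp hw hp hs h
  exact ⟨t, s', hexec, hs', hexec.frame, h _ (ht.trans hτ)⟩

theorem Run.ite (hw : WordSize W M B) {c : Test} (hc : c.weight ≤ W) {p q : Prog}
    {Q : ℕ → State α → Prop} (hs : s.Bdd M)
    (hp : c.Holds s → Run B M p s fun t => Q (c.cost + t))
    (hq : ¬ c.Holds s → Run B M q s fun t => Q (c.cost + t)) : Run B M (.ite c p q) s Q := by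
  have hfits := Test.fits_of_weight_le hw hs hc
  by_cases h : c.Holds s
  · obtain ⟨t, s', hexec, hs', -, hQ⟩ := hp h
    have hexec := Exec.ite_true (q := q) hfits h hexec
    exact ⟨_, _, hexec, hs', hexec.frame, hQ⟩
  · obtain ⟨t, s', hexec, hs', -, hQ⟩ := hq h
    have hexec := Exec.ite_false (p := p) hfits h hexec
    exact ⟨_, _, hexec, hs', hexec.frame, hQ⟩

/-- `Inv n s'` has to entail that at most `n` steps remain, the final test excluded. -/
theorem Run.loop (hw : WordSize W M B) {c : Test} (hc : c.weight ≤ W) {p : Prog}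
    (Inv : ℕ → State α → Prop) {n : ℕ} (hs : s.Bdd M) (hn : Inv n s)
    (h : ∀ n s', s'.Bdd M → p.Frame s s' → Inv n s' → c.Holds s' →
      Run B M p s' fun t s'' => ∃ n', t + c.cost + n' ≤ n ∧ Inv n' s'') :
    Run B M (.loop c p) s fun t s' =>
      ∃ n', t + n' ≤ n + c.cost ∧ Inv n' s' ∧ ¬ c.Holds s' := by
  suffices key : ∀ n s', s'.Bdd M → p.Frame s s' → Inv n s' →
      ∃ t s'', Exec B (.loop c p) s' t s'' ∧ s''.Bdd M ∧
        ∃ n', t + n' ≤ n + c.cost ∧ Inv n' s'' ∧ ¬ c.Holds s'' by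
    obtain ⟨t, s', hexec, hs', hQ⟩ := key n s hs (.refl _ _) hn
    exact ⟨t, s', hexec, hs', hexec.frame, hQ⟩
  intro n
  induction n using Nat.strong_induction_on with
  | _ n ih =>
    intro s' hs' hframe hinv
    have hfits := Test.fits_of_weight_le hw hs' hc
    by_cases hholds : c.Holds s'
    · obtain ⟨t, s'', hexec, hs'', hframe', n', hn', hinv'⟩ := h n s' hs' hframe hinv hholds
      obtain ⟨t', s₃, hexec', hs₃, n'', hn'', hinv''⟩ :=
        ih n' (by have := c.cost_pos; omega) s'' hs'' (hframe.trans hframe') hinv'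
      exact ⟨_, _, .loop_true hfits hholds hexec hexec', hs₃, n'', by omega, hinv''⟩
    · exact ⟨_, _, .loop_false hfits hholds, hs', n, by omega, hinv, hholds⟩

end Machine

/-! ### The program -/

section Algorithm

local infixr:25 " ;; " => Prog.seq

/- The first seven integer arrays and letter array `Chr.label` hold the input, the next four integer
arrays and letter array `Chr.out` the output.  Register 1 holds the number of edges and in the end
the start variable.  The variables of the straight-line program are `X(e) = e`, the variable
`e + edges` for the string from the upper end of `e` down to the next type-1 node below it, and from
`2 * edges` on those for the path that spells out the text. -/

namespace Reg

@[simp] abbrev size : ℕ := 0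
@[simp] abbrev start : ℕ := 1
@[simp] abbrev edges : ℕ := 1
@[simp] abbrev root : ℕ := 2
@[simp] abbrev loop : ℕ := 3
@[simp] abbrev edge : ℕ := 4
@[simp] abbrev rest : ℕ := 5
@[simp] abbrev var : ℕ := 6
@[simp] abbrev low : ℕ := 7
@[simp] abbrev high : ℕ := 8
@[simp] abbrev mid : ℕ := 9
@[simp] abbrev left : ℕ := 10
@[simp] abbrev right : ℕ := 11
@[simp] abbrev next : ℕ := 12
@[simp] abbrev front : ℕ := 13
@[simp] abbrev back : ℕ := 14
@[simp] abbrev node : ℕ := 15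
@[simp] abbrev out : ℕ := 16
@[simp] abbrev outEnd : ℕ := 17
@[simp] abbrev target : ℕ := 18
@[simp] abbrev best : ℕ := 19

end Reg

namespace Arr

@[simp] abbrev type2 : ℕ := 0
@[simp] abbrev slink : ℕ := 1
@[simp] abbrev first : ℕ := 2
@[simp] abbrev deg : ℕ := 3
@[simp] abbrev hi : ℕ := 4
@[simp] abbrev lo : ℕ := 5
@[simp] abbrev slen : ℕ := 6
@[simp] abbrev kind : ℕ := 7
@[simp] abbrev left : ℕ := 8
@[simp] abbrev right : ℕ := 9
@[simp] abbrev table : ℕ := 10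
@[simp] abbrev head : ℕ := 11
@[simp] abbrev mark : ℕ := 12
@[simp] abbrev indeg : ℕ := 13
@[simp] abbrev queue : ℕ := 14
@[simp] abbrev dist : ℕ := 15
@[simp] abbrev pred : ℕ := 16

end Arr

namespace Chr

@[simp] abbrev label : ℕ := 0
@[simp] abbrev out : ℕ := 1

end Chr

section Productions

/-- Runs `p` for all edges, with the edge in register `Reg.loop`. -/
def forEdges (p : Prog) : Prog :=
  .set Reg.loop (.const 0) ;;
  .loop (.lt (.reg Reg.loop) (.reg Reg.edges))
    (p ;; .set Reg.loop (.plus (.reg Reg.loop) (.const 1)))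

/-- Given in register `r` an edge that ends in a type-2 node, computes the variable for the string
from there to the next type-1 node. -/
def setRest (r : ℕ) : Prog :=
  .set Reg.edge (.read Arr.first (.read Arr.lo (.reg r))) ;;
  .ite (.eq (.read Arr.type2 (.read Arr.lo (.reg Reg.edge))) (.const 1))
    (.set Reg.rest (.plus (.reg Reg.edge) (.reg Reg.edges)))
    (.set Reg.rest (.reg Reg.edge))

/-- Stores the production with the left side `i` and the right side `x y`. -/
def writeRule (i : ℕ) (x y : Expr) : Prog :=
  .write Arr.kind (.reg i) (.const 1) ;; .write Arr.left (.reg i) x ;; .write Arr.right (.reg i) y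

/-- Stores the production of the variable in register `i` for the edge in register `r`, which ends
in a type-2 node, and the string from there to the next type-1 node. -/
def storeRule (i r : ℕ) : Prog := setRest r ;; writeRule i (.reg r) (.reg Reg.rest)

def tailBody : Prog :=
  .write Arr.table (.reg Reg.loop) (.reg Reg.loop) ;;
  .copyChr Chr.out (.reg Reg.loop) Chr.label (.reg Reg.loop) ;;
  .set Reg.var (.plus (.reg Reg.loop) (.reg Reg.edges)) ;;
  .ite (.eq (.read Arr.type2 (.read Arr.lo (.reg Reg.loop))) (.const 1))
    (storeRule Reg.var Reg.loop)
    (.write Arr.kind (.reg Reg.var) (.const 0) ;;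
      .copyChr Chr.out (.reg Reg.var) Chr.label (.reg Reg.loop))

def tailProg : Prog := forEdges tailBody

variable {α : Type*} {s s' : State α}

/-- The production `i → a` is stored. -/
def HasLetter (s : State α) (i : ℕ) (a : α) : Prop :=
  s.mem Arr.kind i = 0 ∧ s.chr Chr.out i = some a

/-- The states agree on the production of variable `i`, letters excepted. -/
def SameRule (s s' : State α) (i : ℕ) : Prop :=
  s'.mem Arr.kind i = s.mem Arr.kind i ∧ s'.mem Arr.left i = s.mem Arr.left i ∧
    s'.mem Arr.right i = s.mem Arr.right i

/-- The states differ at most in the production of variable `i` and in registers. -/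
structure UpdateRule (s s' : State α) (i : ℕ) : Prop where
  mem : ∀ a j, a ∉ [Arr.kind, Arr.left, Arr.right] ∨ j ≠ i → s'.mem a j = s.mem a j
  chr : s'.chr = s.chr

theorem SameRule.trans {s'' : State α} {i : ℕ} (h : SameRule s s' i) (h' : SameRule s' s'' i) :
    SameRule s s'' i :=
  ⟨h'.1.trans h.1, h'.2.1.trans h.2.1, h'.2.2.trans h.2.2⟩

theorem HasLetter.congr {i : ℕ} {a : α} (h : HasLetter s i a) (hs : SameRule s s' i)
    (hc : s'.chr Chr.out i = s.chr Chr.out i) : HasLetter s' i a := by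
  unfold HasLetter
  rwa [hs.1, hc]

theorem UpdateRule.sameRule {i j : ℕ} (h : UpdateRule s s' i) (hj : j ≠ i) : SameRule s s' j :=
  ⟨h.mem _ _ (.inr hj), h.mem _ _ (.inr hj), h.mem _ _ (.inr hj)⟩

variable [LinearOrder α] {T : List α}

namespace LCDAWG

/-- The input is still in memory. -/
structure Inp (L : LCDAWG T) (s : State α) : Prop where
  edges : s.reg Reg.edges = L.edges
  root : s.reg Reg.root = L.root
  type2 : ∀ i : Fin L.nodes, s.mem Arr.type2 i = if L.type2 i then 1 else 0
  slink : ∀ i : Fin L.nodes, s.mem Arr.slink i = L.slink i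
  first : ∀ i : Fin L.nodes, s.mem Arr.first i = L.first i
  deg : ∀ i : Fin L.nodes, s.mem Arr.deg i = L.deg i
  hi : ∀ e : Fin L.edges, s.mem Arr.hi e = L.hi e
  lo : ∀ e : Fin L.edges, s.mem Arr.lo e = L.lo e
  slen : ∀ e : Fin L.edges, s.mem Arr.slen e = L.slen e
  chr : ∀ e : Fin L.edges, s.chr Chr.label e = some (L.chr e)

/-- Integers up to `M` suffice for the data of the computation, and words for integers up to `B`
for the intermediate results. -/
structure Big (L : LCDAWG T) (B M : ℕ) : Prop where
  word : WordSize 4 M B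
  edges : 3 * L.edges + 2 ≤ M
  nodes : L.nodes ≤ M
  length : T.length ≤ M

/-- The common precondition of all parts of the program. -/
structure Ready (L : LCDAWG T) (B M : ℕ) (s : State α) : Prop where
  big : L.Big B M
  bdd : s.Bdd M
  inp : L.Inp s

end LCDAWG

/-- The program does not assign to the registers and arrays of the input. -/
abbrev Prog.PreservesInput (p : Prog) : Prop :=
  Reg.edges ∉ p.regs ∧ Reg.root ∉ p.regs ∧ (∀ a < 7, a ∉ p.mems) ∧ Chr.label ∉ p.chrs

namespace LCDAWG

variable {L : LCDAWG T} {B M : ℕ}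

theorem inp_initState (L : LCDAWG T) : L.Inp L.initState := by
  constructor <;> simp [initState, cells]

theorem Inp.congr (h : L.Inp s) (hr : s'.reg Reg.edges = s.reg Reg.edges)
    (hr' : s'.reg Reg.root = s.reg Reg.root) (hm : ∀ a < 7, s'.mem a = s.mem a)
    (hc : s'.chr Chr.label = s.chr Chr.label) : L.Inp s' where
  edges := hr.trans h.edges
  root := hr'.trans h.root
  type2 i := (congrFun (hm _ (by decide)) i).trans (h.type2 i)
  slink i := (congrFun (hm _ (by decide)) i).trans (h.slink i)
  first i := (congrFun (hm _ (by decide)) i).trans (h.first i)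
  deg i := (congrFun (hm _ (by decide)) i).trans (h.deg i)
  hi e := (congrFun (hm _ (by decide)) e).trans (h.hi e)
  lo e := (congrFun (hm _ (by decide)) e).trans (h.lo e)
  slen e := (congrFun (hm _ (by decide)) e).trans (h.slen e)
  chr e := (congrFun hc e).trans (h.chr e)

theorem Ready.frame {p : Prog} (h : L.Ready B M s) (hs' : s'.Bdd M) (hf : p.Frame s s')
    (hp : p.PreservesInput) : L.Ready B M s' :=
  ⟨h.big, hs', h.inp.congr (hf.reg _ hp.1) (hf.reg _ hp.2.1)
    (fun a ha => hf.mem a (hp.2.2.1 a ha)) (hf.chr _ hp.2.2.2)⟩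

theorem Ready.setReg (h : L.Ready B M s) {r x : ℕ} (hx : x ≤ M)
    (hr : r ∉ [Reg.edges, Reg.root] := by decide) : L.Ready B M (s.setReg r x) := by
  simp only [List.mem_cons, List.not_mem_nil, or_false, not_or] at hr
  exact ⟨h.big, h.bdd.setReg hx, h.inp.congr (by simp [Ne.symm hr.1]) (by simp [Ne.symm hr.2])
    (fun _ _ => rfl) rfl⟩

theorem Ready.setMem (h : L.Ready B M s) {a i x : ℕ} (hx : x ≤ M) (ha : 7 ≤ a := by decide) :
    L.Ready B M (s.setMem a i x) :=
  ⟨h.big, h.bdd.setMem hx, h.inp.congr rfl rfl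
    (fun a' ha' => by funext j; rw [State.mem_setMem, if_neg (by omega)]) rfl⟩

theorem Ready.setChr (h : L.Ready B M s) {a i : ℕ} {x : Option α}
    (ha : a ≠ Chr.label := by decide) : L.Ready B M (s.setChr a i x) :=
  ⟨h.big, h.bdd, h.inp.congr rfl rfl (fun _ _ => rfl)
    (by funext j; rw [State.chr_setChr, if_neg ha.symm])⟩

theorem Ready.run_of_wp (h : L.Ready B M s) {p : Prog} {Q : ℕ → State α → Prop} {τ : ℕ}
    (hwp : p.wp M s fun s' => ∀ t, t ≤ τ → Q t s') (hτ : p.steps ≤ τ := by decide)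
    (hp : p.weight ≤ 4 := by decide) : Run B M p s Q :=
  Run.of_wp h.big.word hp h.bdd hτ hwp

theorem run_forEdges (h : L.Ready B M s) {p : Prog} (hp : p.PreservesInput)
    (hloop : Reg.loop ∉ p.regs) (Inv : ℕ → State α → Prop) (Φ : State α → ℕ) (τ : ℕ)
    (h0 : Inv 0 (s.setReg Reg.loop 0))
    (hbody : ∀ (e : Fin L.edges) s', L.Ready B M s' → (forEdges p).Frame s s' →
      s'.reg Reg.loop = e → Inv e s' → Run B M p s' fun t s'' =>
        t + Φ (s''.setReg Reg.loop (e + 1)) ≤ τ + Φ s' ∧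
          Inv (e + 1) (s''.setReg Reg.loop (e + 1))) :
    Run B M (forEdges p) s fun t s' =>
      t + Φ s' ≤ (τ + 7) * L.edges + 5 + Φ (s.setReg Reg.loop 0) ∧ Inv L.edges s' := by
  have hM := h.big.edges
  refine Run.seq (h.run_of_wp (τ := 2) ⟨Nat.zero_le _, fun t ht => ?_⟩)
  simp only [Expr.val]
  set s₀ := s.setReg Reg.loop 0
  have hready₀ : L.Ready B M s₀ := h.setReg (Nat.zero_le _)
  have hframe₀ : (forEdges p).Frame s s₀ := by
    refine ⟨fun r hr => ?_, fun _ _ => rfl, fun _ _ => rfl⟩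
    simp only [forEdges, Prog.regs, List.singleton_append, List.mem_cons, not_or] at hr
    simp [s₀, hr.1]
  have hpres : (p ;; .set Reg.loop (.plus (.reg Reg.loop) (.const 1))).PreservesInput := by
    simpa [Prog.PreservesInput, Prog.regs, Prog.mems, Prog.chrs] using hp
  refine (Run.loop (n := (τ + 7) * L.edges + Φ s₀) h.big.word (by decide)
    (fun n s' => ∃ k ≤ L.edges, s'.reg Reg.loop = k ∧ Inv k s' ∧
      n = (τ + 7) * (L.edges - k) + Φ s')
    hready₀.bdd ⟨0, Nat.zero_le _, by simp [s₀], h0, rfl⟩ ?_).mono ?_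
  · rintro n s' hs' hf ⟨k, -, hk, hinv, rfl⟩ hlt
    have hready := hready₀.frame hs' hf hpres
    simp only [Test.Holds, Expr.val, hready.inp.edges, hk] at hlt
    have hframe := hframe₀.trans (hf.mono (List.subset_append_right _ _)
      (List.subset_append_right _ _) (List.subset_append_right _ _))
    refine Run.seq ((hbody ⟨k, hlt⟩ s' hready hframe hk hinv).mono ?_)
    rintro t' s'' hs'' hf' ⟨ht', hinv'⟩
    have hk' : s''.reg Reg.loop = k := (hf'.reg _ hloop).trans hk
    refine (hready.frame hs'' hf' hp).run_of_wp (τ := 4) ?_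
    simp only [Prog.wp, Expr.val, hk']
    refine ⟨by omega, fun t'' ht'' => ⟨_, ?_, k + 1, hlt, by simp, hinv', rfl⟩⟩
    obtain ⟨d, hd⟩ : ∃ d, L.edges - k = d + 1 := ⟨L.edges - k - 1, by omega⟩
    rw [hd, show L.edges - (k + 1) = d by omega, Nat.mul_succ]
    dsimp only at ht'
    simp only [Test.cost, Expr.cost]
    omega
  · rintro t' s' hs' hf ⟨n, hn, ⟨k, hle, hk, hinv, rfl⟩, hge⟩
    simp only [Test.Holds, Expr.val, (hready₀.frame hs' hf hpres).inp.edges, hk, not_lt] at hge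
    obtain rfl : k = L.edges := le_antisymm hle hge
    simp only [Test.cost, Expr.cost, Nat.sub_self, mul_zero] at hn
    exact ⟨by omega, hinv⟩

/-- The variable for the string that is read from `f` down to the next type-1 node. -/
def restVar (L : LCDAWG T) (f : Fin L.edges) : ℕ := if L.type2 (L.lo f) then f + L.edges else f

/-- The production `i → X(e) Y` is stored, where `Y` stands for the string from the end of `e` down
to the next type-1 node. -/
def HasRule (L : LCDAWG T) (s : State α) (i : ℕ) (e : Fin L.edges) : Prop :=
  s.mem Arr.kind i = 1 ∧ s.mem Arr.left i = e ∧
    ∃ f, L.hi f = L.lo e ∧ s.mem Arr.right i = L.restVar f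

theorem HasRule.congr {i : ℕ} {e : Fin L.edges} (h : L.HasRule s i e) (hs : SameRule s s' i) :
    L.HasRule s' i e := by
  unfold HasRule
  rwa [hs.1, hs.2.1, hs.2.2]

theorem wp_setRest (h : L.Ready B M s) {r : ℕ} {e : Fin L.edges} (hr : s.reg r = e)
    (he : L.type2 (L.lo e) = true) {Q : State α → Prop}
    (hQ : ∀ f, L.hi f = L.lo e → Q ((s.setReg Reg.edge f).setReg Reg.rest (L.restVar f))) :
    (setRest r).wp M s Q := by
  obtain ⟨f, hf⟩ := L.exists_edge_of_type2 he
  have hfirst : L.first (L.lo e) = f := by rw [← hf] at he ⊢; exact L.first_eq_of_type2 he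
  have hM := h.big.edges
  have := f.2
  have hQ := hQ f hf
  simp only [setRest, Prog.wp, Expr.val, Test.Holds, State.reg_setReg, State.mem_setReg, hr,
    h.inp.lo, h.inp.first, h.inp.type2, hfirst, if_true, Reg.edges, Reg.edge, Nat.reduceEqDiff,
    if_false, h.inp.edges]
  refine ⟨by omega, fun htype2 => ?_, fun htype2 => ?_⟩
  · rw [restVar, if_pos (by simpa using htype2)] at hQ
    exact ⟨by omega, hQ⟩
  · rw [restVar, if_neg (by simpa using htype2)] at hQ
    exact ⟨by omega, hQ⟩

theorem wp_storeRule (h : L.Ready B M s) {r i : ℕ} {e : Fin L.edges} (hr : s.reg r = e)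
    (he : L.type2 (L.lo e) = true) (hri : r ∉ [Reg.edge, Reg.rest] ∧ i ∉ [Reg.edge, Reg.rest])
    {Q : State α → Prop} (hQ : ∀ s', L.HasRule s' (s.reg i) e → UpdateRule s s' (s.reg i) → Q s') :
    (storeRule i r).wp M s Q := by
  refine wp_setRest h hr he fun f hf => ?_
  have hM := h.big.edges
  have hrest : L.restVar f < 2 * L.edges := by unfold restVar; split <;> omega
  simp only [List.mem_cons, List.not_mem_nil, or_false, not_or] at hri
  simp only [writeRule, Prog.wp, Expr.val, State.reg_setReg, State.reg_setMem, if_true, hri,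
    if_false, hr]
  refine ⟨by omega, by omega, by omega, hQ _ ⟨?_, ?_, f, hf, ?_⟩ ⟨fun a j haj => ?_, rfl⟩⟩
  · simp
  · simp
  · simp
  · simp only [State.mem_setMem, State.mem_setReg]
    grind

/-- The results of `tailBody` for the edge `e`; the production of `e + L.edges` is a dummy if `e`
ends in a type-1 node. -/
def StoresTail (L : LCDAWG T) (s : State α) (e : Fin L.edges) : Prop :=
  s.mem Arr.table e = e ∧ s.chr Chr.out e = some (L.chr e) ∧
    if L.type2 (L.lo e) then L.HasRule s (e + L.edges) e else HasLetter s (e + L.edges) (L.chr e)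

theorem StoresTail.congr {e : Fin L.edges} (h : L.StoresTail s e)
    (ht : s'.mem Arr.table e = s.mem Arr.table e) (hs : SameRule s s' (e + L.edges))
    (hc : ∀ i ∈ [(e : ℕ), e + L.edges], s'.chr Chr.out i = s.chr Chr.out i) :
    L.StoresTail s' e := by
  refine ⟨ht.trans h.1, (hc _ (by simp)).trans h.2.1, ?_⟩
  have hrule := h.2.2
  split at hrule
  · rw [if_pos ‹_›]
    exact hrule.congr hs
  · rw [if_neg ‹_›]
    exact hrule.congr hs (hc _ (by simp))

theorem wp_tailBody (h : L.Ready B M s) {e : Fin L.edges} (he : s.reg Reg.loop = e) :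
    tailBody.wp M s fun s' =>
      L.StoresTail s' e ∧ ∀ e' ≠ e, L.StoresTail s e' → L.StoresTail s' e' := by
  have hM := h.big.edges
  have := e.2
  set s₁ := ((s.setMem Arr.table e e).setChr Chr.out e (some (L.chr e))).setReg Reg.var
    (e + L.edges) with hs₁
  have hready : L.Ready B M s₁ := ((h.setMem (by omega)).setChr).setReg (by omega)
  have hloop : s₁.reg Reg.loop = e := he
  have hvar : s₁.reg Reg.var = e + L.edges := by simp [hs₁]
  simp only [tailBody, Prog.wp, Expr.val, Test.Holds, State.reg_setMem, State.reg_setChr,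
    State.chr_setMem, he, h.inp.edges, h.inp.chr, ← hs₁, hready.inp.lo, hready.inp.type2, hvar,
    hloop]
  refine ⟨by omega, by omega, fun htype2 => ?_, fun htype2 => ⟨Nat.zero_le _, ?_, ?_⟩⟩
  · have htype2 : L.type2 (L.lo e) = true := by simpa using htype2
    refine wp_storeRule hready hloop htype2 (by decide) fun s' hrule hupd => ⟨⟨?_, ?_, ?_⟩, ?_⟩
    · simp [hupd.mem, hs₁]
    · simp [hupd.chr, hs₁]
    · rwa [if_pos htype2, ← hvar]
    · intro e' he' htail
      have hval := Fin.val_ne_of_ne he'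
      have hrule : e' + L.edges ≠ s₁.reg Reg.var := by omega
      refine htail.congr ?_ (hupd.sameRule hrule) ?_
      · simp [hupd.mem, hs₁, hval]
      · simp [hupd.chr, hs₁, hval]
        omega
  · have htype2 : L.type2 (L.lo e) = false := by simpa using htype2
    have hchr := h.inp.chr e
    simp_all [StoresTail, HasLetter]
  · intro e' he' htail
    have hval := Fin.val_ne_of_ne he'
    refine htail.congr ?_ ⟨?_, ?_, ?_⟩ ?_
    · simp [hs₁, hval]
    · simp [hs₁, hval]
    · simp [hs₁]
    · simp [hs₁]
    · simp [hs₁, hval]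
      omega

theorem run_tailProg (h : L.Ready B M s) :
    Run B M tailProg s fun t s' => t ≤ 67 * L.edges + 5 ∧ ∀ e, L.StoresTail s' e := by
  refine (run_forEdges h (by decide) (by decide) (fun k s => ∀ e : Fin L.edges, e < k →
    L.StoresTail s e) (fun _ => 0) 60 (fun _ he => absurd he (Nat.not_lt_zero _)) ?_).mono
    fun t s' _ _ hs' => ⟨hs'.1, fun e => hs'.2 e e.2⟩
  intro e s' hs' _ he hinv
  refine hs'.run_of_wp (Prog.wp_mono (wp_tailBody hs' he) fun s'' htail t ht => ⟨ht, ?_⟩)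
  intro e' he'
  obtain rfl | hne := eq_or_ne e' e
  · exact htail.1
  · exact htail.2 e' hne (hinv e' (by have := Fin.val_ne_of_ne hne; omega))

end LCDAWG

end Productions

/-! ### Jump links in memory -/

section Jumps

def headInit : Prog :=
  .set Reg.low (.read Arr.first (.read Arr.slink (.read Arr.hi (.reg Reg.loop)))) ;;
  .set Reg.high (.plus (.reg Reg.low)
    (.read Arr.deg (.read Arr.slink (.read Arr.hi (.reg Reg.loop)))))

/-- Searches the edges from the one in register `Reg.low` to the one before that in register
`Reg.high` for the first letter of the edge in register `Reg.loop`. -/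
def searchProg : Prog :=
  .loop (.lt (.plus (.reg Reg.low) (.const 1)) (.reg Reg.high))
    (.set Reg.mid (.half (.plus (.reg Reg.low) (.reg Reg.high))) ;;
      .ite (.chrLt Chr.label (.reg Reg.loop) Chr.label (.reg Reg.mid))
        (.set Reg.high (.reg Reg.mid))
        (.set Reg.low (.reg Reg.mid)))

def headRule : Prog :=
  .write Arr.head (.reg Reg.loop) (.reg Reg.low) ;;
  .ite (.eq (.read Arr.slen (.reg Reg.low)) (.read Arr.slen (.reg Reg.loop)))
    (.write Arr.mark (.reg Reg.loop) (.const 1))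
    (.write Arr.mark (.reg Reg.loop) (.const 0) ;; storeRule Reg.loop Reg.low)

def headBody : Prog :=
  .ite (.lt (.const 1) (.read Arr.slen (.reg Reg.loop)))
    (headInit ;; searchProg ;; headRule)
    (.write Arr.mark (.reg Reg.loop) (.const 0) ;; .write Arr.kind (.reg Reg.loop) (.const 0))

def headProg : Prog := forEdges headBody

/-- Moves from the edge in register `Reg.edge` to the first edge of its edge suffix link, while the
production of the edge is postponed. -/
def walkProg : Prog :=
  .loop (.eq (.read Arr.mark (.reg Reg.edge)) (.const 1))
    (.set Reg.edge (.read Arr.head (.reg Reg.edge)))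

def fillBody : Prog :=
  .set Reg.next (.read Arr.head (.reg Reg.edge)) ;;
  .write Arr.mark (.reg Reg.edge) (.const 0) ;;
  writeRule Reg.edge (.reg Reg.left) (.reg Reg.right) ;;
  .set Reg.edge (.reg Reg.next)

/-- Stores the postponed productions along the same walk. -/
def fillProg : Prog := .loop (.eq (.read Arr.mark (.reg Reg.edge)) (.const 1)) fillBody

def jumpInit : Prog :=
  .set Reg.left (.read Arr.left (.reg Reg.edge)) ;;
  .set Reg.right (.read Arr.right (.reg Reg.edge)) ;;
  .set Reg.edge (.reg Reg.loop)

def jumpBody : Prog := .set Reg.edge (.reg Reg.loop) ;; walkProg ;; jumpInit ;; fillProg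

def jumpProg : Prog := forEdges jumpBody

variable {α : Type*} {s s' : State α}

/-- The states agree on the production of `X(e)` or its postponement. -/
def SameEntry (s s' : State α) (e : ℕ) : Prop :=
  SameRule s s' e ∧ s'.mem Arr.mark e = s.mem Arr.mark e ∧ s'.mem Arr.head e = s.mem Arr.head e

variable [LinearOrder α] {T : List α}

namespace LCDAWG

variable {L : LCDAWG T} {B M : ℕ}

/-- The production of the variable `X(e)` is stored if `L.slen e ≠ 1`; the letter is left out if
`L.slen e = 1`. -/
def StoresEdge (L : LCDAWG T) (s : State α) (e : Fin L.edges) : Prop :=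
  (L.slen e = 1 ∧ s.mem Arr.kind e = 0) ∨
    (2 ≤ L.slen e ∧ ∃ g, L.IsJumpHead e g ∧ L.HasRule s e g)

/-- The edge suffix link of `e` consists of `e₁` only, and hence the production of `X(e)`, which is
that of `X(e₁)`, is postponed. -/
def Deferred (L : LCDAWG T) (s : State α) (e e₁ : Fin L.edges) : Prop :=
  s.mem Arr.mark e = 1 ∧ s.mem Arr.head e = e₁ ∧ 2 ≤ L.slen e ∧ L.IsESufHead e e₁ ∧
    L.slen e₁ = L.slen e

/-- The production of `X(e)` is stored or postponed. -/
def StoresHead (L : LCDAWG T) (s : State α) (e : Fin L.edges) : Prop :=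
  (s.mem Arr.mark e = 0 ∧ L.StoresEdge s e) ∨ ∃ e₁, L.Deferred s e e₁

theorem StoresEdge.congr {e : Fin L.edges} (h : L.StoresEdge s e) (hs : SameRule s s' e) :
    L.StoresEdge s' e :=
  h.imp (fun h => ⟨h.1, hs.1.trans h.2⟩)
    fun ⟨he, g, hg, hrule⟩ => ⟨he, g, hg, hrule.congr hs⟩

theorem Deferred.congr {e e₁ : Fin L.edges} (h : L.Deferred s e e₁) (hs : SameEntry s s' e) :
    L.Deferred s' e e₁ :=
  ⟨hs.2.1.trans h.1, hs.2.2.trans h.2.1, h.2.2⟩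

theorem StoresHead.congr {e : Fin L.edges} (h : L.StoresHead s e) (hs : SameEntry s s' e) :
    L.StoresHead s' e :=
  h.imp (fun h => ⟨hs.2.1.trans h.1, h.2.congr hs.1⟩) fun ⟨e₁, he₁⟩ => ⟨e₁, he₁.congr hs⟩

theorem StoresHead.exists_deferred {e : Fin L.edges} (h : L.StoresHead s e)
    (hm : s.mem Arr.mark e = 1) : ∃ e₁, L.Deferred s e e₁ :=
  h.resolve_left fun h => zero_ne_one (h.1.symm.trans hm)

theorem StoresHead.storesEdge {e : Fin L.edges} (h : L.StoresHead s e)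
    (hm : s.mem Arr.mark e ≠ 1) : L.StoresEdge s e :=
  (h.resolve_right fun ⟨_, he₁⟩ => hm he₁.1).2

theorem clog_two_add_one_le {a b : ℕ} (h : 2 * b ≤ a + 1) (ha : 2 ≤ a) :
    Nat.clog 2 b + 1 ≤ Nat.clog 2 a := by
  rw [Nat.clog_of_two_le (n := a) one_lt_two ha]
  exact Nat.add_le_add_right (Nat.clog_mono_right 2 (by omega)) 1

theorem chr_lt_chr_iff {e f : Fin L.edges} (h : L.hi e = L.hi f) : L.chr e < L.chr f ↔ e < f := by
  refine ⟨fun hlt => not_le.1 fun hle => ?_, L.out_sorted e f h⟩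
  obtain rfl | hfe := hle.eq_or_lt
  · exact lt_irrefl _ hlt
  · exact lt_asymm hlt (L.out_sorted f e h.symm hfe)

theorem run_searchProg (h : L.Ready B M s) {e g : Fin L.edges} (he : s.reg Reg.loop = e)
    (hg : L.chr g = L.chr e) (hlow : s.reg Reg.low = L.first (L.hi g))
    (hhigh : s.reg Reg.high = L.first (L.hi g) + L.deg (L.hi g)) :
    Run B M searchProg s fun t s' =>
      t ≤ 20 * Nat.clog 2 (L.deg (L.hi g)) + 5 ∧ s'.reg Reg.low = g := by
  have hle := L.out_le (L.hi g)
  have hout := (L.out_spec (L.hi g) g).1 rfl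
  refine (Run.loop (n := 20 * Nat.clog 2 (L.deg (L.hi g))) h.big.word (by decide)
    (fun n s' => ∃ a b, s'.reg Reg.low = a ∧ s'.reg Reg.high = b ∧ L.first (L.hi g) ≤ a ∧ a ≤ g ∧
      g < b ∧ b ≤ L.first (L.hi g) + L.deg (L.hi g) ∧ n = 20 * Nat.clog 2 (b - a)) h.bdd
    ⟨_, _, hlow, hhigh, le_rfl, hout.1, hout.2, le_rfl, by rw [Nat.add_sub_cancel_left]⟩ ?_).mono ?_
  · rintro n s' hs' hf ⟨a, b, ha, hb, hfirst, hag, hgb, hdeg, rfl⟩ hholds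
    have hready := h.frame hs' hf (by decide)
    have hloop : s'.reg Reg.loop = e := (hf.reg _ (by decide)).trans he
    have hM := hb.symm.trans_le (hs'.1 Reg.high)
    simp only [Test.Holds, Expr.val, ha, hb] at hholds
    obtain ⟨q, hq⟩ : ∃ q : Fin L.edges, (a + b) / 2 = q := ⟨⟨(a + b) / 2, by omega⟩, rfl⟩
    have hqg : L.hi q = L.hi g := (L.out_spec _ _).2 (by omega)
    have hcmp : (∃ x y, some (L.chr g) = some x ∧ some (L.chr q) = some y ∧ x < y) ↔
        (g : ℕ) < q := by
      simp [chr_lt_chr_iff hqg.symm]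
    refine hready.run_of_wp (τ := 15) ?_
    simp only [Prog.wp, Expr.val, Test.Holds, ha, hb, hq]
    simp only [State.reg_setReg, State.chr_setReg, Reg.mid, Reg.loop, Reg.low, Reg.high,
      Nat.reduceEqDiff, if_true, if_false, hloop, ha, hb, hready.inp.chr, ← hg, hcmp, Test.cost,
      Expr.cost]
    refine ⟨by omega, fun hlt => ⟨by omega, fun t ht => ⟨_, ?_, a, q, rfl, rfl, hfirst, hag, hlt,
        by omega, rfl⟩⟩, fun hle => ⟨by omega, fun t ht => ⟨_, ?_, q, b, rfl, rfl, by omega,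
        by omega, hgb, hdeg, rfl⟩⟩⟩
    · have := clog_two_add_one_le (a := b - a) (b := q - a) (by omega) (by omega)
      omega
    · have := clog_two_add_one_le (a := b - a) (b := b - q) (by omega) (by omega)
      omega
  · rintro t s' - - ⟨n, ht, ⟨a, b, ha, hb, -, hag, hgb, -, rfl⟩, hend⟩
    simp only [Test.Holds, Expr.val, ha, hb] at hend
    simp only [Test.cost, Expr.cost] at ht
    omega

theorem wp_headRule (h : L.Ready B M s) {e e₁ : Fin L.edges} (he : s.reg Reg.loop = e)
    (hlow : s.reg Reg.low = e₁) (hs : 2 ≤ L.slen e) (hhead : L.IsESufHead e e₁) :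
    headRule.wp M s fun s' => L.StoresHead s' e ∧
      ∀ i ≠ (e : ℕ), SameEntry s s' i := by
  have hM := h.big.edges
  have := e.2
  have := e₁.2
  have hready : L.Ready B M (s.setMem Arr.head e e₁) := h.setMem (by omega)
  simp only [headRule, Prog.wp, Expr.val, Test.Holds, State.reg_setMem, he, hlow, hready.inp.slen]
  refine ⟨by omega, fun heq => ⟨by omega, ?_, fun i hi => ?_⟩, fun hne => ⟨Nat.zero_le _, ?_⟩⟩
  · exact .inr ⟨e₁, by simp [Deferred, hs, hhead, heq]⟩
  · simp [SameEntry, SameRule, hi]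
  · have hjump := hhead.isJumpHead hs hne
    refine wp_storeRule (hready.setMem (Nat.zero_le _)) hlow hjump.type2_lo (by decide)
      fun s' hrule hupd => ⟨.inl ⟨?_, .inr ⟨hs, e₁, hjump, he ▸ hrule⟩⟩, fun i hi => ⟨?_, ?_, ?_⟩⟩
    · simp [hupd.mem Arr.mark _ (.inl (by decide))]
    · obtain ⟨hkind, hleft, hright⟩ := hupd.sameRule (j := i) (by simpa [he] using hi)
      exact ⟨by simpa using hkind, by simpa using hleft, by simpa using hright⟩
    · simp [hupd.mem Arr.mark _ (.inl (by decide)), hi]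
    · simp [hupd.mem Arr.head _ (.inl (by decide)), hi]

theorem run_headInit (h : L.Ready B M s) {e e₁ : Fin L.edges} (he : s.reg Reg.loop = e)
    (hhead : L.IsESufHead e e₁) :
    Run B M headInit s fun t s' => t ≤ 15 ∧ s'.reg Reg.low = L.first (L.hi e₁) ∧
      s'.reg Reg.high = L.first (L.hi e₁) + L.deg (L.hi e₁) := by
  have hM := h.big.edges
  have := L.out_le (L.hi e₁)
  refine h.run_of_wp (τ := 15) ?_
  simp only [headInit, Prog.wp, Expr.val, he, h.inp.hi, h.inp.slink, ← hhead.1, h.inp.first,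
    h.inp.deg, State.reg_setReg, State.mem_setReg, Reg.low, Reg.high, Reg.loop, Nat.reduceEqDiff,
    if_true, if_false]
  exact ⟨by omega, by omega, fun t ht => ⟨ht, trivial, trivial⟩⟩

theorem run_headBody (h : L.Ready B M s) {D : ℕ} (hD : ∀ i, L.deg i ≤ D) {e : Fin L.edges}
    (he : s.reg Reg.loop = e) :
    Run B M headBody s fun t s' => t ≤ 20 * Nat.clog 2 D + 100 ∧ L.StoresHead s' e ∧
      ∀ i ≠ (e : ℕ), SameEntry s s' i := by
  refine Run.ite h.big.word (by decide) h.bdd (fun hlong => ?_) fun hshort => ?_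
  · simp only [Test.Holds, Expr.val, he, h.inp.slen] at hlong
    obtain ⟨e₁, hhead⟩ := L.exists_isESufHead hlong
    refine Run.seq ((run_headInit h he hhead).mono ?_)
    rintro t₁ s₁ hs₁ hf₁ ⟨ht₁, hlow, hhigh⟩
    have hready₁ := h.frame hs₁ hf₁ (by decide)
    have he₁ : s₁.reg Reg.loop = e := (hf₁.reg _ (by decide)).trans he
    refine Run.seq ((run_searchProg hready₁ he₁ hhead.2 hlow hhigh).mono ?_)
    rintro t₂ s₂ hs₂ hf₂ ⟨ht₂, hlow⟩
    have hready₂ := hready₁.frame hs₂ hf₂ (by decide)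
    have he₂ : s₂.reg Reg.loop = e := (hf₂.reg _ (by decide)).trans he₁
    have hmem : s₂.mem = s.mem := funext fun a =>
      (hf₂.mem a List.not_mem_nil).trans (hf₁.mem a List.not_mem_nil)
    refine hready₂.run_of_wp (τ := 70) (Prog.wp_mono (wp_headRule hready₂ he₂ hlow hlong hhead) ?_)
    rintro s' hs' t ht
    have := Nat.clog_mono_right 2 (hD (L.hi e₁))
    refine ⟨?_, hs'.1, by simpa only [SameEntry, SameRule, hmem] using hs'.2⟩
    simp only [Test.cost, Expr.cost]
    omega
  · simp only [Test.Holds, Expr.val, he, h.inp.slen] at hshort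
    have hslen := L.slen_pos e
    refine h.run_of_wp (τ := 6) ?_
    simp only [Prog.wp, Expr.val, State.reg_setMem, he]
    refine ⟨Nat.zero_le _, Nat.zero_le _, fun t ht => ⟨?_, .inl ?_, fun i hi => ?_⟩⟩
    · simp only [Test.cost, Expr.cost]
      omega
    · exact ⟨by simp, .inl ⟨by omega, by simp⟩⟩
    · simp [SameEntry, SameRule, hi]

theorem run_headProg (h : L.Ready B M s) {D : ℕ} (hD : ∀ i, L.deg i ≤ D) :
    Run B M headProg s fun t s' => t ≤ (20 * Nat.clog 2 D + 107) * L.edges + 5 ∧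
      (∀ e, L.StoresHead s' e) ∧ ∀ i ≥ L.edges, SameRule s s' i := by
  refine (run_forEdges h (by decide) (by decide) (fun k s' =>
    (∀ e : Fin L.edges, e < k → L.StoresHead s' e) ∧ ∀ i ≥ L.edges, SameRule s s' i)
    (fun _ => 0) (20 * Nat.clog 2 D + 100)
    ⟨fun _ he => absurd he (Nat.not_lt_zero _), fun _ _ => ⟨rfl, rfl, rfl⟩⟩ ?_).mono ?_
  · rintro e s' hs' - he ⟨hinv, hsame⟩
    refine (run_headBody hs' hD he).mono ?_
    rintro t s'' - - ⟨ht, hhead, hother⟩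
    refine ⟨ht, fun e' he' => ?_, fun i hi => (hsame i hi).trans (hother i (by omega)).1⟩
    obtain rfl | hne := eq_or_ne e' e
    · exact hhead
    · have hne := Fin.val_ne_of_ne hne
      exact (hinv e' (by omega)).congr (hother e' hne)
  · rintro t s' - - ⟨ht, hinv⟩
    exact ⟨by omega, fun e => hinv.1 e e.2, hinv.2⟩

/-- The walk of `m` steps from `e` to `c` along the first edges of edge suffix links. -/
inductive Walk (L : LCDAWG T) (s : State α) : ℕ → Fin L.edges → Fin L.edges → Prop
  | nil {c : Fin L.edges} : s.mem Arr.mark c ≠ 1 → L.Walk s 0 c c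
  | cons {m e e₁ c} : L.Deferred s e e₁ → L.Walk s m e₁ c → L.Walk s (m + 1) e c

theorem Deferred.length_lt {e e₁ : Fin L.edges} (h : L.Deferred s e e₁) :
    (L.str (L.hi e₁)).length < (L.str (L.hi e)).length :=
  h.2.2.2.1.length_lt h.2.2.1

theorem Walk.congr {m : ℕ} {e c : Fin L.edges} (h : L.Walk s m e c)
    (hs : ∀ e' : Fin L.edges, (L.str (L.hi e')).length ≤ (L.str (L.hi e)).length →
      SameEntry s s' e') : L.Walk s' m e c := by
  induction h with
  | nil hc => exact .nil (by rwa [(hs _ le_rfl).2.1])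
  | cons hd _ ih =>
    exact .cons (hd.congr (hs _ le_rfl)) (ih fun e' he' => hs e' (he'.trans hd.length_lt.le))

theorem exists_walk (hs : ∀ e, L.StoresHead s e) (e : Fin L.edges) : ∃ m c, L.Walk s m e c := by
  induction hn : (L.str (L.hi e)).length using Nat.strong_induction_on generalizing e with
  | _ n ih =>
    by_cases hm : s.mem Arr.mark e = 1
    · obtain ⟨e₁, hd⟩ := (hs e).exists_deferred hm
      obtain ⟨m, c, hw⟩ := ih _ (hn ▸ hd.length_lt) e₁ rfl
      exact ⟨_, _, hw.cons hd⟩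
    · exact ⟨_, _, .nil hm⟩

theorem Walk.mark_ne_one {m : ℕ} {e c : Fin L.edges} (h : L.Walk s m e c) :
    s.mem Arr.mark c ≠ 1 := by
  induction h with
  | nil hc => exact hc
  | cons _ _ ih => exact ih

theorem Walk.slen_eq {m : ℕ} {e c : Fin L.edges} (h : L.Walk s m e c) :
    L.slen c = L.slen e := by
  induction h with
  | nil => rfl
  | cons hd _ ih => exact ih.trans hd.2.2.2.2

theorem Walk.isJumpHead {m : ℕ} {e c g : Fin L.edges} (h : L.Walk s m e c)
    (hg : L.IsJumpHead c g) : L.IsJumpHead e g := by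
  induction h with
  | nil => exact hg
  | cons hd _ ih => exact hd.2.2.2.1.isJumpHead_of_slen_eq hd.2.2.1 hd.2.2.2.2 (ih hg)

theorem run_walkProg (h : L.Ready B M s) {m : ℕ} {e c : Fin L.edges} (he : s.reg Reg.edge = e)
    (hw : L.Walk s m e c) :
    Run B M walkProg s fun t s' => t ≤ 8 * m + 4 ∧ s'.reg Reg.edge = c := by
  refine (Run.loop (n := 8 * m) h.big.word (by decide)
    (fun n s' => ∃ m x, L.Walk s m x c ∧ s'.reg Reg.edge = x ∧ n = 8 * m) h.bdd
    ⟨m, e, hw, he, rfl⟩ ?_).mono ?_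
  · rintro n s' hs' hf ⟨m, x, hw, hx, rfl⟩ hholds
    have hmem : s'.mem = s.mem := funext fun a => hf.mem a List.not_mem_nil
    simp only [Test.Holds, Expr.val, hx, hmem] at hholds
    cases hw with
    | nil hc => exact absurd hholds hc
    | @cons m _ e₁ _ hd hw =>
      have hM := h.big.edges
      refine (h.frame hs' hf (by decide)).run_of_wp (τ := 3) ?_
      simp only [Prog.wp, Expr.val, hx, hmem, hd.2.1]
      refine ⟨by omega, fun t ht => ⟨8 * m, ?_, m, e₁, hw, by simp, rfl⟩⟩
      simp only [Test.cost, Expr.cost]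
      omega
  · rintro t s' - hf ⟨n, ht, ⟨m, x, hw, hx, rfl⟩, hend⟩
    have hmem : s'.mem = s.mem := funext fun a => hf.mem a List.not_mem_nil
    simp only [Test.Holds, Expr.val, hx, hmem] at hend
    simp only [Test.cost, Expr.cost] at ht
    cases hw with
    | nil hc => exact ⟨by omega, hx⟩
    | cons hd => exact absurd hd.1 hend

/-- The edges whose productions are postponed. -/
def marked (L : LCDAWG T) (s : State α) : Finset (Fin L.edges) :=
  Finset.univ.filter fun e => s.mem Arr.mark e = 1

theorem card_marked_add_one {e : Fin L.edges} (he : s.mem Arr.mark e = 1)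
    (he' : s'.mem Arr.mark e = 0)
    (h : ∀ e' : Fin L.edges, e' ≠ e → s'.mem Arr.mark e' = s.mem Arr.mark e') :
    (L.marked s').card + 1 = (L.marked s).card := by
  have herase : L.marked s' = (L.marked s).erase e := by
    ext e'
    obtain rfl | hne := eq_or_ne e' e
    · simp [marked, he']
    · simp [marked, h e' hne, hne]
  rw [herase, Finset.card_erase_add_one (by simpa [marked] using he)]

/-- In `s'` some of the productions that are postponed in `s` are stored. -/
structure Resolves (L : LCDAWG T) (s s' : State α) : Prop where
  head : ∀ e, L.StoresHead s' e
  mark : ∀ e : Fin L.edges, s.mem Arr.mark e ≠ 1 → s'.mem Arr.mark e ≠ 1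
  rule : ∀ i ≥ L.edges, SameRule s s' i

theorem Resolves.trans {s'' : State α} (h : L.Resolves s s') (h' : L.Resolves s' s'') :
    L.Resolves s s'' :=
  ⟨h'.head, fun e he => h'.mark e (h.mark e he), fun i hi => (h.rule i hi).trans (h'.rule i hi)⟩

theorem wp_fillBody (h : L.Ready B M s) (hs : ∀ e, L.StoresHead s e) {e e₁ g f : Fin L.edges}
    (he : s.reg Reg.edge = e) (hd : L.Deferred s e e₁) (hg : L.IsJumpHead e g)
    (hleft : s.reg Reg.left = g) (hf : L.hi f = L.lo g) (hright : s.reg Reg.right = L.restVar f) :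
    fillBody.wp M s fun s' => s'.reg Reg.edge = e₁ ∧ s'.mem Arr.mark e = 0 ∧
      (∀ i ≠ (e : ℕ), SameEntry s s' i) ∧ L.Resolves s s' := by
  have hM := h.big.edges
  have hx := h.bdd.1 Reg.left
  have hy := h.bdd.1 Reg.right
  rw [hleft] at hx
  rw [hright] at hy
  simp only [fillBody, writeRule, Prog.wp, Expr.val, he, hd.2.1, hleft, hright, State.reg_setReg,
    State.reg_setMem, Reg.edge, Reg.next, Reg.left, Reg.right, Nat.reduceEqDiff, if_true, if_false]
  set s' := (((((s.setReg Reg.next e₁).setMem Arr.mark e 0).setMem Arr.kind e 1).setMem Arr.left e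
    g).setMem Arr.right e (L.restVar f)).setReg Reg.edge e₁ with hs'
  have hmark : s'.mem Arr.mark e = 0 := by simp [hs']
  have hsame : ∀ i ≠ (e : ℕ), SameEntry s s' i := fun i hi => by
    simp [SameEntry, SameRule, hs', hi]
  have hrule : L.HasRule s' e g := ⟨by simp [hs'], by simp [hs'], f, hf, by simp [hs']⟩
  refine ⟨by omega, Nat.zero_le _, by omega, hx, hy, by omega, trivial, hmark, hsame, fun e' => ?_,
    fun e' he' => ?_, fun i hi => (hsame i (by omega)).1⟩
  · obtain rfl | hne := eq_or_ne e' e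
    · exact .inl ⟨hmark, .inr ⟨hd.2.2.1, g, hg, hrule⟩⟩
    · exact (hs e').congr (hsame _ (Fin.val_ne_of_ne hne))
  · obtain rfl | hne := eq_or_ne e' e
    · simp [hmark]
    · rwa [(hsame _ (Fin.val_ne_of_ne hne)).2.1]

theorem run_fillProg (h : L.Ready B M s) (hs : ∀ e, L.StoresHead s e) {m : ℕ} {e c : Fin L.edges}
    (he : s.reg Reg.edge = e) (hw : L.Walk s m e c)
    (hleft : s.reg Reg.left = s.mem Arr.left c) (hright : s.reg Reg.right = s.mem Arr.right c) :
    Run B M fillProg s fun t s' => t ≤ 25 * m + 4 ∧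
      (L.marked s').card + m = (L.marked s).card ∧ s'.mem Arr.mark e ≠ 1 ∧ L.Resolves s s' := by
  refine (Run.loop (n := 25 * m) h.big.word (by decide)
    (fun n s' => ∃ k x, L.Walk s' k x c ∧ s'.reg Reg.edge = x ∧ n = 25 * k ∧
      (L.marked s').card + m = (L.marked s).card + k ∧ (x = e ∨ s'.mem Arr.mark e ≠ 1) ∧
      L.Resolves s s') h.bdd
    ⟨m, e, hw, he, rfl, rfl, .inl rfl, hs, fun _ => id, fun _ _ => ⟨rfl, rfl, rfl⟩⟩ ?_).mono ?_
  · rintro n s' hs' hf ⟨k, x, hw', hx, rfl, hcard, hmark, hres⟩ hholds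
    have hready := h.frame hs' hf (by decide)
    simp only [Test.Holds, Expr.val, hx] at hholds
    cases hw' with
    | nil hc => exact absurd hholds hc
    | @cons k _ e₁ _ hd hw₁ =>
      have hslen : 2 ≤ L.slen c := (hw₁.cons hd).slen_eq ▸ hd.2.2.1
      obtain hshort | ⟨-, g, hg, -, hg', f, hf', hrest⟩ := (hs c).storesEdge hw.mark_ne_one
      · omega
      refine hready.run_of_wp (τ := 20) (Prog.wp_mono (wp_fillBody hready hres.head hx hd
        ((hw₁.cons hd).isJumpHead hg) ((hf.reg _ (by decide)).trans (hleft.trans hg')) hf'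
        ((hf.reg _ (by decide)).trans (hright.trans hrest))) ?_)
      rintro s'' ⟨hx', hmark', hsame, hres'⟩ t ht
      have hcard' := card_marked_add_one hd.1 hmark' fun e' he' =>
        (hsame e' (Fin.val_ne_of_ne he')).2.1
      refine ⟨25 * k, ?_, k, e₁, hw₁.congr fun e' he' => hsame e' fun heq => ?_, hx', rfl,
        by omega, .inr ?_, hres.trans hres'⟩
      · simp only [Test.cost, Expr.cost]
        omega
      · exact absurd hd.length_lt (by rw [← Fin.ext heq]; omega)
      · obtain rfl | hmark := hmark
        · simp [hmark']
        · exact hres'.mark e hmark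
  · rintro t s' - - ⟨n, ht, ⟨k, x, hw', hx, rfl, hcard, hmark, hres⟩, hend⟩
    simp only [Test.Holds, Expr.val, hx] at hend
    simp only [Test.cost, Expr.cost] at ht
    cases hw' with
    | nil hc => exact ⟨by omega, by omega, hmark.elim (fun h => h ▸ hc) id, hres⟩
    | cons hd => exact absurd hd.1 hend

theorem run_jumpBody (h : L.Ready B M s) (hs : ∀ e, L.StoresHead s e) {e : Fin L.edges}
    (he : s.reg Reg.loop = e) :
    Run B M jumpBody s fun t s' => t + 33 * (L.marked s').card ≤ 36 + 33 * (L.marked s).card ∧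
      s'.mem Arr.mark e ≠ 1 ∧ L.Resolves s s' := by
  have hM := h.big.edges
  obtain ⟨m, c, hw⟩ := exists_walk hs e
  refine Run.seq (h.run_of_wp (τ := 2) ⟨?_, fun t₁ ht₁ => ?_⟩)
  · rw [Expr.val, he]
    omega
  simp only [Expr.val, he]
  have hready₁ : L.Ready B M (s.setReg Reg.edge e) := h.setReg (by omega)
  refine Run.seq ((run_walkProg (c := c) hready₁ (by simp)
    (hw.congr fun _ _ => ⟨⟨rfl, rfl, rfl⟩, rfl, rfl⟩)).mono ?_)
  rintro t₂ s₂ hs₂ hf₂ ⟨ht₂, hc⟩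
  have hready₂ := hready₁.frame hs₂ hf₂ (by decide)
  have hloop : s₂.reg Reg.loop = e := (hf₂.reg _ (by decide)).trans (by simpa using he)
  have hmem : s₂.mem = s.mem := funext fun a => hf₂.mem a List.not_mem_nil
  refine Run.seq (hready₂.run_of_wp (τ := 12) ?_)
  simp only [jumpInit, Prog.wp, Expr.val, State.reg_setReg, State.mem_setReg, Reg.left, Reg.right,
    Reg.edge, Reg.loop, Nat.reduceEqDiff, if_false, hc, hloop]
  refine ⟨hready₂.bdd.2 _ _, hready₂.bdd.2 _ _, by omega, fun t₃ ht₃ => ?_⟩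
  set s₃ := ((s₂.setReg Reg.left (s₂.mem Arr.left c)).setReg Reg.right
    (s₂.mem Arr.right c)).setReg Reg.edge e with hs₃
  have hready₃ : L.Ready B M s₃ :=
    ((hready₂.setReg (hs₂.2 _ _)).setReg (hs₂.2 _ _)).setReg (by omega)
  have hmem₃ : s₃.mem = s.mem := hmem
  have hsame : ∀ i, SameEntry s s₃ i := fun i => by simp only [SameEntry, SameRule, hmem₃, and_self]
  refine (run_fillProg hready₃ (fun e => (hs e).congr (hsame e)) (by simp [hs₃])
    (hw.congr fun e' _ => hsame e') (by simp [hs₃]) (by simp [hs₃])).mono ?_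
  rintro t₄ s₄ - - ⟨ht₄, hcard, hmark, hres⟩
  have hmarked : L.marked s₃ = L.marked s := by simp only [marked, hmem₃]
  rw [hmarked] at hcard
  refine ⟨by omega, hmark, hres.head, fun e' he' => hres.mark e' (by rwa [hmem₃]), fun i hi => ?_⟩
  exact (hsame i).1.trans (hres.rule i hi)

theorem run_jumpProg (h : L.Ready B M s) (hs : ∀ e, L.StoresHead s e) :
    Run B M jumpProg s fun t s' => t ≤ 76 * L.edges + 5 ∧ (∀ e, L.StoresEdge s' e) ∧
      ∀ i ≥ L.edges, SameRule s s' i := by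
  refine (run_forEdges h (by decide) (by decide)
    (fun k s' => (∀ e : Fin L.edges, e < k → s'.mem Arr.mark e ≠ 1) ∧ L.Resolves s s')
    (fun s => 33 * (L.marked s).card) 36
    ⟨fun _ he => absurd he (Nat.not_lt_zero _), hs, fun _ => id, fun _ _ => ⟨rfl, rfl, rfl⟩⟩
    ?_).mono ?_
  · rintro e s' hs' - he ⟨hmark, hres⟩
    refine (run_jumpBody hs' hres.head he).mono ?_
    rintro t s'' - - ⟨ht, hmark', hres'⟩
    have htrans := hres.trans hres'
    refine ⟨ht, fun e' he' => ?_, htrans.head, htrans.mark, htrans.rule⟩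
    obtain rfl | hne := eq_or_ne e' e
    · exact hmark'
    · have := Fin.val_ne_of_ne hne
      exact hres'.mark e' (hmark e' (by omega))
  · rintro t s' - - ⟨ht, hmark, hres⟩
    have hcard : (L.marked (s.setReg Reg.loop 0)).card ≤ L.edges :=
      (Finset.card_filter_le _ _).trans (by simp)
    exact ⟨by omega, fun e => (hres.head e).storesEdge (hmark e e.2), hres.rule⟩

end LCDAWG

end Jumps

/-! ### Topological order and longest paths -/

section Distances

def degBody : Prog :=
  .write Arr.indeg (.read Arr.lo (.reg Reg.loop))
    (.plus (.read Arr.indeg (.read Arr.lo (.reg Reg.loop))) (.const 1))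

def degProg : Prog := forEdges degBody

/- `x + (y - x)` is the maximum of `x` and `y`.  The target is appended to the queue in any case,
but the end of the queue moves only if no in-coming edge of the target remains. -/
def visitBody : Prog :=
  .set Reg.target (.read Arr.lo (.reg Reg.out)) ;;
  .write Arr.dist (.reg Reg.target) (.plus (.read Arr.dist (.reg Reg.target))
    (.minus (.plus (.read Arr.dist (.reg Reg.node)) (.read Arr.slen (.reg Reg.out)))
      (.read Arr.dist (.reg Reg.target)))) ;;
  .write Arr.indeg (.reg Reg.target)
    (.minus (.read Arr.indeg (.reg Reg.target)) (.const 1)) ;;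
  .write Arr.queue (.reg Reg.back) (.reg Reg.target) ;;
  .set Reg.back (.plus (.reg Reg.back)
    (.minus (.const 1) (.read Arr.indeg (.reg Reg.target)))) ;;
  .set Reg.out (.plus (.reg Reg.out) (.const 1))

def visitProg : Prog := .loop (.lt (.reg Reg.out) (.reg Reg.outEnd)) visitBody

def nodeInit : Prog :=
  .set Reg.node (.read Arr.queue (.reg Reg.front)) ;;
  .set Reg.front (.plus (.reg Reg.front) (.const 1)) ;;
  .set Reg.out (.read Arr.first (.reg Reg.node)) ;;
  .set Reg.outEnd (.plus (.reg Reg.out) (.read Arr.deg (.reg Reg.node)))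

def orderBody : Prog := nodeInit ;; visitProg

def orderInit : Prog :=
  .write Arr.queue (.const 0) (.reg Reg.root) ;; .set Reg.front (.const 0) ;;
  .set Reg.back (.const 1)

/-- Computes the lengths of the longest paths to the nodes, in a topological order. -/
def orderProg : Prog := orderInit ;; .loop (.lt (.reg Reg.front) (.reg Reg.back)) orderBody

variable {α : Type*} [LinearOrder α] {T : List α}

namespace LCDAWG

variable {L : LCDAWG T} {s s' : State α} {B M : ℕ} {D : Finset (Fin L.edges)}
  {Q : List (Fin L.nodes)}

/-- The in-coming edges of `v` outside of the set `D` of visited edges. -/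
def pending (L : LCDAWG T) (D : Finset (Fin L.edges)) (v : Fin L.nodes) : Finset (Fin L.edges) :=
  {e | L.lo e = v ∧ e ∉ D}

/-- The greatest length of a path from the root to `v` with last edge in `D`. -/
def dist (L : LCDAWG T) (D : Finset (Fin L.edges)) (v : Fin L.nodes) : ℕ :=
  {e ∈ D | L.lo e = v}.sup fun e => (L.str (L.hi e)).length + L.slen e

theorem lo_ne_root (e : Fin L.edges) : L.lo e ≠ L.root := by
  intro h
  have hlt := L.length_str_hi_lt e
  rw [h, str_root] at hlt
  exact Nat.not_lt_zero _ hlt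

theorem pending_eq_empty {v : Fin L.nodes} : L.pending D v = ∅ ↔ ∀ e, L.lo e = v → e ∈ D := by
  simp [pending, Finset.filter_eq_empty_iff]

theorem card_pending {e : Fin L.edges} (he : e ∉ D) (v : Fin L.nodes) :
    (L.pending D v).card = (L.pending (insert e D) v).card + if v = L.lo e then 1 else 0 := by
  split
  · next hv =>
    rw [← Finset.card_insert_of_notMem (a := e) (by simp [pending])]
    congr 1
    ext e'
    simp only [pending, Finset.mem_filter_univ, Finset.mem_insert]
    grind
  · next hv =>
    rw [add_zero]
    congr 1
    ext e'
    simp only [pending, Finset.mem_filter_univ, Finset.mem_insert]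
    grind

theorem card_pending_le (v : Fin L.nodes) : (L.pending D v).card ≤ L.edges := by
  simpa using Finset.card_le_univ (L.pending D v)

theorem dist_insert (e : Fin L.edges) (v : Fin L.nodes) : L.dist (insert e D) v =
    if v = L.lo e then max ((L.str (L.hi e)).length + L.slen e) (L.dist D v) else L.dist D v := by
  unfold dist
  rw [Finset.filter_insert]
  obtain rfl | hv := eq_or_ne v (L.lo e)
  · rw [if_pos rfl, if_pos rfl, Finset.sup_insert]
  · rw [if_neg hv, if_neg hv.symm]

theorem dist_le (D : Finset (Fin L.edges)) (v : Fin L.nodes) : L.dist D v ≤ (L.str v).length := by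
  refine Finset.sup_le fun e he => ?_
  rw [← (Finset.mem_filter.1 he).2]
  exact L.slen_add_le e

theorem dist_eq_length {v : Fin L.nodes} (hv : L.pending D v = ∅) :
    L.dist D v = (L.str v).length := by
  refine le_antisymm (dist_le D v) ?_
  obtain rfl | hr := eq_or_ne v L.root
  · rw [str_root]
    exact Nat.zero_le _
  · obtain ⟨e, rfl, hlen⟩ := L.exists_primary_edge hr
    rw [← hlen]
    exact Finset.le_sup (f := fun e => (L.str (L.hi e)).length + L.slen e)
      (Finset.mem_filter.2 ⟨pending_eq_empty.1 hv e rfl, rfl⟩)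

/-- The edges from number `k` on, which remain to be counted by `degProg`. -/
def edgesFrom (L : LCDAWG T) (k : ℕ) : Finset (Fin L.edges) := {e | k ≤ (e : ℕ)}

theorem edgesFrom_eq_insert (e : Fin L.edges) :
    L.edgesFrom e = insert e (L.edgesFrom (e + 1)) := by
  ext e'
  simp only [edgesFrom, Finset.mem_filter_univ, Finset.mem_insert, Fin.ext_iff]
  omega

theorem run_degProg (h : L.Ready B M s) (hindeg : ∀ i, s.mem Arr.indeg i = 0) :
    Run B M degProg s fun t s' => t ≤ 20 * L.edges + 5 ∧
      ∀ v : Fin L.nodes, s'.mem Arr.indeg v = (L.pending ∅ v).card := by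
  have hM := h.big.edges
  refine (run_forEdges h (by decide) (by decide) (fun k s => ∀ v : Fin L.nodes,
    s.mem Arr.indeg v = (L.pending (L.edgesFrom k) v).card) (fun _ => 0) 13 ?_ ?_).mono ?_
  · intro v
    simp [pending, edgesFrom, hindeg]
  · intro e s' hs' _ he hinv
    have hcard := card_pending (L := L) (D := L.edgesFrom (e + 1)) (e := e) (by simp [edgesFrom])
    rw [← edgesFrom_eq_insert] at hcard
    have hle := card_pending_le (D := L.edgesFrom e) (L.lo e)
    refine hs'.run_of_wp (τ := 13) ?_
    simp only [degBody, Prog.wp, Expr.val, he, hs'.inp.lo, hinv]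
    refine ⟨by omega, fun t ht => ⟨ht, fun v => ?_⟩⟩
    rw [hcard v]
    simp only [State.mem_setReg, State.mem_setMem, if_true, Fin.val_inj]
    split
    · next hv => rw [hv]
    · exact hinv v
  · rintro t s' - - ⟨ht, hinv⟩
    refine ⟨ht, fun v => (hinv v).trans ?_⟩
    congr 2
    ext e
    simp [edgesFrom]

/-- The state of the traversal: `Q` is the queue of all nodes without in-coming edges outside of the
set `D` of edges that have been visited. -/
structure OrderSpec (L : LCDAWG T) (s : State α) (Q : List (Fin L.nodes))
    (D : Finset (Fin L.edges)) : Prop where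
  nodup : Q.Nodup
  back : s.reg Reg.back = Q.length
  queue : ∀ k (h : k < Q.length), s.mem Arr.queue k = Q[k]
  indeg : ∀ v : Fin L.nodes, s.mem Arr.indeg v = (L.pending D v).card
  dist : ∀ v : Fin L.nodes, s.mem Arr.dist v = L.dist D v
  mem : ∀ v, v ∈ Q ↔ L.pending D v = ∅

theorem orderSpec_root (hback : s.reg Reg.back = 1) (hqueue : s.mem Arr.queue 0 = L.root)
    (hindeg : ∀ v : Fin L.nodes, s.mem Arr.indeg v = (L.pending ∅ v).card)
    (hdist : ∀ v : Fin L.nodes, s.mem Arr.dist v = 0) : L.OrderSpec s [L.root] ∅ := by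
  refine ⟨List.nodup_singleton _, hback, by simpa using hqueue, hindeg, by simp [hdist, dist],
    fun v => ?_⟩
  rw [List.mem_singleton, pending_eq_empty]
  refine ⟨fun hv e he => absurd (he.trans hv) (lo_ne_root e), fun hv => ?_⟩
  by_contra hne
  obtain ⟨e, he, -⟩ := L.exists_primary_edge hne
  exact Finset.notMem_empty _ (hv e he)

theorem OrderSpec.dist_eq (h : L.OrderSpec s Q D) {v : Fin L.nodes} (hv : v ∈ Q) :
    s.mem Arr.dist v = (L.str v).length :=
  (h.dist v).trans (dist_eq_length ((h.mem v).1 hv))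

theorem OrderSpec.length_le (h : L.OrderSpec s Q D) : Q.length ≤ L.nodes := by
  simpa using h.nodup.length_le_card

theorem OrderSpec.congr (h : L.OrderSpec s Q D) (hm : s'.mem = s.mem)
    (hr : s'.reg Reg.back = s.reg Reg.back) : L.OrderSpec s' Q D where
  nodup := h.nodup
  back := hr.trans h.back
  queue := hm ▸ h.queue
  indeg := hm ▸ h.indeg
  dist := hm ▸ h.dist
  mem := h.mem

theorem OrderSpec.length_lt (h : L.OrderSpec s Q D) {e : Fin L.edges} (he : e ∉ D) :
    Q.length < L.nodes := by
  have hlo : L.lo e ∉ Q := fun hmem => he (pending_eq_empty.1 ((h.mem _).1 hmem) e rfl)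
  simpa using (List.nodup_cons.2 ⟨hlo, h.nodup⟩).length_le_card

theorem wp_visitBody (h : L.Ready B M s) (hO : L.OrderSpec s Q D) {e : Fin L.edges} (he : e ∉ D)
    (hQ : L.hi e ∈ Q) (hnode : s.reg Reg.node = L.hi e) (hout : s.reg Reg.out = e) :
    visitBody.wp M s fun s' => s'.reg Reg.out = e + 1 ∧
      s'.reg Reg.back = Q.length + (1 - (L.pending (insert e D) (L.lo e)).card) ∧
      s'.mem Arr.queue = Function.update (s.mem Arr.queue) Q.length (L.lo e) ∧
      (∀ v : Fin L.nodes, s'.mem Arr.indeg v = (L.pending (insert e D) v).card) ∧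
      ∀ v : Fin L.nodes, s'.mem Arr.dist v = L.dist (insert e D) v := by
  have hM := h.big.edges
  have hMn := h.big.nodes
  have hlength := hO.length_lt he
  have hdist : L.dist D (L.lo e) + ((L.str (L.hi e)).length + L.slen e - L.dist D (L.lo e)) =
      L.dist (insert e D) (L.lo e) := by
    rw [dist_insert, if_pos rfl]
    omega
  have hindeg : (L.pending D (L.lo e)).card - 1 = (L.pending (insert e D) (L.lo e)).card := by
    rw [card_pending he, if_pos rfl, Nat.add_sub_cancel]
  have hdist_le := (dist_le (insert e D) (L.lo e)).trans (L.length_str_le _)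
  have hindeg_le := card_pending_le (D := insert e D) (L.lo e)
  have hMl := h.big.length
  have hlo := (L.lo e).2
  have hnode_dist := hO.dist_eq hQ
  have hdist_lo := hO.dist (L.lo e)
  simp only [visitBody, Prog.wp, Expr.val, hout, h.inp.lo, hnode, hdist_lo, hnode_dist, h.inp.slen,
    hO.indeg, hO.back, hdist, hindeg, State.reg_setReg, State.mem_setReg, State.reg_setMem,
    State.mem_setMem, if_true, if_false, Reg.target, Reg.out, Reg.node, Arr.dist, Arr.indeg,
    Arr.queue, Reg.back, Nat.reduceEqDiff, Arr.lo, Arr.slen]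
  refine ⟨by omega, by omega, by omega, by omega, by omega, by omega, trivial, trivial, ?_, ?_, ?_⟩
  · funext k
    simp [Function.update_apply]
  · intro v
    simp only [Fin.val_inj]
    split
    · next hv => rw [hv]
    · next hv => rw [card_pending he, if_neg hv, add_zero]
  · intro v
    simp only [Fin.val_inj]
    split
    · next hv => rw [hv]
    · next hv => rw [dist_insert, if_neg hv, hO.dist]

theorem run_visitBody (h : L.Ready B M s) (hO : L.OrderSpec s Q D) {e : Fin L.edges} (he : e ∉ D)
    (hQ : L.hi e ∈ Q) (hnode : s.reg Reg.node = L.hi e) (hout : s.reg Reg.out = e) :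
    Run B M visitBody s fun t s' => t ≤ 60 ∧ s'.reg Reg.out = e + 1 ∧
      ∃ Q', Q <+: Q' ∧ L.OrderSpec s' Q' (insert e D) := by
  refine h.run_of_wp (τ := 60) (Prog.wp_mono (wp_visitBody h hO he hQ hnode hout) ?_)
  rintro s' ⟨hout', hback, hqueue, hindeg, hdist⟩ t ht
  refine ⟨ht, hout', ?_⟩
  have hloQ : L.lo e ∉ Q := fun hmem => he (pending_eq_empty.1 ((hO.mem _).1 hmem) e rfl)
  have hmem : ∀ v ≠ L.lo e, v ∈ Q ↔ L.pending (insert e D) v = ∅ := fun v hv => by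
    rw [hO.mem, ← Finset.card_eq_zero, card_pending he, if_neg hv, add_zero, Finset.card_eq_zero]
  by_cases hlo : L.pending (insert e D) (L.lo e) = ∅
  · refine ⟨Q ++ [L.lo e], List.prefix_append _ _, ?_, ?_, fun k hk => ?_, hindeg, hdist,
      fun v => ?_⟩
    · rw [← List.concat_eq_append]
      exact hO.nodup.concat hloQ
    · rw [hback, hlo, Finset.card_empty, List.length_append, List.length_singleton]
    · rw [hqueue, Function.update_apply]
      split
      · next hk' => simp [hk']
      · next hk' =>
        rw [List.length_append, List.length_singleton] at hk
        rw [hO.queue k (by omega), List.getElem_append_left]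
    · rw [List.mem_append, List.mem_singleton]
      obtain rfl | hv := eq_or_ne v (L.lo e)
      · exact iff_of_true (.inr rfl) hlo
      · rw [or_iff_left hv, hmem v hv]
  · refine ⟨Q, List.prefix_rfl, hO.nodup, ?_, fun k hk => ?_, hindeg, hdist, fun v => ?_⟩
    · have := Finset.card_pos.2 (Finset.nonempty_iff_ne_empty.2 hlo)
      omega
    · rw [hqueue, Function.update_of_ne hk.ne, hO.queue]
    · obtain rfl | hv := eq_or_ne v (L.lo e)
      · exact iff_of_false hloQ hlo
      · exact hmem v hv

/-- The out-going edges of `u`. -/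
def outEdges (L : LCDAWG T) (u : Fin L.nodes) : Finset (Fin L.edges) := {e | L.hi e = u}

theorem run_visitProg (h : L.Ready B M s) (hO : L.OrderSpec s Q D) {u : Fin L.nodes} (hu : u ∈ Q)
    (hnode : s.reg Reg.node = u) (hout : s.reg Reg.out = L.first u)
    (hend : s.reg Reg.outEnd = L.first u + L.deg u) (hD : Disjoint D (L.outEdges u)) :
    Run B M visitProg s fun t s' => t + 64 * D.card ≤ 64 * (D ∪ L.outEdges u).card + 4 ∧
      ∃ Q', Q <+: Q' ∧ L.OrderSpec s' Q' (D ∪ L.outEdges u) := by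
  refine (Run.loop (n := 64 * (D ∪ L.outEdges u).card - 64 * D.card) h.big.word (by decide)
    (fun n s' => ∃ Q' D', Q <+: Q' ∧ L.OrderSpec s' Q' D' ∧
      (∀ e, e ∈ D' ↔ e ∈ D ∨ L.hi e = u ∧ e < s'.reg Reg.out) ∧
      L.first u ≤ s'.reg Reg.out ∧ n = 64 * (D ∪ L.outEdges u).card - 64 * D'.card) h.bdd
      ⟨Q, D, List.prefix_rfl, hO, ?_, hout.ge, rfl⟩ ?_).mono ?_
  · simp only [hout, L.out_spec]
    exact fun e => (or_iff_left (by omega)).symm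
  · rintro n s' hs' hf ⟨Q', D', hQ', hO', hD', hfirst, rfl⟩ hlt
    have hready : L.Ready B M s' := h.frame hs' hf (by decide)
    simp only [Test.Holds, Expr.val, hf.reg Reg.outEnd (by decide), hend] at hlt
    obtain ⟨e, he⟩ : ∃ e : Fin L.edges, s'.reg Reg.out = e :=
      ⟨⟨s'.reg Reg.out, hlt.trans_le (L.out_le u)⟩, rfl⟩
    obtain rfl : L.hi e = u := by rw [L.out_spec]; omega
    have heD : e ∉ D' := by
      rw [hD', not_or, he]
      exact ⟨fun heD => Finset.disjoint_left.1 hD heD (by simp [outEdges]), by simp⟩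
    have hsub : insert e D' ⊆ D ∪ L.outEdges (L.hi e) := by
      intro e'
      simp only [Finset.mem_insert, Finset.mem_union, outEdges, Finset.mem_filter_univ, hD']
      grind
    have hcard := Finset.card_le_card hsub
    rw [Finset.card_insert_of_notMem heD] at hcard
    refine (run_visitBody hready hO' heD (hQ'.subset hu)
      ((hf.reg _ (by decide)).trans hnode) he).mono ?_
    rintro t s'' - - ⟨ht, hout', Q'', hQ'', hO''⟩
    refine ⟨_, ?_, Q'', insert e D', hQ'.trans hQ'', hO'', fun e' => ?_, by omega, rfl⟩
    · rw [Finset.card_insert_of_notMem heD]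
      simp only [Test.cost, Expr.cost]
      omega
    · rw [Finset.mem_insert, hD', hout', he, Nat.lt_succ_iff_lt_or_eq, Fin.val_inj]
      grind
  · rintro t s' - hf ⟨n, ht, ⟨Q', D', hQ', hO', hD', -, rfl⟩, hge⟩
    simp only [Test.Holds, Expr.val, hf.reg Reg.outEnd (by decide), hend] at hge
    obtain rfl : D' = D ∪ L.outEdges u := by
      ext e
      simp only [hD', outEdges, Finset.mem_union, Finset.mem_filter_univ, L.out_spec]
      exact or_congr_right (by omega)
    have hcard := Finset.card_le_card (Finset.subset_union_left (s₁ := D) (s₂ := L.outEdges u))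
    simp only [Test.cost, Expr.cost] at ht
    exact ⟨by omega, Q', hQ', hO'⟩

theorem wp_nodeInit (h : L.Ready B M s) (hO : L.OrderSpec s Q D) {k : ℕ}
    (hfront : s.reg Reg.front = k) (hk : k < Q.length) :
    nodeInit.wp M s fun s' => s'.mem = s.mem ∧ s'.reg Reg.front = k + 1 ∧
      s'.reg Reg.back = s.reg Reg.back ∧ s'.reg Reg.node = Q[k] ∧
      s'.reg Reg.out = L.first Q[k] ∧ s'.reg Reg.outEnd = L.first Q[k] + L.deg Q[k] := by
  have hM := h.big.edges
  have hMn := h.big.nodes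
  have hlength := hO.length_le
  have hle := L.out_le Q[k]
  have hnode := Q[k].2
  simp only [nodeInit, Prog.wp, Expr.val, hfront, hO.queue k hk, State.reg_setReg,
    State.mem_setReg, if_true, if_false, Nat.reduceEqDiff, Reg.front, Reg.node, Reg.out,
    Reg.outEnd, Reg.back, h.inp.first, h.inp.deg]
  refine ⟨by omega, by omega, by omega, by omega, ?_⟩
  trivial

theorem run_orderBody (h : L.Ready B M s) (hO : L.OrderSpec s Q D) {k : ℕ}
    (hfront : s.reg Reg.front = k) (hk : k < Q.length)
    (hD : ∀ e, e ∈ D ↔ L.hi e ∈ Q.take k) :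
    Run B M orderBody s fun t s' => s'.reg Reg.front = k + 1 ∧
      ∃ Q' D', t + 64 * D.card ≤ 64 * D'.card + 34 ∧ L.OrderSpec s' Q' D' ∧
        ∀ e, e ∈ D' ↔ L.hi e ∈ Q'.take (k + 1) := by
  refine Run.seq ((h.run_of_wp (τ := 30) (Q := fun t s' => t ≤ 30 ∧ _) (Prog.wp_mono
    (wp_nodeInit h hO hfront hk) fun s' hs' t ht => ⟨ht, hs'⟩)).mono ?_)
  rintro t s' hs' hf ⟨ht, hmem, hfront', hback, hnode, hout, hend⟩
  have htake : Q.take (k + 1) = Q.take k ++ [Q[k]] := List.take_succ_eq_append_getElem hk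
  have hnotMem : Q[k] ∉ Q.take k := by
    have hnodup := hO.nodup.sublist (List.take_sublist (k + 1) Q)
    rw [htake] at hnodup
    exact fun hmem => List.disjoint_of_nodup_append hnodup hmem (List.mem_singleton_self _)
  have hdisjoint : Disjoint D (L.outEdges Q[k]) := by
    refine Finset.disjoint_left.2 fun e he he' => hnotMem ?_
    rw [← (Finset.mem_filter.1 he').2]
    exact (hD e).1 he
  refine (run_visitProg (h.frame hs' hf (by decide)) (hO.congr hmem hback) (List.getElem_mem hk)
    hnode hout hend hdisjoint).mono ?_
  rintro t' s'' - hf' ⟨ht', Q', hQ', hO'⟩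
  refine ⟨(hf'.reg _ (by decide)).trans hfront', Q', _, by omega, hO', fun e => ?_⟩
  obtain ⟨R, rfl⟩ := hQ'
  rw [List.take_append_of_le_length hk, htake, List.mem_append, List.mem_singleton,
    Finset.mem_union, hD, outEdges, Finset.mem_filter_univ]

theorem mem_of_forall_hi_mem {S : Set (Fin L.nodes)}
    (hS : ∀ v, (∀ e, L.lo e = v → L.hi e ∈ S) → v ∈ S) (v : Fin L.nodes) : v ∈ S := by
  induction hn : (L.str v).length using Nat.strong_induction_on generalizing v with
  | _ n ih =>
    refine hS v fun e he => ih _ ?_ _ rfl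
    rw [← hn, ← he]
    exact L.length_str_hi_lt e

theorem run_orderProg (h : L.Ready B M s)
    (hindeg : ∀ v : Fin L.nodes, s.mem Arr.indeg v = (L.pending ∅ v).card)
    (hdist : ∀ i, s.mem Arr.dist i = 0) :
    Run B M orderProg s fun t s' => t ≤ 64 * L.edges + 40 * L.nodes + 12 ∧
      ∀ v : Fin L.nodes, s'.mem Arr.dist v = (L.str v).length := by
  have hM := h.big.nodes
  have hroot := L.root.2
  set s₀ := ((s.setMem Arr.queue 0 L.root).setReg Reg.front 0).setReg Reg.back 1 with hs₀
  have hready : L.Ready B M s₀ := ((h.setMem (by omega)).setReg (by omega)).setReg (by omega)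
  have hO : L.OrderSpec s₀ [L.root] ∅ := orderSpec_root (by simp [hs₀]) (by simp [hs₀])
    (by simpa [hs₀] using hindeg) fun v => by simpa [hs₀] using hdist v
  refine Run.seq (h.run_of_wp (τ := 8) ?_)
  simp only [orderInit, Prog.wp, Expr.val, h.inp.root, ← hs₀]
  refine ⟨by omega, by omega, by omega, fun t ht => ?_⟩
  refine (Run.loop (n := 64 * L.edges + 40 * L.nodes) hready.big.word (by decide)
    (fun n s' => ∃ k Q D, s'.reg Reg.front = k ∧ L.OrderSpec s' Q D ∧
      (∀ e, e ∈ D ↔ L.hi e ∈ Q.take k) ∧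
      n = 64 * (L.edges - D.card) + 40 * (L.nodes - k)) hready.bdd
      ⟨0, _, _, by simp [hs₀], hO, by simp, rfl⟩ ?_).mono ?_
  · rintro n s' hs' hf ⟨k, Q, D, hfront, hO, hD, rfl⟩ hlt
    simp only [Test.Holds, Expr.val, hfront, hO.back] at hlt
    refine (run_orderBody (hready.frame hs' hf (by decide)) hO hfront hlt hD).mono ?_
    rintro t' s'' - - ⟨hfront', Q', D', ht', hO', hD'⟩
    refine ⟨_, ?_, k + 1, Q', D', hfront', hO', hD', rfl⟩
    have hcard := Finset.card_le_univ D
    have hcard' := Finset.card_le_univ D'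
    have hlength := hO.length_le
    rw [Fintype.card_fin] at hcard hcard'
    simp only [Test.cost, Expr.cost]
    omega
  · rintro t' s' - - ⟨n, ht', ⟨k, Q, D, hfront, hO, hD, rfl⟩, hge⟩
    simp only [Test.Holds, Expr.val, hfront, hO.back] at hge
    rw [List.take_of_length_le (not_lt.1 hge)] at hD
    simp only [Test.cost, Expr.cost] at ht'
    refine ⟨by omega, fun v => hO.dist_eq (mem_of_forall_hi_mem (S := {v | v ∈ Q}) ?_ v)⟩
    exact fun v hv => (hO.mem v).2 (pending_eq_empty.2 fun e he => (hD e).2 (hv e he))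

end LCDAWG

end Distances

/-! ### The path that spells out the text -/

section TextPath

def updateBest : Prog :=
  .ite (.lt (.read Arr.dist (.reg Reg.best)) (.read Arr.dist (.reg Reg.target)))
    (.set Reg.best (.reg Reg.target)) .skip

def primaryBody : Prog :=
  .set Reg.target (.read Arr.lo (.reg Reg.loop)) ;;
  .ite (.eq (.plus (.read Arr.dist (.read Arr.hi (.reg Reg.loop)))
      (.read Arr.slen (.reg Reg.loop))) (.read Arr.dist (.reg Reg.target)))
    (.write Arr.pred (.reg Reg.target) (.reg Reg.loop)) .skip ;;
  updateBest

/-- Finds for each node the last edge of its longest path, and the node of the text. -/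
def primaryProg : Prog := .set Reg.best (.reg Reg.root) ;; forEdges primaryBody

def traceInit : Prog :=
  .set Reg.edge (.read Arr.pred (.reg Reg.best)) ;;
  .set Reg.rest (.reg Reg.edge) ;;
  .set Reg.node (.read Arr.hi (.reg Reg.edge)) ;;
  .set Reg.var (.plus (.reg Reg.edges) (.reg Reg.edges))

def traceBody : Prog :=
  .set Reg.edge (.read Arr.pred (.reg Reg.node)) ;;
  writeRule Reg.var (.reg Reg.edge) (.reg Reg.rest) ;;
  .set Reg.rest (.reg Reg.var) ;;
  .set Reg.var (.plus (.reg Reg.var) (.const 1)) ;;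
  .set Reg.node (.read Arr.hi (.reg Reg.edge))

def traceLoop : Prog := .loop (.lt (.const 0) (.read Arr.dist (.reg Reg.node))) traceBody

/-- Follows the longest path to the node of the text backwards and stores the productions for the
text. -/
def traceProg : Prog :=
  traceInit ;; traceLoop ;;
  .set Reg.size (.reg Reg.var) ;;
  .set Reg.start (.reg Reg.rest)

variable {α : Type*} [LinearOrder α] {T : List α}

namespace LCDAWG

variable {L : LCDAWG T} {s s' : State α} {B M : ℕ}

/-- The edge `e` is the last one of a longest path. -/
def IsPrimary (L : LCDAWG T) (e : Fin L.edges) : Prop :=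
  (L.str (L.hi e)).length + L.slen e = (L.str (L.lo e)).length

/-- The results of `orderProg`. -/
def StoresDist (L : LCDAWG T) (s : State α) : Prop :=
  ∀ v : Fin L.nodes, s.mem Arr.dist v = (L.str v).length

/-- A primary edge to `v` is stored. -/
def StoresPred (L : LCDAWG T) (s : State α) (v : Fin L.nodes) : Prop :=
  ∃ e : Fin L.edges, s.mem Arr.pred v = e ∧ L.lo e = v ∧ L.IsPrimary e

theorem wp_primaryBody (h : L.Ready B M s) (hdist : L.StoresDist s) {e : Fin L.edges}
    (he : s.reg Reg.loop = e) {b : Fin L.nodes} (hb : s.reg Reg.best = b) :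
    primaryBody.wp M s fun s' =>
      (L.IsPrimary e → L.StoresPred s' (L.lo e)) ∧ (∀ v, L.StoresPred s v → L.StoresPred s' v) ∧
      ∃ b' : Fin L.nodes, s'.reg Reg.best = b' ∧
        (L.str b').length = max (L.str b).length (L.str (L.lo e)).length := by
  have hM := h.big.edges
  have hlo := (L.lo e).2.le.trans h.big.nodes
  set s₁ := s.setReg Reg.target (L.lo e) with hs₁
  have hupdate (s₂ : State α) (hreg : s₂.reg = s₁.reg) (hdist₂ : L.StoresDist s₂)
      (hprim : L.IsPrimary e → L.StoresPred s₂ (L.lo e))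
      (hpred : ∀ v, L.StoresPred s v → L.StoresPred s₂ v) :
      updateBest.wp M s₂ fun s' =>
        (L.IsPrimary e → L.StoresPred s' (L.lo e)) ∧
        (∀ v, L.StoresPred s v → L.StoresPred s' v) ∧
        ∃ b' : Fin L.nodes, s'.reg Reg.best = b' ∧
          (L.str b').length = max (L.str b).length (L.str (L.lo e)).length := by
    have htarget : s₂.reg Reg.target = L.lo e := by simp [hreg, hs₁]
    have hbest : s₂.reg Reg.best = b := by simpa [hreg, hs₁] using hb
    simp only [updateBest, Prog.wp, Test.Holds, Expr.val, htarget, hbest, hdist₂ _]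
    exact ⟨fun hlt => ⟨hlo, hprim, hpred, L.lo e, by simp, (max_eq_right hlt.le).symm⟩,
      fun hge => ⟨hprim, hpred, b, rfl, (max_eq_left (not_lt.1 hge)).symm⟩⟩
  simp only [primaryBody, Prog.wp, Test.Holds, Expr.val, he, h.inp.lo, ← hs₁]
  simp only [hs₁, State.reg_setReg, State.mem_setReg, Reg.loop, Reg.target, Nat.reduceEqDiff,
    if_true, if_false, he, h.inp.hi, h.inp.slen, hdist _]
  refine ⟨hlo, fun hprim => ⟨by omega, hupdate _ rfl (fun v => ?_) (fun _ => ?_) fun v hv => ?_⟩,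
    fun hprim => hupdate _ rfl hdist (fun h => absurd h hprim) fun _ h => h⟩
  · simpa using hdist v
  · exact ⟨e, by simp, rfl, hprim⟩
  · obtain rfl | hne := eq_or_ne v (L.lo e)
    · exact ⟨e, by simp, rfl, hprim⟩
    · simpa [StoresPred, Fin.val_ne_of_ne hne] using hv

theorem run_primaryProg (h : L.Ready B M s) (hdist : L.StoresDist s) :
    Run B M primaryProg s fun t s' => t ≤ 50 * L.edges + 7 ∧
      (∀ v ≠ L.root, L.StoresPred s' v) ∧
      ∃ b : Fin L.nodes, s'.reg Reg.best = b ∧ L.str b = T := by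
  have hM := h.big.nodes
  have hroot := L.root.2
  refine Run.seq (h.run_of_wp (τ := 2) ⟨by simp only [Expr.val, h.inp.root]; omega, fun t ht => ?_⟩)
  simp only [Expr.val, h.inp.root]
  refine (run_forEdges (h.setReg (by omega)) (by decide) (by decide) (fun k s =>
    (∀ e : Fin L.edges, e < k → L.IsPrimary e → L.StoresPred s (L.lo e)) ∧
    ∃ b : Fin L.nodes, s.reg Reg.best = b ∧
      ∀ e : Fin L.edges, e < k → (L.str (L.lo e)).length ≤ (L.str b).length) (fun _ => 0) 43
      ⟨by simp, L.root, by simp, by simp⟩ ?_).mono ?_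
  · rintro e s' hs' hf he ⟨hpred, b, hb, hmax⟩
    refine hs'.run_of_wp (τ := 43) (Prog.wp_mono (wp_primaryBody hs'
      (fun v => (congrFun (hf.mem Arr.dist (by decide)) v).trans (hdist v)) he hb) ?_)
    rintro s'' ⟨hpred', hpred'', b', hb', hmax'⟩ t ht
    refine ⟨ht, fun e' he' hprim => ?_, b', by simpa using hb', fun e' he' => ?_⟩
    · obtain hlt | heq := Nat.lt_succ_iff_lt_or_eq.1 he'
      · exact hpred'' _ (hpred e' hlt hprim)
      · obtain rfl := Fin.ext heq
        exact hpred' hprim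
    · rw [hmax']
      obtain hlt | heq := Nat.lt_succ_iff_lt_or_eq.1 he'
      · exact (hmax e' hlt).trans (le_max_left _ _)
      · obtain rfl := Fin.ext heq
        exact le_max_right _ _
  · rintro t' s' - - ⟨ht', hpred, b, hb, hmax⟩
    refine ⟨by omega, fun v hv => ?_, b, hb, L.str_eq_text (le_antisymm (L.length_str_le b) ?_)⟩
    · obtain ⟨e, rfl, hlen⟩ := L.exists_primary_edge hv
      exact hpred e e.2 hlen
    · obtain ⟨i, hi⟩ := L.exists_str_eq_text
      obtain rfl | hr := eq_or_ne i L.root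
      · simp [← hi, str_root]
      · obtain ⟨e, rfl, -⟩ := L.exists_primary_edge hr
        exact (congrArg List.length hi).symm.trans_le (hmax e e.2)

/-- The path `p` from `v` spells out the text from the end of the longest path to `v` on, and the
longest paths to its nodes are no shorter than that. -/
structure SuffixPath (L : LCDAWG T) (p : List (Fin L.edges)) (v : Fin L.nodes) : Prop where
  isPathFrom : L.IsPathFrom v p
  str_append : L.str v ++ L.pathLabel p = T
  nodup : p.Nodup
  length_le : ∀ e ∈ p, (L.str v).length ≤ (L.str (L.hi e)).length

theorem SuffixPath.nil {v : Fin L.nodes} (hv : L.str v = T) : L.SuffixPath [] v where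
  isPathFrom := trivial
  str_append := by simpa [pathLabel_nil] using hv
  nodup := List.nodup_nil
  length_le := by simp

theorem SuffixPath.cons {p : List (Fin L.edges)} {e : Fin L.edges} (hp : L.SuffixPath p (L.lo e))
    (he : L.IsPrimary e) : L.SuffixPath (e :: p) (L.hi e) := by
  have hlt := L.length_str_hi_lt e
  refine ⟨⟨rfl, hp.isPathFrom⟩, ?_, List.nodup_cons.2 ⟨fun hmem => ?_, hp.nodup⟩, fun e' he' => ?_⟩
  · rw [pathLabel_cons, ← List.append_assoc, L.str_lo_eq he, hp.str_append]
  · exact (hp.length_le e hmem).not_gt hlt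
  · obtain rfl | hmem := List.mem_cons.1 he'
    · exact le_rfl
    · exact hlt.le.trans (hp.length_le e' hmem)

theorem SuffixPath.length_le_edges {p : List (Fin L.edges)} {v : Fin L.nodes}
    (hp : L.SuffixPath p v) : p.length ≤ L.edges := by
  simpa using hp.nodup.length_le_card

/-- The productions of the variables from `2 * L.edges` to `n - 1` expand the variable `y` along
the path. -/
inductive Traced (L : LCDAWG T) (s : State α) : List (Fin L.edges) → ℕ → ℕ → Prop
  | single (e : Fin L.edges) : L.Traced s [e] e (L.edges + L.edges)
  | cons {e : Fin L.edges} {p y n} : L.Traced s p y n → s.mem Arr.kind n = 1 →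
      s.mem Arr.left n = e → s.mem Arr.right n = y → L.Traced s (e :: p) n (n + 1)

namespace Traced

variable {p : List (Fin L.edges)} {y n : ℕ}

theorem add_one_eq (h : L.Traced s p y n) : n + 1 = L.edges + L.edges + p.length := by
  induction h with
  | single => rfl
  | cons _ _ _ _ ih => rw [List.length_cons]; omega

theorem two_mul_le (h : L.Traced s p y n) : L.edges + L.edges ≤ n := by
  induction h with
  | single => exact le_rfl
  | cons _ _ _ _ ih => exact ih.trans (Nat.le_succ _)

theorem lt (h : L.Traced s p y n) : y < n := by
  cases h with
  | single e => exact e.2.trans_le (Nat.le_add_left _ _)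
  | cons => exact Nat.lt_succ_self _

theorem congr (h : L.Traced s p y n) (hs : ∀ i < n, SameRule s s' i) : L.Traced s' p y n := by
  induction h with
  | single e => exact .single e
  | @cons e p y n _ hkind hleft hright ih =>
    have hrule := hs n (Nat.lt_succ_self n)
    exact .cons (ih fun i hi => hs i (Nat.lt_succ_of_lt hi)) (hrule.1.trans hkind)
      (hrule.2.1.trans hleft) (hrule.2.2.trans hright)

end Traced

/-- The invariant of the loop in `traceProg`: the path `p` from `v` has been traced. -/
structure TraceInv (L : LCDAWG T) (s : State α) (p : List (Fin L.edges)) (v : Fin L.nodes) :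
    Prop where
  node : s.reg Reg.node = v
  traced : L.Traced s p (s.reg Reg.rest) (s.reg Reg.var)
  suffixPath : L.SuffixPath p v

theorem wp_traceInit (h : L.Ready B M s) {e : Fin L.edges} {b : Fin L.nodes}
    (hb : s.reg Reg.best = b) (hbe : s.mem Arr.pred b = e) (hlo : L.lo e = b)
    (he : L.IsPrimary e) (hT : L.str b = T) :
    traceInit.wp M s fun s' => L.TraceInv s' [e] (L.hi e) ∧ s'.mem = s.mem := by
  have hM := h.big.edges
  have hMn := h.big.nodes
  have hhi := (L.hi e).2
  simp only [traceInit, Prog.wp, Expr.val, State.reg_setReg, State.mem_setReg, hb, hbe, h.inp.hi,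
    h.inp.edges, if_true, Reg.edge, Reg.edges, Reg.rest, Reg.node, Nat.reduceEqDiff, if_false]
  refine ⟨by omega, by omega, by omega, by omega, ⟨by simp, ?_, ?_⟩, trivial⟩
  · simpa using Traced.single e
  · exact (SuffixPath.nil (hlo.symm ▸ hT)).cons he

theorem wp_traceBody (h : L.Ready B M s) {p : List (Fin L.edges)} {e : Fin L.edges}
    (hinv : L.TraceInv s p (L.lo e)) (he : L.IsPrimary e) (hpred : s.mem Arr.pred (L.lo e) = e) :
    traceBody.wp M s fun s' =>
      L.TraceInv s' (e :: p) (L.hi e) ∧ ∀ i < L.edges + L.edges, SameRule s s' i := by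
  have hM := h.big.edges
  have hMn := h.big.nodes
  have hhi := (L.hi e).2
  obtain ⟨hnode, htraced, hsuffix⟩ := hinv
  have hsuffix' := hsuffix.cons he
  have hlength : p.length + 1 ≤ L.edges := hsuffix'.length_le_edges
  have hvar := htraced.add_one_eq
  have htwo := htraced.two_mul_le
  have hrest := htraced.lt
  generalize hy : s.reg Reg.rest = y at htraced hrest
  generalize hn : s.reg Reg.var = n at htraced hrest hvar htwo
  simp only [traceBody, writeRule, Prog.wp, Expr.val, State.reg_setReg, State.mem_setReg,
    State.reg_setMem, State.mem_setMem, hnode, hpred, hn, hy, h.inp.hi, if_true, Reg.edge, Reg.rest,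
    Reg.var, Arr.hi, Arr.kind, Arr.left, Arr.right, Nat.reduceEqDiff, if_false]
  refine ⟨by omega, by omega, by omega, by omega, by omega, by omega, by omega,
    ⟨by simp, ?_, hsuffix'⟩, fun i hi => ?_⟩
  · simp only [State.reg_setReg, Reg.node, if_true]
    refine .cons (y := y) (htraced.congr fun i hi => ?_) (by simp) (by simp) (by simp)
    simp [SameRule, hi.ne]
  · simp [SameRule, (hi.trans_le htwo).ne]

theorem run_traceLoop (h : L.Ready B M s) (hdist : L.StoresDist s)
    (hpred : ∀ v ≠ L.root, L.StoresPred s v) {e : Fin L.edges} (hinv : L.TraceInv s [e] (L.hi e)) :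
    Run B M traceLoop s fun t s' => t ≤ 40 * L.edges + 5 ∧
      (∀ i < L.edges + L.edges, SameRule s s' i) ∧ ∃ p, L.TraceInv s' p L.root := by
  have hdist' {s' : State α} (hmem : s'.mem Arr.dist = s.mem Arr.dist) (v : Fin L.nodes) :
      s'.mem Arr.dist v = (L.str v).length :=
    (congrFun hmem v).trans (hdist v)
  refine (Run.loop (n := 40 * L.edges) h.big.word (by decide)
    (fun n s' => ∃ p v, L.TraceInv s' p v ∧ (∀ i < L.edges + L.edges, SameRule s s' i) ∧
      n = 40 * (L.edges + 1 - p.length)) h.bdd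
    ⟨[e], L.hi e, hinv, fun i _ => ⟨rfl, rfl, rfl⟩, rfl⟩ ?_).mono ?_
  · rintro n s' hs' hf ⟨p, v, hinv, hrule, rfl⟩ hlt
    simp only [Test.Holds, Expr.val, hinv.node, hdist' (hf.mem Arr.dist (by decide)) v] at hlt
    obtain ⟨e, hpred, rfl, he⟩ := hpred v (by rintro rfl; simp [str_root] at hlt)
    have hlength := (hinv.suffixPath.cons he).length_le_edges
    rw [List.length_cons] at hlength
    have hpred' : s'.mem Arr.pred (L.lo e) = e :=
      (congrFun (hf.mem Arr.pred (by decide)) _).trans hpred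
    have h' := h.frame hs' hf (by decide)
    refine h'.run_of_wp (τ := 30) (Prog.wp_mono (wp_traceBody h' hinv he hpred')
      fun s'' hs'' t ht => ⟨_, ?_, e :: p, L.hi e, hs''.1, fun i hi =>
        (hrule i hi).trans (hs''.2 i hi), rfl⟩)
    simp only [Test.cost, Expr.cost, List.length_cons]
    omega
  · rintro t s' - hf ⟨n, hn, ⟨p, v, hinv, hrule, rfl⟩, hge⟩
    simp only [Test.Holds, Expr.val, hinv.node, hdist' (hf.mem Arr.dist (by decide)) v,
      not_lt] at hge
    obtain rfl : v = L.root := by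
      by_contra hv
      obtain ⟨e, rfl, -⟩ := L.exists_primary_edge hv
      exact (hge.trans (Nat.zero_le _)).not_gt (L.length_str_hi_lt e)
    simp only [Test.cost, Expr.cost] at hn
    exact ⟨by omega, hrule, p, hinv⟩

theorem run_traceProg (h : L.Ready B M s) (hT : T ≠ []) (hdist : L.StoresDist s)
    (hpred : ∀ v ≠ L.root, L.StoresPred s v) {b : Fin L.nodes} (hb : s.reg Reg.best = b)
    (hbT : L.str b = T) :
    Run B M traceProg s fun t s' => t ≤ 40 * L.edges + 24 ∧
      (∀ i < L.edges + L.edges, SameRule s s' i) ∧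
      ∃ p, L.IsPathFrom L.root p ∧ L.pathLabel p = T ∧ p.length ≤ L.edges ∧
        L.Traced s' p (s'.reg Reg.start) (s'.reg Reg.size) := by
  obtain ⟨e, hbe, hlo, he⟩ := hpred b (by rintro rfl; exact hT (hbT ▸ L.str_root))
  refine Run.seq ((h.run_of_wp (τ := 15) (Prog.wp_mono (wp_traceInit h hb hbe hlo he hbT)
    fun s' hs' t ht => And.intro ht hs')).mono ?_)
  rintro t₁ s₁ hs₁ hf₁ ⟨ht₁, hinv₁, hmem₁⟩
  have h₁ := h.frame hs₁ hf₁ (by decide)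
  refine Run.seq ((run_traceLoop h₁ (fun v => hmem₁ ▸ hdist v)
    (fun v hv => by simpa only [StoresPred, hmem₁] using hpred v hv) hinv₁).mono ?_)
  rintro t₂ s₂ hs₂ hf₂ ⟨ht₂, hrule, p, hinv⟩
  refine (h₁.frame hs₂ hf₂ (by decide)).run_of_wp (τ := 4) ⟨hs₂.1 _, hs₂.1 _, fun t ht =>
    ⟨by omega, fun i hi => ?_, p, hinv.suffixPath.isPathFrom, ?_,
      hinv.suffixPath.length_le_edges, hinv.traced.congr fun _ _ => ⟨rfl, rfl, rfl⟩⟩⟩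
  · simpa only [SameRule, hmem₁, State.mem_setReg] using hrule i hi
  · simpa [str_root] using hinv.suffixPath.str_append

end LCDAWG

end TextPath

/-! ### The straight-line program -/

section Extraction

variable {α : Type*}

theorem SLP.exists_of_state (s : State α) {n y : ℕ} (hy : y < n) (rank : ℕ → ℕ)
    (h : ∀ i < n, (∃ a, HasLetter s i a) ∨ s.mem Arr.kind i = 1 ∧
      ∀ j ∈ [s.mem Arr.left i, s.mem Arr.right i], j < n ∧ rank j < rank i) :
    ∃ R : SLP α, R.size = n ∧ R.start = y ∧
      (∀ i a, R.rule i = Sum.inl a ↔ HasLetter s i a) ∧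
      ∀ i j k, R.rule i = Sum.inr (j, k) ↔
        s.mem Arr.kind i = 1 ∧ s.mem Arr.left i = j ∧ s.mem Arr.right i = k := by
  have hrule (i : Fin n) : ∃ r : α ⊕ (Fin n × Fin n), (∀ a, r = Sum.inl a ↔ HasLetter s i a) ∧
      ∀ j k, r = Sum.inr (j, k) ↔
        s.mem Arr.kind i = 1 ∧ s.mem Arr.left i = j ∧ s.mem Arr.right i = k := by
    obtain ⟨a, ha⟩ | ⟨hkind, hlt⟩ := h i i.2
    · exact ⟨Sum.inl a, by simp [HasLetter, ha.1, ha.2], by simp [ha.1]⟩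
    · exact ⟨Sum.inr (⟨s.mem Arr.left i, (hlt _ (by simp)).1⟩,
          ⟨s.mem Arr.right i, (hlt _ (by simp)).1⟩),
        by simp [HasLetter, hkind], by simp [hkind, Fin.ext_iff]⟩
  choose rule hletter hpair using hrule
  have hacyclic : WellFounded fun j i : Fin n =>
      ∃ k, rule i = Sum.inr (j, k) ∨ rule i = Sum.inr (k, j) := by
    refine Subrelation.wf ?_ (InvImage.wf (fun i : Fin n => rank i) wellFounded_lt)
    rintro j i ⟨k, hk⟩
    have hi : s.mem Arr.kind i = 1 ∧ (j : ℕ) ∈ [s.mem Arr.left i, s.mem Arr.right i] := by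
      obtain hk | hk := hk <;> obtain ⟨hkind, hleft, hright⟩ := (hpair _ _ _).1 hk <;>
        simp [hkind, hleft, hright]
    obtain ⟨a, hkind, -⟩ | ⟨-, hlt⟩ := h i i.2
    · exact absurd (hkind.symm.trans hi.1) zero_ne_one
    · exact (hlt j hi.2).2
  exact ⟨⟨n, rule, ⟨y, hy⟩, hacyclic⟩, rfl, rfl, hletter, hpair⟩

theorem SLP.Expands.phrase_eq {R : SLP α} {E : Type*} {X : E → Fin R.size} {v : Fin R.size}
    {p : List E} (h : R.Expands X v p) : R.phrase v = p.flatMap fun e => R.phrase (X e) := by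
  induction h with
  | single e => simp
  | cons hrule _ ih => rw [R.phrase_inr hrule, ih, List.flatMap_cons]

/-- The productions in memory expand the variable `i` along the path.  The variable of an edge is
the number of the edge. -/
inductive Spells (s : State α) {m : ℕ} : List (Fin m) → ℕ → Prop
  | single (e : Fin m) : Spells s [e] e
  | cons {e : Fin m} {p : List (Fin m)} {i j : ℕ} : s.mem Arr.kind i = 1 → s.mem Arr.left i = e →
      s.mem Arr.right i = j → Spells s p j → Spells s (e :: p) i

theorem Spells.expands {s : State α} {m : ℕ} {R : SLP α} {X : Fin m → Fin R.size}
    (hX : ∀ e, (X e : ℕ) = e)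
    (hlt : ∀ i < R.size, s.mem Arr.kind i = 1 → s.mem Arr.right i < R.size)
    (hrule : ∀ i j k, R.rule i = Sum.inr (j, k) ↔
      s.mem Arr.kind i = 1 ∧ s.mem Arr.left i = j ∧ s.mem Arr.right i = k)
    {p : List (Fin m)} {i : ℕ} (hp : Spells s p i) {v : Fin R.size} (hv : (v : ℕ) = i) :
    R.Expands X v p := by
  induction hp generalizing v with
  | single e =>
    obtain rfl : v = X e := Fin.ext (hv.trans (hX e).symm)
    exact .single e
  | @cons e p i j hkind hleft hright _ ih =>
    subst hv
    have hj : j < R.size := hright ▸ hlt v v.2 hkind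
    exact .cons (y := ⟨j, hj⟩) ((hrule _ _ _).2 ⟨hkind, hleft.trans (hX e).symm, hright⟩) (ih rfl)

end Extraction

section Result

/-- Stores the productions of the variables of edges and of strings down to type-1 nodes. -/
def edgeProg : Prog := tailProg ;; headProg ;; jumpProg

/-- Stores the productions for the text. -/
def textProg : Prog := degProg ;; orderProg ;; primaryProg ;; traceProg

/-- Constructs the straight-line program of an L-CDAWG. -/
def slpProg : Prog := edgeProg ;; textProg

variable {α : Type*} [LinearOrder α] {T : List α}

namespace LCDAWG

variable {L : LCDAWG T} {s : State α} {B M : ℕ}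

/-- The straight-line program `R` has the variable `X e` for each edge `e`, and its productions
follow the jump links and the path that spells out the text. -/
structure Compresses (L : LCDAWG T) (R : SLP α) (X : Fin L.edges → Fin R.size) : Prop where
  injective : Function.Injective X
  rule_eq : ∀ e, L.slen e = 1 → R.rule (X e) = Sum.inl (L.chr e)
  expands : ∀ e, 2 ≤ L.slen e → ∃ p, L.IsJump e p ∧ 2 ≤ p.length ∧ R.Expands X (X e) p
  expands_start : ∃ p, L.IsPathFrom L.root p ∧ L.pathLabel p = T ∧ R.Expands X R.start p

theorem label_eq_singleton {e : Fin L.edges} (he : L.slen e = 1) : L.label e = [L.chr e] := by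
  obtain ⟨x, hx⟩ := L.label_eq_cons e
  rw [L.slen_spec, hx, List.length_cons, Nat.add_eq_right] at he
  rw [hx, List.length_eq_zero_iff.1 he]

theorem slen_lt_of_mem {e : Fin L.edges} {p : List (Fin L.edges)} (hp : 2 ≤ p.length)
    (he : e ∈ p) : L.slen e < (L.pathLabel p).length := by
  obtain ⟨q, r, rfl⟩ := List.append_of_mem he
  have hpos (f : Fin L.edges) := List.length_pos_iff.2 (L.label_ne_nil f)
  rw [pathLabel_append, pathLabel_cons, L.slen_spec]
  rcases q with - | ⟨f, q⟩ <;> rcases r with - | ⟨g, r⟩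
  · simp at hp
  all_goals
    simp only [pathLabel_cons, pathLabel_nil, List.length_append, List.length_nil]
    grind

theorem Compresses.phrase_eq {R : SLP α} {X : Fin L.edges → Fin R.size} (h : L.Compresses R X)
    (e : Fin L.edges) : R.phrase (X e) = L.label e := by
  induction hn : L.slen e using Nat.strong_induction_on generalizing e with
  | _ n ih =>
    subst hn
    obtain he | he : L.slen e = 1 ∨ 2 ≤ L.slen e := by
      have := L.slen_pos e
      omega
    · rw [R.phrase_inl (h.rule_eq e he), label_eq_singleton he]
    · obtain ⟨p, hjump, hp, hexpands⟩ := h.expands e he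
      rw [hexpands.phrase_eq, ← hjump.pathLabel_eq]
      refine List.flatMap_congr fun f hf => ih _ ?_ f rfl
      rw [L.slen_spec e, ← hjump.pathLabel_eq]
      exact slen_lt_of_mem hp hf

theorem Compresses.phrase_start {R : SLP α} {X : Fin L.edges → Fin R.size}
    (h : L.Compresses R X) : R.phrase R.start = T := by
  obtain ⟨p, -, hp, hexpands⟩ := h.expands_start
  rw [hexpands.phrase_eq]
  simp only [h.phrase_eq]
  exact hp

/-- The result of the computation, before it is read as a straight-line program. -/
structure Output (L : LCDAWG T) (s : State α) : Prop where
  tail : ∀ e, L.StoresTail s e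
  edge : ∀ e, L.StoresEdge s e
  text : ∃ p, L.IsPathFrom L.root p ∧ L.pathLabel p = T ∧ p.length ≤ L.edges ∧
    L.Traced s p (s.reg Reg.start) (s.reg Reg.size)

/-- The measure that shows that the productions have no loops: the length of the phrase for the
variables of edges and of strings down to type-1 nodes, and a larger number for the variables of the
path that spells out the text. -/
noncomputable def varRank (L : LCDAWG T) (i : ℕ) : ℕ :=
  if h : i < L.edges then L.slen ⟨i, h⟩
  else if h : i - L.edges < L.edges then
    L.slen ⟨i - L.edges, h⟩ + (L.rest (L.lo ⟨i - L.edges, h⟩)).length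
  else T.length + i

theorem varRank_edge (e : Fin L.edges) : L.varRank e = L.slen e := dif_pos e.2

theorem varRank_tail (e : Fin L.edges) :
    L.varRank (e + L.edges) = L.slen e + (L.rest (L.lo e)).length := by
  simp [varRank]

theorem varRank_text {i : ℕ} (hi : L.edges + L.edges ≤ i) : L.varRank i = T.length + i := by
  rw [varRank, dif_neg (by omega), dif_neg (by omega)]

theorem restVar_lt (f : Fin L.edges) : L.restVar f < L.edges + L.edges := by
  unfold restVar
  split <;> omega

theorem varRank_restVar {f : Fin L.edges} (hf : L.type2 (L.hi f) = true) :
    L.varRank (L.restVar f) = (L.rest (L.hi f)).length := by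
  rw [L.rest_hi_of_type2 hf, List.length_append, ← L.slen_spec, restVar]
  split_ifs with hlo
  · exact varRank_tail f
  · rw [varRank_edge, L.rest_of_type1 (by simpa using hlo), List.length_nil, add_zero]

theorem HasRule.varRank_lt {i : ℕ} {g : Fin L.edges} (h : L.HasRule s i g)
    (hg : L.type2 (L.lo g) = true) (hi : L.varRank i = L.slen g + (L.rest (L.lo g)).length) :
    ∀ j ∈ [s.mem Arr.left i, s.mem Arr.right i],
      j < L.edges + L.edges ∧ L.varRank j < L.varRank i := by
  obtain ⟨-, hleft, f, hf, hright⟩ := h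
  rw [← hf] at hg hi
  have hrest : (L.rest (L.hi f)).length = L.slen f + (L.rest (L.lo f)).length := by
    rw [L.rest_hi_of_type2 hg, List.length_append, L.slen_spec]
  have := L.slen_pos f
  have := L.slen_pos g
  have := restVar_lt f
  simp only [hleft, hright, List.forall_mem_cons, List.not_mem_nil, false_imp_iff, implies_true,
    and_true, varRank_edge, varRank_restVar hg, hi]
  omega

theorem Traced.varRank_lt {p : List (Fin L.edges)} {y n i : ℕ} (h : L.Traced s p y n)
    (hi : L.edges + L.edges ≤ i) (hin : i < n) : s.mem Arr.kind i = 1 ∧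
      ∀ j ∈ [s.mem Arr.left i, s.mem Arr.right i], j < n ∧ L.varRank j < L.varRank i := by
  induction h with
  | single => exact absurd hi hin.not_ge
  | @cons e p y n hp hkind hleft hright ih =>
    obtain hin | rfl := Nat.lt_succ_iff_lt_or_eq.1 hin
    · exact (ih hin).imp_right fun h j hj => (h j hj).imp_left Nat.lt_succ_of_lt
    have hedge (f : Fin L.edges) : (f : ℕ) < i + 1 ∧ L.varRank f < L.varRank i := by
      rw [varRank_edge, varRank_text hi]
      have := L.slen_le f
      omega
    refine ⟨hkind, ?_⟩
    simp only [hleft, hright, List.forall_mem_cons, List.not_mem_nil, false_imp_iff, implies_true,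
      and_true]
    refine ⟨hedge e, ?_⟩
    cases hp with
    | single f => exact hedge f
    | @cons _ _ _ m hp =>
      rw [varRank_text hi, varRank_text hp.two_mul_le]
      omega

theorem Output.hasLetter (h : L.Output s) {e : Fin L.edges} (he : L.slen e = 1) :
    HasLetter s e (L.chr e) :=
  ⟨((h.edge e).resolve_right fun h => absurd h.1 (by omega)).2, (h.tail e).2.1⟩

theorem Output.exists_hasRule (h : L.Output s) {e : Fin L.edges} (he : 2 ≤ L.slen e) :
    ∃ g, L.IsJumpHead e g ∧ L.HasRule s e g :=
  ((h.edge e).resolve_left fun h => absurd h.1 (by omega)).2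

theorem Output.varRank_lt (h : L.Output s) {i : ℕ} (hi : i < s.reg Reg.size) :
    (∃ a, HasLetter s i a) ∨ s.mem Arr.kind i = 1 ∧
      ∀ j ∈ [s.mem Arr.left i, s.mem Arr.right i],
        j < s.reg Reg.size ∧ L.varRank j < L.varRank i := by
  obtain ⟨p, -, -, -, htraced⟩ := h.text
  have hrule {g : Fin L.edges} (hg : L.type2 (L.lo g) = true) (hr : L.HasRule s i g)
      (hi : L.varRank i = L.slen g + (L.rest (L.lo g)).length) := And.intro hr.1 fun j hj =>
    (hr.varRank_lt hg hi j hj).imp_left htraced.two_mul_le.trans_lt'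
  by_cases hedge : i < L.edges
  · lift i to Fin L.edges using hedge with e
    obtain he | he : L.slen e = 1 ∨ 2 ≤ L.slen e := by
      have := L.slen_pos e
      omega
    · exact .inl ⟨_, h.hasLetter he⟩
    · obtain ⟨g, hg, hr⟩ := h.exists_hasRule he
      refine .inr (hrule hg.type2_lo hr ?_)
      rw [varRank_edge, L.slen_spec, hg.label_eq, List.length_append, L.slen_spec]
  by_cases htail : i < L.edges + L.edges
  · obtain ⟨e, rfl⟩ : ∃ e : Fin L.edges, i = e + L.edges :=
      ⟨⟨i - L.edges, by omega⟩, (Nat.sub_add_cancel (not_lt.1 hedge)).symm⟩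
    have he := (h.tail e).2.2
    split_ifs at he with hlo
    · exact .inr (hrule hlo he (varRank_tail e))
    · exact .inl ⟨_, he⟩
  · exact .inr (htraced.varRank_lt (not_lt.1 htail) hi)

theorem Chain.spells (h : ∀ e, L.StoresTail s e) {i : Fin L.nodes} {q : List (Fin L.edges)}
    (hq : L.Chain i q) (hi : L.type2 i = true) {f : Fin L.edges} (hf : L.hi f = i) :
    Spells s q (L.restVar f) := by
  induction hq generalizing f with
  | nil h1 => exact absurd (h1.symm.trans hi) Bool.false_ne_true
  | @cons e q he hq ih =>
    obtain rfl := L.eq_of_hi_eq_of_type2 he hf.symm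
    have hrule := (h e).2.2
    unfold restVar
    split_ifs at hrule ⊢ with hlo
    · obtain ⟨hkind, hleft, f, hf, hright⟩ := hrule
      exact .cons hkind hleft hright (ih hlo hf)
    · obtain rfl := hq.unique (.nil (by simpa using hlo))
      exact .single e

theorem Traced.spells {p : List (Fin L.edges)} {y n : ℕ} (h : L.Traced s p y n) :
    Spells s p y := by
  induction h with
  | single e => exact .single e
  | cons _ hkind hleft hright ih => exact .cons hkind hleft hright ih

theorem Output.exists_slp (h : L.Output s) : ∃ (R : SLP α) (X : Fin L.edges → Fin R.size),
    s.Stores R X ∧ R.size ≤ 3 * L.edges ∧ L.Compresses R X := by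
  obtain ⟨p, hp, hpT, hlength, htraced⟩ := h.text
  obtain ⟨R, hsize, hstart, hletter, hpair⟩ :=
    SLP.exists_of_state s htraced.lt L.varRank fun _ => h.varRank_lt
  have hadd := htraced.add_one_eq
  have htwo := htraced.two_mul_le
  let X (e : Fin L.edges) : Fin R.size := ⟨e, by omega⟩
  have hspells {p : List (Fin L.edges)} {v : Fin R.size} (hv : Spells s p v) :
      R.Expands X v p := by
    refine hv.expands (X := X) (v := v) (fun _ => rfl) (fun i hi hkind => ?_) hpair rfl
    obtain ⟨a, hzero, -⟩ | ⟨-, hlt⟩ := h.varRank_lt (hsize ▸ hi)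
    · exact absurd (hzero.symm.trans hkind) zero_ne_one
    · exact hsize ▸ (hlt _ (by simp)).1
  refine ⟨R, X, ⟨hsize.symm, hstart.symm, fun i a => (hletter i a).1,
    fun i j k => (hpair i j k).1, fun e => (h.tail e).1⟩, by omega,
    ⟨fun e f hef => Fin.ext (Fin.mk.inj hef), fun e he => (hletter _ _).2 (h.hasLetter he),
      fun e he => ?_, p, hp, hpT, hspells (hstart ▸ htraced.spells)⟩⟩
  obtain ⟨g, hg, hkind, hleft, f, hf, hright⟩ := h.exists_hasRule he
  have hlo := hg.type2_lo
  obtain ⟨q, hq, hjump, hchain⟩ := hg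
  have hpos := List.length_pos_iff.2 hq
  exact ⟨g :: q, hjump, Nat.succ_le_succ hpos,
    hspells (v := X e) (.cons hkind hleft hright (hchain.spells h.tail hlo hf))⟩

theorem bdd_initState (h : L.Big B M) : L.initState.Bdd M := by
  have hedges := h.edges
  have hnodes := h.nodes
  refine ⟨fun r => ?_, fun a i => ?_⟩
  · match r with
    | 0 => exact hnodes
    | 1 => exact (by omega : L.edges ≤ M)
    | 2 => exact L.root.2.le.trans hnodes
    | _ + 3 => exact Nat.zero_le _
  · have hcells {n : ℕ} (f : Fin n → ℕ) (hf : ∀ i, f i ≤ M) : cells 0 f i ≤ M := by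
      unfold cells
      split
      · exact hf _
      · exact Nat.zero_le _
    match a with
    | 0 => exact hcells (fun i => if L.type2 i then 1 else 0) fun i => by split <;> omega
    | 1 => exact hcells _ fun i => (L.slink i).2.le.trans hnodes
    | 2 => exact hcells _ fun i => by have := L.out_le i; omega
    | 3 => exact hcells _ fun i => by have := L.out_le i; omega
    | 4 => exact hcells _ fun e => (L.hi e).2.le.trans hnodes
    | 5 => exact hcells _ fun e => (L.lo e).2.le.trans hnodes
    | 6 => exact hcells _ fun e => (L.slen_le e).trans h.length
    | _ + 7 => exact Nat.zero_le _

theorem run_edgeProg (h : L.Ready B M s) {D : ℕ} (hD : ∀ i, L.deg i ≤ D) :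
    Run B M edgeProg s fun t s' => t ≤ (20 * Nat.clog 2 D + 250) * L.edges + 15 ∧
      (∀ e, L.StoresTail s' e) ∧ ∀ e, L.StoresEdge s' e := by
  refine Run.seq ((run_tailProg h).mono ?_)
  rintro t₁ s₁ hs₁ hf₁ ⟨ht₁, htail⟩
  have h₁ := h.frame hs₁ hf₁ (by decide)
  refine Run.seq ((run_headProg h₁ hD).mono ?_)
  rintro t₂ s₂ hs₂ hf₂ ⟨ht₂, hhead, hsame₂⟩
  refine (run_jumpProg (h₁.frame hs₂ hf₂ (by decide)) hhead).mono ?_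
  rintro t₃ s₃ - hf₃ ⟨ht₃, hedge, hsame₃⟩
  refine ⟨by linarith, fun e => (htail e).congr ?_ ?_ fun i _ => ?_, hedge⟩
  · rw [hf₃.mem _ (by decide), hf₂.mem _ (by decide)]
  · exact (hsame₂ _ (Nat.le_add_left _ _)).trans (hsame₃ _ (Nat.le_add_left _ _))
  · rw [hf₃.chr _ (by decide), hf₂.chr _ (by decide)]

theorem run_textProg (h : L.Ready B M s) (hT : T ≠ []) (hindeg : ∀ i, s.mem Arr.indeg i = 0)
    (hdist : ∀ i, s.mem Arr.dist i = 0) :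
    Run B M textProg s fun t s' => t ≤ 214 * L.edges + 88 ∧
      (∀ i < L.edges + L.edges, SameRule s s' i) ∧
      ∃ p, L.IsPathFrom L.root p ∧ L.pathLabel p = T ∧ p.length ≤ L.edges ∧
        L.Traced s' p (s'.reg Reg.start) (s'.reg Reg.size) := by
  refine Run.seq ((run_degProg h hindeg).mono ?_)
  rintro t₁ s₁ hs₁ hf₁ ⟨ht₁, hpending⟩
  have h₁ := h.frame hs₁ hf₁ (by decide)
  refine Run.seq ((run_orderProg h₁ hpending fun i => ?_).mono ?_)
  · rw [hf₁.mem _ (by decide), hdist]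
  rintro t₂ s₂ hs₂ hf₂ ⟨ht₂, hdist₂⟩
  have h₂ := h₁.frame hs₂ hf₂ (by decide)
  refine Run.seq ((run_primaryProg h₂ hdist₂).mono ?_)
  rintro t₃ s₃ hs₃ hf₃ ⟨ht₃, hpred, b, hb, hbT⟩
  have hdist₃ : L.StoresDist s₃ := fun v =>
    (congrFun (hf₃.mem Arr.dist (by decide)) v).trans (hdist₂ v)
  refine (run_traceProg (h₂.frame hs₃ hf₃ (by decide)) hT hdist₃ hpred hb hbT).mono ?_
  rintro t₄ s₄ - - ⟨ht₄, hsame, htext⟩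
  have := L.nodes_le
  refine ⟨by omega, fun i hi => ?_, htext⟩
  have hmem : ∀ a ∈ [Arr.kind, Arr.left, Arr.right], s₃.mem a = s.mem a := by
    intro a ha
    fin_cases ha <;>
      rw [hf₃.mem _ (by decide), hf₂.mem _ (by decide), hf₁.mem _ (by decide)]
  have hsame₃ : SameRule s s₃ i := by simp [SameRule, hmem]
  exact hsame₃.trans (hsame i hi)

theorem run_slpProg (h : L.Big B M) (hT : T ≠ []) {D : ℕ} (hD : ∀ i, L.deg i ≤ D) :
    Run B M slpProg L.initState fun t s =>
      t ≤ (20 * Nat.clog 2 D + 464) * L.edges + 103 ∧ L.Output s := by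
  have hready : L.Ready B M L.initState := ⟨h, L.bdd_initState h, L.inp_initState⟩
  refine Run.seq ((run_edgeProg hready hD).mono ?_)
  rintro t₁ s₁ hs₁ hf₁ ⟨ht₁, htail, hedge⟩
  refine (run_textProg (hready.frame hs₁ hf₁ (by decide)) hT
    (fun i => congrFun (hf₁.mem Arr.indeg (by decide)) i)
    (fun i => congrFun (hf₁.mem Arr.dist (by decide)) i)).mono ?_
  rintro t₂ s₂ - hf₂ ⟨ht₂, hsame, htext⟩
  refine ⟨by linarith, fun e => (htail e).congr ?_ (hsame _ (by omega)) fun i _ => ?_,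
    fun e => (hedge e).congr (hsame e (by omega)), htext⟩
  · rw [hf₂.mem _ (by decide)]
  · rw [hf₂.chr _ (by decide)]

theorem big_of_length (L : LCDAWG T) (hT : T ≠ []) {C : ℕ} (hC : 7 ≤ C) :
    L.Big ((T.length + 1) ^ C) (8 * (T.length + 1) ^ 2) := by
  have hlength : 1 ≤ T.length := List.length_pos_iff.2 hT
  have hedges := L.edges_le.trans numExt_le
  have hnodes := L.nodes_le
  have hfour : 2 ^ 2 ≤ (T.length + 1) ^ 2 := Nat.pow_le_pow_left (by omega) 2
  have hsq : T.length + 1 ≤ (T.length + 1) ^ 2 := Nat.le_self_pow two_ne_zero _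
  refine ⟨⟨by omega, ?_⟩, by omega, by omega, by omega⟩
  calc 4 * (8 * (T.length + 1) ^ 2) = 2 ^ 5 * (T.length + 1) ^ 2 := by ring
    _ ≤ (T.length + 1) ^ 5 * (T.length + 1) ^ 2 := by gcongr; omega
    _ = (T.length + 1) ^ 7 := by ring
    _ ≤ (T.length + 1) ^ C := Nat.pow_le_pow_right (Nat.succ_pos _) hC

end LCDAWG

theorem one_le_logb {σ : ℕ} (hσ : 2 ≤ σ) : 1 ≤ Real.logb 2 σ := by
  rw [Real.le_logb_iff_rpow_le one_lt_two (by positivity), Real.rpow_one]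
  exact_mod_cast hσ

theorem clog_le_two_mul_logb {σ : ℕ} (hσ : 2 ≤ σ) : (Nat.clog 2 σ : ℝ) ≤ 2 * Real.logb 2 σ := by
  have hlog := one_le_logb hσ
  calc (Nat.clog 2 σ : ℝ) = ⌈Real.logb 2 σ⌉₊ := by simpa using (Real.natCeil_logb_natCast 2 σ).symm
    _ ≤ Real.logb 2 σ + 1 := (Nat.ceil_lt_add_one (zero_le_one.trans hlog)).le
    _ ≤ 2 * Real.logb 2 σ := by linarith

end Result

end Algorithm

end LinCDAWG

open LinCDAWG in
theorem mainTheorem3_general :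
    ∃ (P : Prog) (C : ℕ), ∀ (α : Type*) [LinearOrder α] (T : List α), T ≠ [] → ∀ σ : ℕ, 2 ≤ σ →
      T.toFinset.card ≤ σ → ∀ L : LCDAWG T,
        ∃ (t : ℕ) (s : State α) (R : SLP α) (X : Fin L.edges → Fin R.size),
          Exec ((T.length + 1) ^ C) P L.initState t s ∧
          s.Stores R X ∧
          (t : ℝ) ≤ C * numExt T * Real.logb 2 σ ∧
          R.size ≤ C * numExt T ∧
          L.Compresses R X := by
  refine ⟨slpProg, 607, fun α _ T hT σ hσ hcard L => ?_⟩
  obtain ⟨t, s, hexec, -, -, ht, houtput⟩ := LCDAWG.run_slpProg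
    (L.big_of_length hT (by norm_num : 7 ≤ 607)) hT fun i => (L.deg_le_card_toFinset i).trans hcard
  obtain ⟨R, X, hstores, hsize, hcompresses⟩ := houtput.exists_slp
  have hedges := L.edges_le
  refine ⟨t, s, R, X, hexec, hstores, ?_, by omega, hcompresses⟩
  have hlog := one_le_logb hσ
  have hpos : (1 : ℝ) ≤ L.edges := mod_cast L.edges_pos hT
  calc (t : ℝ) ≤ (20 * Nat.clog 2 σ + 464) * L.edges + 103 := mod_cast ht
    _ ≤ (20 * Nat.clog 2 σ + 567) * L.edges := by linarith
    _ ≤ 607 * Real.logb 2 σ * L.edges := by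
      gcongr
      linarith [clog_le_two_mul_logb hσ]
    _ ≤ 607 * Real.logb 2 σ * numExt T := by gcongr
    _ = (607 : ℕ) * numExt T * Real.logb 2 σ := by push_cast; ring

open LinCDAWG in
/-- One program, for all ordered alphabets and all texts, constructs from the L-CDAWG of `T` a
straight-line program for all edge labels and for `T`. -/
theorem mainTheorem3 :
    ∃ (P : Prog) (C : ℕ), ∀ (α : Type*) [Fintype α] [LinearOrder α], 2 ≤ Fintype.card α →
      ∀ T : List α, HasEndMarker T → ∀ L : LCDAWG T,
        ∃ (t : ℕ) (s : State α) (R : SLP α) (X : Fin L.edges → Fin R.size),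
          -- the program halts after `t` steps with `R` and `X` in memory, on words of `O(log |T|)` bits
          Exec ((T.length + 1) ^ C) P L.initState t s ∧
          s.Stores R X ∧
          (t : ℝ) ≤ C * numExt T * Real.logb 2 (Fintype.card α) ∧
          R.size ≤ C * numExt T ∧
          -- the straight-line program produces all edge labels and the text
          (∀ e, R.phrase (X e) = L.label e) ∧
          R.phrase R.start = T ∧
          -- its productions follow the jump links and the path that spells out the text
          Function.Injective X ∧
          (∀ e, L.slen e = 1 → R.rule (X e) = Sum.inl (L.chr e)) ∧
          (∀ e, 2 ≤ L.slen e → ∃ p, L.IsJump e p ∧ 2 ≤ p.length ∧ R.Expands X (X e) p) ∧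
          (∃ p, L.IsPathFrom L.root p ∧ L.pathLabel p = T ∧ R.Expands X R.start p) := by
  obtain ⟨P, C, h⟩ := mainTheorem3_general
  refine ⟨P, C, fun α _ _ hσ T ⟨w, d, hT, _⟩ L => ?_⟩
  obtain ⟨t, s, R, X, hexec, hstores, ht, hsize, hcompresses⟩ :=
    h α T (by simp [hT]) (Fintype.card α) hσ T.toFinset.card_le_univ L
  exact ⟨t, s, R, X, hexec, hstores, ht, hsize, hcompresses.phrase_eq, hcompresses.phrase_start,
    hcompresses.injective, hcompresses.rule_eq, hcompresses.expands, hcompresses.expands_start⟩
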